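/- Let $(M,g)$ be a Zoll surface: a compact smooth surface without boundary (in the classical setting $M=S^2$) with a smooth Riemannian metric $g$ all of whose geodesics are closed and of the same length, the length of a closed geodesic being its least positive period with respect to arc length. Let $\tau$ be the Gauss curvature of $g$, let $\gamma$ be a closed geodesic of $(M,g)$ parametrized by arc length $s$, with period $L>0$ (least or not), let $\nu$ be a parallel unit normal vector field along $\gamma$, and put $\tau_\nu(s)=d\tau_{\gamma(s)}(\nu(s))$. Then, for any two real or complex normal Jacobi fields $y\,\nu$ and $y_2\,\nu$ along $\gamma$, that is, for any solutions $y,y_2$ on $\mathbb{R}$ of Jacobi's equation $$y''(s)+\tau(\gamma(s))\,y(s)=0,$$ one has $$\int_\gamma \tau_\nu\, y^2\, y_2\, ds=\int_0^L \tau_\nu(s)\,y(s)^2\,y_2(s)\,ds=0 .$$ -/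

import Mathlib

open scoped Manifold ContDiff

noncomputable section

/-- The model space of surfaces. -/
abbrev Plane : Type := EuclideanSpace ℝ (Fin 2)

/-- A smooth Riemannian metric on the (smooth) surface `M`. -/
abbrev SurfaceMetric (M : Type*) [TopologicalSpace M] [ChartedSpace Plane M]
    [IsManifold (𝓡 2) ∞ M] : Type _ :=
  Bundle.ContMDiffRiemannianMetric (𝓡 2) ∞ Plane (fun x : M => TangentSpace (𝓡 2) x)

/-- The partial derivative `∂ᵢ f (u)` of a function on the plane. -/
def partialDeriv (i : Fin 2) (f : Plane → ℝ) (u : Plane) : ℝ :=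
  fderiv ℝ f u (EuclideanSpace.single i (1 : ℝ))

namespace SurfaceMetric

variable {M : Type*} [TopologicalSpace M] [ChartedSpace Plane M] [IsManifold (𝓡 2) ∞ M]

/-- The coordinate vector field `∂ᵢ` of the chart at `p`, at the point with coordinates `u`. -/
def coordVec (p : M) (i : Fin 2) (u : Plane) :
    TangentSpace (𝓡 2) ((extChartAt (𝓡 2) p).symm u) :=
  mfderiv 𝓘(ℝ, Plane) (𝓡 2) (extChartAt (𝓡 2) p).symm u (EuclideanSpace.single i (1 : ℝ) : Plane)

/-- The matrix `(g_ij)` of the metric in the chart at `p`, at the point with coordinates `u`. -/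
def metricMatrix (g : SurfaceMetric M) (p : M) (u : Plane) : Matrix (Fin 2) (Fin 2) ℝ :=
  Matrix.of fun i j =>
    g.inner ((extChartAt (𝓡 2) p).symm u) (coordVec p i u) (coordVec p j u)

/-- The Christoffel symbol
`Γᵏ_ij = (1/2) ∑_l gᵏˡ (∂_i g_jl + ∂_j g_il - ∂_l g_ij)` in the chart at `p`. -/
def christoffel (g : SurfaceMetric M) (p : M) (k i j : Fin 2) (u : Plane) : ℝ :=
  (1 / 2 : ℝ) * ∑ l, (g.metricMatrix p u)⁻¹ k l *
    (partialDeriv i (fun w => g.metricMatrix p w j l) u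
      + partialDeriv j (fun w => g.metricMatrix p w i l) u
      - partialDeriv l (fun w => g.metricMatrix p w i j) u)

/-- The `l`-th component, in the chart at `p`, of the Riemann curvature tensor
`R(∂_i, ∂_j) ∂_k = ∇_i ∇_j ∂_k - ∇_j ∇_i ∂_k`. -/
def riemann (g : SurfaceMetric M) (p : M) (l k i j : Fin 2) (u : Plane) : ℝ :=
  partialDeriv i (g.christoffel p l j k) u - partialDeriv j (g.christoffel p l i k) u
    + ∑ m, (g.christoffel p l i m u * g.christoffel p m j k u
      - g.christoffel p l j m u * g.christoffel p m i k u)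

/-- The Gauss curvature `τ(x) = g(R(∂₀, ∂₁) ∂₁, ∂₀) / det (g_ij)`, computed in the chart at `x`. -/
def gaussCurvature (g : SurfaceMetric M) (x : M) : ℝ :=
  (∑ l, g.metricMatrix x (extChartAt (𝓡 2) x x) 0 l * g.riemann x l 1 0 1 (extChartAt (𝓡 2) x x))
    / (g.metricMatrix x (extChartAt (𝓡 2) x x)).det

/-- The velocity vector `γ'(t)`. -/
def velocity (γ : ℝ → M) (t : ℝ) : TangentSpace (𝓡 2) (γ t) :=
  mfderiv 𝓘(ℝ, ℝ) (𝓡 2) γ t (1 : ℝ)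

/-- The `k`-th coordinate of `γ(t)` in the chart at `p`. -/
def curveCoord (p : M) (γ : ℝ → M) (k : Fin 2) (t : ℝ) : ℝ :=
  extChartAt (𝓡 2) p (γ t) k

/-- The `k`-th component, in the chart at `p`, of a vector field `V` along `γ`. -/
def vecCoord (p : M) (γ : ℝ → M) (V : ∀ t, TangentSpace (𝓡 2) (γ t)) (k : Fin 2) (t : ℝ) : ℝ :=
  let w : Plane := mfderiv (𝓡 2) 𝓘(ℝ, Plane) (extChartAt (𝓡 2) p) (γ t) (V t)
  w k

/-- `γ : ℝ → M` is a geodesic with unit speed: it satisfies the geodesic equation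
`(γᵏ)'' + ∑ Γᵏ_ij(γ) (γⁱ)' (γʲ)' = 0` in all charts, and `g(γ', γ') = 1`. -/
structure IsUnitSpeedGeodesic (g : SurfaceMetric M) (γ : ℝ → M) : Prop where
  contMDiff : ContMDiff 𝓘(ℝ, ℝ) (𝓡 2) 2 γ
  unit_speed : ∀ t, g.inner (γ t) (velocity γ t) (velocity γ t) = 1
  geodesic_eq : ∀ (p : M) (t : ℝ), γ t ∈ (chartAt Plane p).source → ∀ k,
    deriv (deriv (curveCoord p γ k)) t
      + ∑ i, ∑ j, g.christoffel p k i j (extChartAt (𝓡 2) p (γ t))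
          * deriv (curveCoord p γ i) t * deriv (curveCoord p γ j) t = 0

/-- The vector field `V` along `γ` is parallel: it satisfies
`(Vᵏ)' + ∑ Γᵏ_ij(γ) (γⁱ)' Vʲ = 0` in all charts. -/
def IsParallelAlong (g : SurfaceMetric M) (γ : ℝ → M) (V : ∀ t, TangentSpace (𝓡 2) (γ t)) : Prop :=
  ∀ (p : M) (t : ℝ), γ t ∈ (chartAt Plane p).source → ∀ k,
    HasDerivAt (vecCoord p γ V k)
      (-∑ i, ∑ j, g.christoffel p k i j (extChartAt (𝓡 2) p (γ t))
          * deriv (curveCoord p γ i) t * vecCoord p γ V j t) t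

/-- `ν` is a parallel unit normal vector field along `γ`. -/
structure IsUnitNormalAlong (g : SurfaceMetric M) (γ : ℝ → M)
    (ν : ∀ t, TangentSpace (𝓡 2) (γ t)) : Prop where
  parallel : g.IsParallelAlong γ ν
  unit : ∀ t, g.inner (γ t) (ν t) (ν t) = 1
  normal : ∀ t, g.inner (γ t) (ν t) (velocity γ t) = 0

/-- `y ν` is a (real or complex) normal Jacobi field along the unit speed geodesic `γ`, where
`ν` is a parallel unit normal field: on a surface Jacobi's equation for `y ν` reads
`y'' + τ(γ) y = 0`, where `τ` is the Gauss curvature. -/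
def IsNormalJacobi (g : SurfaceMetric M) (γ : ℝ → M) {𝕜 : Type*} [RCLike 𝕜] (y : ℝ → 𝕜) : Prop :=
  Differentiable ℝ y ∧
    ∀ s, HasDerivAt (deriv y) (-((g.gaussCurvature (γ s) : ℝ) : 𝕜) * y s) s

/-- The derivative `τ_ν(s) = dτ(ν(s))` of the Gauss curvature in the direction `ν(s)`. -/
def normalDerivCurvature (g : SurfaceMetric M) (γ : ℝ → M)
    (ν : ∀ t, TangentSpace (𝓡 2) (γ t)) (s : ℝ) : ℝ :=
  mfderiv (𝓡 2) 𝓘(ℝ, ℝ) g.gaussCurvature (γ s) (ν s)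

/-- The metric `g` is a Zoll metric: all its geodesics are closed, and of the same length `L`.
Here the length of a closed geodesic is its least positive period with respect to arc length;
equivalently, the unit speed geodesic flow is a free action of the circle `ℝ / Lℤ`. -/
def IsZoll (g : SurfaceMetric M) : Prop :=
  ∃ L : ℝ, ∀ γ : ℝ → M, g.IsUnitSpeedGeodesic γ →
    IsLeast {T : ℝ | 0 < T ∧ Function.Periodic γ T} L

end SurfaceMetric

end

/-! It suffices to show that the integral of `τ_ν a b c` vanishes for three real normal Jacobi
fields `a ν`, `b ν`, `c ν`; the statement over `𝕜` follows by separating real and imaginary parts.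

Embed `γ` in a family of unit speed geodesics `γ_ε` with variation field `a ν`. At `ε = 0` the
function `τ(γ_ε(s))` has `ε`-derivative `τ_ν(s) a(s)`. On a Zoll surface all geodesics share the
period `L`, so every variation through geodesics repeats after time `L`, and normal Jacobi fields
along each `γ_ε` are `L`-periodic as vector fields. The scalar solutions of `y'' + τ(γ_ε) y = 0` are
then `L`-periodic up to a sign (a parallel normal may return reversed if the surface is not
orientable), and `2L`-periodic in every case.

Let `f_ε` solve the equation along `γ_ε` with the initial data of `b`. The Wronskian expression `f_ε
c' - f_ε' c` has derivative `(τ(γ_ε) - τ(γ)) f_ε c`, whose integral over `[0, 2L]` is therefore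
zero. Dividing by `ε` and letting `ε → 0` makes the integral of `τ_ν a b c` over `[0, 2L]` vanish
(`integral_derivative_coefficient_eq_zero`). The integrand equals `dτ(a ν) g(b ν, c ν)`, hence is
`L`-periodic (`integrand_periodic`), and the integral over `[0, L]` is half of that.

The remaining work constructs the family. Geodesics exist for all time by compactness
(`exists_isUnitSpeedGeodesic`), a family with prescribed initial variation exists
(`exists_variation`), and its variation field stays equal to the Jacobi field because the latter
solves the linearized geodesic equation (`hasDerivAt_jacobi`, `flow_expansion`). Local computations
are made in one chart and carried to another because coordinate changes are isometries
(`isIsometryOn_coordChange`). -/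

open scoped Manifold ContDiff

noncomputable section

open Set Filter Topology

set_option maxSynthPendingDepth 3
set_option linter.unusedSectionVars false

/-! ### Levi-Civita calculus on an open set of a normed space, and its behaviour under isometries.
-/

section LeviCivita

variable {E : Type*} [NormedAddCommGroup E] [NormedSpace ℝ E]

/-- `Γ` is the Levi-Civita connection (as a field of Christoffel maps) of the metric `B` on the
open set `U` of a normed space. -/
structure IsLeviCivitaOn (U : Set E) (B : E → E →L[ℝ] E →L[ℝ] ℝ) (Γ : E → E →L[ℝ] E →L[ℝ] E) :
    Prop where
  isOpen : IsOpen U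
  contDiffOn_metric : ContDiffOn ℝ ∞ B U
  contDiffOn_christoffel : ContDiffOn ℝ ∞ Γ U
  symm : ∀ u ∈ U, ∀ v w, B u v w = B u w v
  pos : ∀ u ∈ U, ∀ v, v ≠ 0 → 0 < B u v v
  -- Koszul's formula for constant vector fields. Absence of torsion and compatibility with the
  -- metric both follow from it: `christoffel_symm` and `fderiv_metric`.
  koszul : ∀ u ∈ U, ∀ v w z, 2 * B u (Γ u v w) z =
    fderiv ℝ B u v w z + fderiv ℝ B u w v z - fderiv ℝ B u z v w

/-- The curvature `R(v, w) z` of a field of Christoffel maps. -/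
def curvatureOf (Γ : E → E →L[ℝ] E →L[ℝ] E) (u v w z : E) : E :=
  fderiv ℝ Γ u v w z - fderiv ℝ Γ u w v z + Γ u v (Γ u w z) - Γ u w (Γ u v z)

/-- The geodesic vector field on the phase space. -/
def geodesicField (Γ : E → E →L[ℝ] E →L[ℝ] E) (z : E × E) : E × E :=
  (z.2, -Γ z.1 z.2 z.2)

/-- The tangent map of a map between normed spaces. -/
def phaseMap (Φ : E → E) (z : E × E) : E × E := (Φ z.1, fderiv ℝ Φ z.1 z.2)

namespace IsLeviCivitaOn

variable {U : Set E} {B : E → E →L[ℝ] E →L[ℝ] ℝ} {Γ : E → E →L[ℝ] E →L[ℝ] E}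

lemma contDiffAt_metric (h : IsLeviCivitaOn U B Γ) {u : E} (hu : u ∈ U) : ContDiffAt ℝ ∞ B u :=
  h.contDiffOn_metric.contDiffAt (h.isOpen.mem_nhds hu)

lemma contDiffAt_christoffel (h : IsLeviCivitaOn U B Γ) {u : E} (hu : u ∈ U) :
    ContDiffAt ℝ ∞ Γ u :=
  h.contDiffOn_christoffel.contDiffAt (h.isOpen.mem_nhds hu)

lemma hasFDerivAt_metric (h : IsLeviCivitaOn U B Γ) {u : E} (hu : u ∈ U) :
    HasFDerivAt B (fderiv ℝ B u) u :=
  ((h.contDiffAt_metric hu).differentiableAt (by simp)).hasFDerivAt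

lemma hasFDerivAt_christoffel (h : IsLeviCivitaOn U B Γ) {u : E} (hu : u ∈ U) :
    HasFDerivAt Γ (fderiv ℝ Γ u) u :=
  ((h.contDiffAt_christoffel hu).differentiableAt (by simp)).hasFDerivAt

lemma eq_of_metric_eq (h : IsLeviCivitaOn U B Γ) {u : E} (hu : u ∈ U) {v w : E}
    (hvw : ∀ z, B u v z = B u w z) : v = w := by
  by_contra hne
  have h1 := h.pos u hu (v - w) (sub_ne_zero.2 hne)
  have h2 : B u (v - w) (v - w) = 0 := by
    rw [map_sub (B u), sub_apply, hvw (v - w), sub_self]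
  exact h1.ne' h2

lemma fderiv_metric_symm (h : IsLeviCivitaOn U B Γ) {u : E} (hu : u ∈ U) (z v w : E) :
    fderiv ℝ B u z v w = fderiv ℝ B u z w v := by
  have hd := h.hasFDerivAt_metric hu
  have h1 : HasFDerivAt (fun x => B x v w) _ u :=
    (hd.clm_apply (hasFDerivAt_const v u)).clm_apply (hasFDerivAt_const w u)
  have h2 : HasFDerivAt (fun x => B x w v) _ u :=
    (hd.clm_apply (hasFDerivAt_const w u)).clm_apply (hasFDerivAt_const v u)
  have h3 : (fun x => B x v w) =ᶠ[𝓝 u] fun x => B x w v := by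
    filter_upwards [h.isOpen.mem_nhds hu] with x hx using h.symm x hx v w
  have := h1.unique (h2.congr_of_eventuallyEq h3)
  simpa using congrArg (fun L => L z) this

lemma christoffel_symm (h : IsLeviCivitaOn U B Γ) {u : E} (hu : u ∈ U) (v w : E) :
    Γ u v w = Γ u w v := by
  refine h.eq_of_metric_eq hu fun z => ?_
  have h1 := h.koszul u hu v w z
  have h2 := h.koszul u hu w v z
  rw [h.fderiv_metric_symm hu z w v] at h2
  linarith

/-- The connection is compatible with the metric. -/
lemma fderiv_metric (h : IsLeviCivitaOn U B Γ) {u : E} (hu : u ∈ U) (z v w : E) :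
    fderiv ℝ B u z v w = B u (Γ u z v) w + B u v (Γ u z w) := by
  have h1 := h.koszul u hu z v w
  have h2 := h.koszul u hu z w v
  rw [h.symm u hu v]
  have h3 := h.fderiv_metric_symm hu z v w
  have h4 := h.fderiv_metric_symm hu w z v
  have h5 := h.fderiv_metric_symm hu v z w
  linarith

lemma fderiv_christoffel_symm (h : IsLeviCivitaOn U B Γ) {u : E} (hu : u ∈ U) (z v w : E) :
    fderiv ℝ Γ u z v w = fderiv ℝ Γ u z w v := by
  have hd := h.hasFDerivAt_christoffel hu
  have h1 : HasFDerivAt (fun x => Γ x v w) _ u :=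
    (hd.clm_apply (hasFDerivAt_const v u)).clm_apply (hasFDerivAt_const w u)
  have h2 : HasFDerivAt (fun x => Γ x w v) _ u :=
    (hd.clm_apply (hasFDerivAt_const w u)).clm_apply (hasFDerivAt_const v u)
  have h3 : (fun x => Γ x v w) =ᶠ[𝓝 u] fun x => Γ x w v := by
    filter_upwards [h.isOpen.mem_nhds hu] with x hx using h.christoffel_symm hx v w
  have := h1.unique (h2.congr_of_eventuallyEq h3)
  simpa using congrArg (fun L => L z) this

/-- The curvature operators are skew-symmetric. -/
lemma metric_curvature_self (h : IsLeviCivitaOn U B Γ) {u : E} (hu : u ∈ U) (v w z : E) :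
    B u (curvatureOf Γ u v w z) z = 0 := by
  have hB := h.hasFDerivAt_metric hu
  have hΓ := h.hasFDerivAt_christoffel hu
  have hB2 : HasFDerivAt (fderiv ℝ B) (fderiv ℝ (fderiv ℝ B) u) u :=
    (((h.contDiffAt_metric hu).fderiv_right (m := ∞) (by simp)).differentiableAt
      (by simp)).hasFDerivAt
  -- Compatibility reads `∂_b B(z, z) = 2 B(Γ(b, z), z)`; this is its derivative in the direction
  -- `a`. Antisymmetrizing in `a, b` kills the left side and leaves the curvature on the right.
  have key : ∀ a b : E, fderiv ℝ (fderiv ℝ B) u a b z z =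
      2 * (fderiv ℝ B u a (Γ u b z) z + B u (fderiv ℝ Γ u a b z) z) := by
    intro a b
    have h1 : HasFDerivAt (fun x => fderiv ℝ B x b z z) _ u :=
      ((hB2.clm_apply (hasFDerivAt_const b u)).clm_apply (hasFDerivAt_const z u)).clm_apply
        (hasFDerivAt_const z u)
    have h2 : HasFDerivAt (fun x => 2 * B x (Γ x b z) z) _ u :=
      ((hB.clm_apply ((hΓ.clm_apply (hasFDerivAt_const b u)).clm_apply
        (hasFDerivAt_const z u))).clm_apply (hasFDerivAt_const z u)).const_mul (2 : ℝ)
    have h3 : (fun x => fderiv ℝ B x b z z) =ᶠ[𝓝 u] fun x => 2 * B x (Γ x b z) z := by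
      filter_upwards [h.isOpen.mem_nhds hu] with x hx
      rw [h.fderiv_metric hx, h.symm x hx z]
      ring
    have := congrArg (fun L => L a) (h1.unique (h2.congr_of_eventuallyEq h3))
    simp at this
    rw [this]
    ring
  have hsym : fderiv ℝ (fderiv ℝ B) u v w = fderiv ℝ (fderiv ℝ B) u w v :=
    (h.contDiffAt_metric hu).isSymmSndFDerivAt (by simpa using ENat.LEInfty.out) v w
  have h1 := key v w
  have h2 := key w v
  rw [hsym, h2, h.fderiv_metric hu, h.fderiv_metric hu, h.symm u hu (Γ u v z) (Γ u w z)] at h1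
  simp only [curvatureOf, map_sub, map_add, add_apply, sub_apply]
  linarith

lemma metric_curvature_skew (h : IsLeviCivitaOn U B Γ) {u : E} (hu : u ∈ U) (v w z t : E) :
    B u (curvatureOf Γ u v w z) t = -B u (curvatureOf Γ u v w t) z := by
  have h1 := h.metric_curvature_self hu v w z
  have h2 := h.metric_curvature_self hu v w t
  have h3 := h.metric_curvature_self hu v w (z + t)
  have h4 : curvatureOf Γ u v w (z + t) = curvatureOf Γ u v w z + curvatureOf Γ u v w t := by
    simp only [curvatureOf, map_add]; abel
  rw [h4] at h3
  simp only [map_add, add_apply] at h3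
  linarith

end IsLeviCivitaOn

/-- `Φ` is a smooth map on the open set `V` which pulls the metric `B` on `U` back to `B'`. -/
structure IsIsometryOn (V U : Set E) (Φ : E → E) (B' B : E → E →L[ℝ] E →L[ℝ] ℝ) : Prop where
  isOpen : IsOpen V
  mapsTo : MapsTo Φ V U
  contDiffOn : ContDiffOn ℝ ∞ Φ V
  -- With a surjective differential, an identity of vectors at `Φ u` may be tested against the
  -- images `fderiv ℝ Φ u z` only.
  surjective : ∀ u ∈ V, Function.Surjective (fderiv ℝ Φ u)
  pullback : ∀ u ∈ V, ∀ v w, B' u v w = B (Φ u) (fderiv ℝ Φ u v) (fderiv ℝ Φ u w)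

namespace IsIsometryOn

variable {V U' U : Set E} {Φ : E → E} {B' B : E → E →L[ℝ] E →L[ℝ] ℝ}
  {Γ' Γ : E → E →L[ℝ] E →L[ℝ] E}

lemma contDiffAt (h : IsIsometryOn V U Φ B' B) {u : E} (hu : u ∈ V) : ContDiffAt ℝ ∞ Φ u :=
  h.contDiffOn.contDiffAt (h.isOpen.mem_nhds hu)

lemma hasFDerivAt (h : IsIsometryOn V U Φ B' B) {u : E} (hu : u ∈ V) :
    HasFDerivAt Φ (fderiv ℝ Φ u) u :=
  ((h.contDiffAt hu).differentiableAt (by simp)).hasFDerivAt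

lemma hasFDerivAt_fderiv (h : IsIsometryOn V U Φ B' B) {u : E} (hu : u ∈ V) :
    HasFDerivAt (fderiv ℝ Φ) (fderiv ℝ (fderiv ℝ Φ) u) u :=
  (((h.contDiffAt hu).fderiv_right (m := ∞) (by simp)).differentiableAt (by simp)).hasFDerivAt

lemma fderiv_fderiv_symm (h : IsIsometryOn V U Φ B' B) {u : E} (hu : u ∈ V) (v w : E) :
    fderiv ℝ (fderiv ℝ Φ) u v w = fderiv ℝ (fderiv ℝ Φ) u w v :=
  (h.contDiffAt hu).isSymmSndFDerivAt (by simpa using ENat.LEInfty.out) v w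

lemma fderiv_pullback (h : IsIsometryOn V U Φ B' B) (hΓ' : IsLeviCivitaOn U' B' Γ')
    (hVU' : V ⊆ U') (hΓ : IsLeviCivitaOn U B Γ) {u : E} (hu : u ∈ V) (z v w : E) :
    fderiv ℝ B' u z v w =
      fderiv ℝ B (Φ u) (fderiv ℝ Φ u z) (fderiv ℝ Φ u v) (fderiv ℝ Φ u w)
      + B (Φ u) (fderiv ℝ (fderiv ℝ Φ) u z v) (fderiv ℝ Φ u w)
      + B (Φ u) (fderiv ℝ Φ u v) (fderiv ℝ (fderiv ℝ Φ) u z w) := by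
  have hB' := hΓ'.hasFDerivAt_metric (hVU' hu)
  have hB := (hΓ.hasFDerivAt_metric (h.mapsTo hu)).comp u (h.hasFDerivAt hu)
  have hD := h.hasFDerivAt_fderiv hu
  have h1 : HasFDerivAt (fun x => B' x v w) _ u :=
    (hB'.clm_apply (hasFDerivAt_const v u)).clm_apply (hasFDerivAt_const w u)
  have h2 : HasFDerivAt (fun x => (B ∘ Φ) x (fderiv ℝ Φ x v) (fderiv ℝ Φ x w)) _ u :=
    (hB.clm_apply (hD.clm_apply (hasFDerivAt_const v u))).clm_apply
      (hD.clm_apply (hasFDerivAt_const w u))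
  have h3 : (fun x => B' x v w) =ᶠ[𝓝 u]
      fun x => (B ∘ Φ) x (fderiv ℝ Φ x v) (fderiv ℝ Φ x w) := by
    filter_upwards [h.isOpen.mem_nhds hu] with x hx using h.pullback x hx v w
  have := congrArg (fun L => L z) (h1.unique (h2.congr_of_eventuallyEq h3))
  simp at this
  rw [this]
  ring

/-- The transformation law of the Christoffel maps. -/
lemma christoffel (h : IsIsometryOn V U Φ B' B) (hΓ' : IsLeviCivitaOn U' B' Γ')
    (hVU' : V ⊆ U') (hΓ : IsLeviCivitaOn U B Γ) {u : E} (hu : u ∈ V) (v w : E) :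
    fderiv ℝ Φ u (Γ' u v w) =
      Γ (Φ u) (fderiv ℝ Φ u v) (fderiv ℝ Φ u w) + fderiv ℝ (fderiv ℝ Φ) u v w := by
  have hU := h.mapsTo hu
  refine hΓ.eq_of_metric_eq hU fun z' => ?_
  obtain ⟨z, rfl⟩ := h.surjective u hu z'
  have h1 := hΓ'.koszul u (hVU' hu) v w z
  have h2 := hΓ.koszul (Φ u) hU (fderiv ℝ Φ u v) (fderiv ℝ Φ u w) (fderiv ℝ Φ u z)
  -- Of the six terms with second derivatives of `Φ` in Koszul's formula, four cancel by symmetry;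
  -- the other two add up to `2 B(D²Φ(v, w), DΦ z)`.
  rw [h.pullback u hu, h.fderiv_pullback hΓ' hVU' hΓ hu, h.fderiv_pullback hΓ' hVU' hΓ hu,
    h.fderiv_pullback hΓ' hVU' hΓ hu, h.fderiv_fderiv_symm hu w v, h.fderiv_fderiv_symm hu z v,
    h.fderiv_fderiv_symm hu z w, hΓ.symm _ hU (fderiv ℝ Φ u w), 
    hΓ.symm _ hU (fderiv ℝ Φ u v)] at h1
  simp only [map_add, add_apply]
  linarith

/-- The transformation law of the curvature. -/
lemma curvature (h : IsIsometryOn V U Φ B' B) (hΓ' : IsLeviCivitaOn U' B' Γ')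
    (hVU' : V ⊆ U') (hΓ : IsLeviCivitaOn U B Γ) {u : E} (hu : u ∈ V) (v w z : E) :
    fderiv ℝ Φ u (curvatureOf Γ' u v w z) =
      curvatureOf Γ (Φ u) (fderiv ℝ Φ u v) (fderiv ℝ Φ u w) (fderiv ℝ Φ u z) := by
  have hU := h.mapsTo hu
  have hD := h.hasFDerivAt_fderiv hu
  have hΓ'd := hΓ'.hasFDerivAt_christoffel (hVU' hu)
  have hΓd := (hΓ.hasFDerivAt_christoffel hU).comp u (h.hasFDerivAt hu)
  have hD2 : HasFDerivAt (fderiv ℝ (fderiv ℝ Φ)) (fderiv ℝ (fderiv ℝ (fderiv ℝ Φ)) u) u :=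
    ((((h.contDiffAt hu).fderiv_right (m := ∞) (by simp)).fderiv_right (m := ∞)
      (by simp)).differentiableAt (by simp)).hasFDerivAt
  -- The derivative of the Christoffel transformation law in the direction `a`. The third derivative
  -- of `Φ` is symmetric in `a, b`, so it disappears from the curvature, and the second derivatives
  -- cancel against the quadratic terms.
  have key : ∀ a b : E, fderiv ℝ Φ u (fderiv ℝ Γ' u a b z) =
      -fderiv ℝ (fderiv ℝ Φ) u a (Γ' u b z)
      + fderiv ℝ Γ (Φ u) (fderiv ℝ Φ u a) (fderiv ℝ Φ u b) (fderiv ℝ Φ u z)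
      + Γ (Φ u) (fderiv ℝ (fderiv ℝ Φ) u a b) (fderiv ℝ Φ u z)
      + Γ (Φ u) (fderiv ℝ Φ u b) (fderiv ℝ (fderiv ℝ Φ) u a z)
      + fderiv ℝ (fderiv ℝ (fderiv ℝ Φ)) u a b z := by
    intro a b
    have h1 : HasFDerivAt (fun x => fderiv ℝ Φ x (Γ' x b z)) _ u :=
      hD.clm_apply ((hΓ'd.clm_apply (hasFDerivAt_const b u)).clm_apply (hasFDerivAt_const z u))
    have h2 : HasFDerivAt (fun x => (Γ ∘ Φ) x (fderiv ℝ Φ x b) (fderiv ℝ Φ x z)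
        + fderiv ℝ (fderiv ℝ Φ) x b z) _ u :=
      ((hΓd.clm_apply (hD.clm_apply (hasFDerivAt_const b u))).clm_apply
        (hD.clm_apply (hasFDerivAt_const z u))).add
        ((hD2.clm_apply (hasFDerivAt_const b u)).clm_apply (hasFDerivAt_const z u))
    have h3 : (fun x => fderiv ℝ Φ x (Γ' x b z)) =ᶠ[𝓝 u] fun x =>
        (Γ ∘ Φ) x (fderiv ℝ Φ x b) (fderiv ℝ Φ x z) + fderiv ℝ (fderiv ℝ Φ) x b z := by
      filter_upwards [h.isOpen.mem_nhds hu] with x hx using h.christoffel hΓ' hVU' hΓ hx b z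
    have := congrArg (fun L => L a) (h1.unique (h2.congr_of_eventuallyEq h3))
    simp at this
    rw [← sub_eq_zero] at this ⊢
    rw [← this]
    abel
  have hD3 : fderiv ℝ (fderiv ℝ (fderiv ℝ Φ)) u v w z = fderiv ℝ (fderiv ℝ (fderiv ℝ Φ)) u w v z := by
    have := ((h.contDiffAt hu).fderiv_right (m := ∞) (by simp)).isSymmSndFDerivAt (by simpa using ENat.LEInfty.out) v w
    exact congrArg (fun L => L z) this
  simp only [curvatureOf, map_add, map_sub, key, h.christoffel hΓ' hVU' hΓ hu,
    hD3]
  rw [h.fderiv_fderiv_symm hu w v]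
  abel

lemma hasFDerivAt_phaseMap (h : IsIsometryOn V U Φ B' B) {z : E × E} (hz : z.1 ∈ V) :
    HasFDerivAt (phaseMap Φ) (((fderiv ℝ Φ z.1).comp (ContinuousLinearMap.fst ℝ E E)).prod
      ((fderiv ℝ Φ z.1).comp (ContinuousLinearMap.snd ℝ E E)
        + ((fderiv ℝ (fderiv ℝ Φ) z.1).comp (ContinuousLinearMap.fst ℝ E E)).flip z.2)) z :=
  ((h.hasFDerivAt hz).comp z hasFDerivAt_fst).prodMk
    (((h.hasFDerivAt_fderiv hz).comp z hasFDerivAt_fst).clm_apply hasFDerivAt_snd)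

/-- The second derivative of `Φ` in the differential of the tangent map is exactly the inhomogeneous
term in the transformation law of the Christoffel maps. Hence the geodesic equation does not depend
on the chart. -/
lemma phaseMap_geodesicField (h : IsIsometryOn V U Φ B' B) (hΓ' : IsLeviCivitaOn U' B' Γ')
    (hVU' : V ⊆ U') (hΓ : IsLeviCivitaOn U B Γ) {z : E × E} (hz : z.1 ∈ V) :
    fderiv ℝ (phaseMap Φ) z (geodesicField Γ' z) = geodesicField Γ (phaseMap Φ z) := by
  rw [(h.hasFDerivAt_phaseMap hz).fderiv]
  simp [geodesicField, phaseMap, h.christoffel hΓ' hVU' hΓ hz]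

/-- Transformation of the initial data of a Jacobi field `a n` with derivative `b n`. -/
lemma phaseMap_normal (h : IsIsometryOn V U Φ B' B) (hΓ' : IsLeviCivitaOn U' B' Γ')
    (hVU' : V ⊆ U') (hΓ : IsLeviCivitaOn U B Γ) {z : E × E} (hz : z.1 ∈ V) (a b : ℝ) (n : E) :
    fderiv ℝ (phaseMap Φ) z (a • n, b • n - a • Γ' z.1 z.2 n) =
      (a • fderiv ℝ Φ z.1 n, b • fderiv ℝ Φ z.1 n
        - a • Γ (Φ z.1) (fderiv ℝ Φ z.1 z.2) (fderiv ℝ Φ z.1 n)) := by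
  rw [(h.hasFDerivAt_phaseMap hz).fderiv]
  simp [h.christoffel hΓ' hVU' hΓ hz, h.fderiv_fderiv_symm hz z.2 n]
  abel

end IsIsometryOn

end LeviCivita

/-! ### The linearized geodesic equation and Jacobi fields. -/

namespace IsLeviCivitaOn

section Jacobi

variable {E : Type*} [NormedAddCommGroup E] [NormedSpace ℝ E]
  {U : Set E} {B : E → E →L[ℝ] E →L[ℝ] ℝ} {Γ : E → E →L[ℝ] E →L[ℝ] E}

lemma contDiffAt_geodesicField (h : IsLeviCivitaOn U B Γ) {z : E × E} (hz : z.1 ∈ U) :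
    ContDiffAt ℝ ∞ (geodesicField Γ) z := by
  have h1 : ContDiffAt ℝ ∞ (fun z : E × E => Γ z.1) z :=
    (h.contDiffAt_christoffel hz).comp z contDiffAt_fst
  exact contDiffAt_snd.prodMk ((h1.clm_apply contDiffAt_snd).clm_apply contDiffAt_snd).neg

lemma fderiv_geodesicField (h : IsLeviCivitaOn U B Γ) {z : E × E} (hz : z.1 ∈ U) (w : E × E) :
    fderiv ℝ (geodesicField Γ) z w =
      (w.2, -(fderiv ℝ Γ z.1 w.1 z.2 z.2 + 2 • Γ z.1 z.2 w.2)) := by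
  have h1 : HasFDerivAt (fun z : E × E => Γ z.1) _ z :=
    (h.hasFDerivAt_christoffel hz).comp z hasFDerivAt_fst
  have h2 : HasFDerivAt (geodesicField Γ) _ z :=
    hasFDerivAt_snd.prodMk ((h1.clm_apply hasFDerivAt_snd).clm_apply hasFDerivAt_snd).neg
  rw [h2.fderiv]
  simp [h.christoffel_symm hz w.2 z.2, two_smul]
  abel

/-- Along a curve, the scalar product of two vector fields is differentiated by Leibniz' rule. -/
lemma hasDerivAt_metric (h : IsLeviCivitaOn U B Γ) {c v w : ℝ → E} {c' v' w' : E} {s : ℝ}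
    (hs : c s ∈ U) (hc : HasDerivAt c c' s) (hv : HasDerivAt v v' s) (hw : HasDerivAt w w' s) :
    HasDerivAt (fun t => B (c t) (v t) (w t))
      (B (c s) (v' + Γ (c s) c' (v s)) (w s) + B (c s) (v s) (w' + Γ (c s) c' (w s))) s := by
  have h1 : HasDerivAt (fun t => B (c t)) (fderiv ℝ B (c s) c') s :=
    (h.hasFDerivAt_metric hs).comp_hasDerivAt s hc
  refine ((h1.clm_apply hv).clm_apply hw).congr_deriv ?_
  simp only [map_add, add_apply, h.fderiv_metric hs]
  ring

/-- A normal Jacobi field `y n` along a geodesic, with its derivative, solves the linearization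
of the geodesic equation. -/
lemma hasDerivAt_jacobi (h : IsLeviCivitaOn U B Γ) {z : ℝ → E × E} {n : ℝ → E} {y y' : ℝ → ℝ}
    {τ s : ℝ} (hs : (z s).1 ∈ U) (hz : HasDerivAt z (geodesicField Γ (z s)) s)
    (hn : HasDerivAt n (-Γ (z s).1 (z s).2 (n s)) s)
    (hτ : curvatureOf Γ (z s).1 (n s) (z s).2 (z s).2 = τ • n s)
    (hy : HasDerivAt y (y' s) s) (hy' : HasDerivAt y' (-τ * y s) s) :
    -- Since `n` is parallel, the second component is the ordinary derivative of `y n`.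
    HasDerivAt (fun t => (y t • n t, y' t • n t - y t • Γ (z t).1 (z t).2 (n t)))
      (fderiv ℝ (geodesicField Γ) (z s)
        (y s • n s, y' s • n s - y s • Γ (z s).1 (z s).2 (n s))) s := by
  have hz1 : HasDerivAt (fun t => (z t).1) (z s).2 s := hz.fst
  have hz2 : HasDerivAt (fun t => (z t).2) (-Γ (z s).1 (z s).2 (z s).2) s := hz.snd
  have hΓ : HasDerivAt (fun t => Γ (z t).1) (fderiv ℝ Γ (z s).1 (z s).2) s :=
    (h.hasFDerivAt_christoffel hs).comp_hasDerivAt s hz1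
  have h1 := hy.smul hn
  have h2 := (hy'.smul hn).sub (hy.smul ((hΓ.clm_apply hz2).clm_apply hn))
  refine (h1.prodMk h2).congr_deriv ?_
  rw [h.fderiv_geodesicField hs]
  refine Prod.ext ?_ ?_
  · simp only [smul_neg]; abel
  · simp only [map_smul, map_sub, map_neg, neg_apply, smul_apply,
      add_apply, smul_neg, smul_add, smul_sub, neg_smul, two_smul, neg_mul]
    -- The derivatives of `Γ` and its quadratic terms assemble to `R(n, γ')γ'`, which `hτ`
    -- identifies with the zeroth order term of Jacobi's equation.
    have key : (y s * τ) • n s = y s • curvatureOf Γ (z s).1 (n s) (z s).2 (z s).2 := by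
      rw [hτ, smul_smul]
    rw [mul_comm τ, key]
    simp only [curvatureOf, smul_add, smul_sub, h.christoffel_symm hs (n s) (z s).2,
      h.fderiv_christoffel_symm hs (z s).2 (z s).2 (n s),
      h.christoffel_symm hs (n s) (Γ (z s).1 (z s).2 (z s).2)]
    abel

end Jacobi

end IsLeviCivitaOn

/-! ### Dimension two: Gauss curvature and the unit normal of a curve. -/

/-- The standard basis vectors of the plane. -/
abbrev planeBasis (i : Fin 2) : Plane := EuclideanSpace.single i (1 : ℝ)

lemma plane_eq (v : Plane) : v = v 0 • planeBasis 0 + v 1 • planeBasis 1 := by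
  ext i
  fin_cases i <;> simp

/-- The determinant of a bilinear form on the plane. -/
def gramDet (B : Plane →L[ℝ] Plane →L[ℝ] ℝ) : ℝ :=
  B (planeBasis 0) (planeBasis 0) * B (planeBasis 1) (planeBasis 1)
    - B (planeBasis 0) (planeBasis 1) * B (planeBasis 1) (planeBasis 0)

/-- The Gauss curvature of a metric with Christoffel maps `Γ`. -/
def gaussOf (B : Plane → Plane →L[ℝ] Plane →L[ℝ] ℝ) (Γ : Plane → Plane →L[ℝ] Plane →L[ℝ] Plane)
    (u : Plane) : ℝ :=
  B u (curvatureOf Γ u (planeBasis 0) (planeBasis 1) (planeBasis 1)) (planeBasis 0)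
    / gramDet (B u)

/-- The unit normal obtained by rotating the unit vector `z.2` at `z.1`. -/
def normalOf (B : Plane → Plane →L[ℝ] Plane →L[ℝ] ℝ) (z : Plane × Plane) : Plane :=
  (√(gramDet (B z.1)))⁻¹ •
    (B z.1 z.2 (planeBasis 0) • planeBasis 1 - B z.1 z.2 (planeBasis 1) • planeBasis 0)

namespace IsLeviCivitaOn

variable {U : Set Plane} {B : Plane → Plane →L[ℝ] Plane →L[ℝ] ℝ}
  {Γ : Plane → Plane →L[ℝ] Plane →L[ℝ] Plane}

lemma metric_expand (h : IsLeviCivitaOn U B Γ) {u : Plane} (hu : u ∈ U) (v w : Plane) :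
    B u v w = v 0 * w 0 * B u (planeBasis 0) (planeBasis 0)
      + (v 0 * w 1 + v 1 * w 0) * B u (planeBasis 0) (planeBasis 1)
      + v 1 * w 1 * B u (planeBasis 1) (planeBasis 1) := by
  conv_lhs => rw [plane_eq v, plane_eq w]
  simp only [map_add, map_smul, add_apply, smul_apply, smul_eq_mul,
    h.symm u hu (planeBasis 1) (planeBasis 0)]
  ring

/-- The Gram determinant of two vectors. -/
lemma gram_eq (h : IsLeviCivitaOn U B Γ) {u : Plane} (hu : u ∈ U) (v w : Plane) :
    B u v v * B u w w - B u v w ^ 2 = (v 0 * w 1 - v 1 * w 0) ^ 2 * gramDet (B u) := by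
  rw [h.metric_expand hu v w, h.metric_expand hu v v, h.metric_expand hu w w, gramDet,
    h.symm u hu (planeBasis 1) (planeBasis 0)]
  ring

lemma gramDet_pos (h : IsLeviCivitaOn U B Γ) {u : Plane} (hu : u ∈ U) : 0 < gramDet (B u) := by
  have h0 := h.pos u hu (planeBasis 0) (by simp)
  set a := B u (planeBasis 0) (planeBasis 0)
  set b := B u (planeBasis 0) (planeBasis 1)
  -- This vector is orthogonal to `planeBasis 0` and its square norm is `a * gramDet (B u)`.
  have h1 := h.pos u hu (a • planeBasis 1 - b • planeBasis 0) (by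
    intro h2
    have := congrArg (fun v : Plane => v 1) h2
    simp at this
    exact h0.ne' this)
  rw [h.metric_expand hu] at h1
  simp only [PiLp.sub_apply, PiLp.smul_apply, smul_eq_mul] at h1
  simp at h1
  rw [gramDet, h.symm u hu (planeBasis 1) (planeBasis 0)]
  change 0 < a * B u (planeBasis 1) (planeBasis 1) - b * b
  change 0 < b * b * a + (-(b * a) + -(a * b)) * b + a * a * B u (planeBasis 1) (planeBasis 1) at h1
  by_contra hcon
  nlinarith

/-- The Gram identity gives an orthonormal pair a nonzero determinant; by Cramer's rule `x` is a
combination of `n` and `t`, so it is orthogonal to itself. -/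
lemma eq_zero_of_orthogonal (h : IsLeviCivitaOn U B Γ) {u : Plane} (hu : u ∈ U) {n t x : Plane}
    (hn : B u n n = 1) (ht : B u t t = 1) (hnt : B u n t = 0) (hxn : B u x n = 0)
    (hxt : B u x t = 0) : x = 0 := by
  have hg := h.gram_eq hu n t
  have e1 := h.gram_eq hu x n
  have e2 := h.gram_eq hu x t
  rw [hn, ht, hnt] at hg
  rw [hxn, hn] at e1
  rw [hxt, ht] at e2
  have hg1 := h.gramDet_pos hu
  by_contra hx
  have h3 := h.pos u hu x hx
  -- the Gram determinants give a nontrivial relation between `n` and `t`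
  have e3 := h.metric_expand hu n t
  set d := gramDet (B u)
  have hD : (n 0 * t 1 - n 1 * t 0) ≠ 0 := by
    intro h0
    rw [h0] at hg
    norm_num at hg
  have hA := h.metric_expand hu x n
  have hC := h.metric_expand hu x t
  have hX := h.metric_expand hu x x
  rw [hxn] at hA
  rw [hxt] at hC
  have : (n 0 * t 1 - n 1 * t 0) * B u x x = 0 := by
    rw [hX]
    linear_combination (-(x 0 * t 1 - x 1 * t 0)) * hA + (x 0 * n 1 - x 1 * n 0) * hC
  rcases mul_eq_zero.1 this with h4 | h4
  · exact hD h4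
  · exact h3.ne' h4

/-- By bilinearity and antisymmetry `R(n, t) = det(n, t) R(e₀, e₁)`, a skew operator. So `R(n, t)t`
is orthogonal to `t`, and its `n`-component is `det(n, t)² B(R(e₀, e₁)e₁, e₀)`, where `det(n, t)²
gramDet = 1`. The square makes the orientation of the pair irrelevant. -/
lemma curvature_orthonormal (h : IsLeviCivitaOn U B Γ) {u : Plane} (hu : u ∈ U) {n t : Plane}
    (hn : B u n n = 1) (ht : B u t t = 1) (hnt : B u n t = 0) :
    curvatureOf Γ u n t t = gaussOf B Γ u • n := by
  have hg := h.gram_eq hu n t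
  rw [hn, ht, hnt] at hg
  have hg1 := h.gramDet_pos hu
  set A : Plane → Plane := fun v => curvatureOf Γ u (planeBasis 0) (planeBasis 1) v with hA
  have hlin : ∀ v : Plane, A v = v 0 • A (planeBasis 0) + v 1 • A (planeBasis 1) := by
    intro v
    conv_lhs => rw [plane_eq v]
    simp only [hA, curvatureOf, map_add, map_smul, smul_add, smul_sub]
    abel
  have hR : ∀ v, curvatureOf Γ u n t v = (n 0 * t 1 - n 1 * t 0) • A v := by
    intro v
    conv_lhs => rw [plane_eq n, plane_eq t]
    simp only [hA, curvatureOf, map_add, map_smul, smul_add, smul_sub, add_apply, smul_apply,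
      smul_smul, sub_smul]
    simp only [mul_comm]
    abel
  have hsk := h.metric_curvature_skew hu (planeBasis 0) (planeBasis 1) (planeBasis 0)
    (planeBasis 1)
  have h00 := h.metric_curvature_self hu (planeBasis 0) (planeBasis 1) (planeBasis 0)
  have h11 := h.metric_curvature_self hu (planeBasis 0) (planeBasis 1) (planeBasis 1)
  have htt := h.metric_curvature_self hu (planeBasis 0) (planeBasis 1) t
  set ρ := B u (A (planeBasis 1)) (planeBasis 0) with hρ
  change B u (A (planeBasis 0)) (planeBasis 1) = -ρ at hsk
  change B u (A (planeBasis 0)) (planeBasis 0) = 0 at h00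
  change B u (A (planeBasis 1)) (planeBasis 1) = 0 at h11
  change B u (A t) t = 0 at htt
  have hAn : B u (A t) n = (n 0 * t 1 - n 1 * t 0) * ρ := by
    rw [hlin t]
    conv_lhs => rw [plane_eq n]
    simp only [map_add, map_smul, add_apply, smul_apply, smul_eq_mul, hsk, h00, h11, ← hρ]
    ring
  rw [hR, ← sub_eq_zero]
  refine h.eq_zero_of_orthogonal hu hn ht hnt ?_ ?_
  · have : gaussOf B Γ u = ρ / gramDet (B u) := rfl
    rw [this]
    simp only [map_sub, map_smul, sub_apply, smul_apply, smul_eq_mul, hn, hAn]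
    field_simp
    linear_combination (-ρ) * hg
  · simp [hnt, htt]

lemma eq_or_eq_neg_of_unit_normal (h : IsLeviCivitaOn U B Γ) {u : Plane} (hu : u ∈ U)
    {n m t : Plane} (hn : B u n n = 1) (hm : B u m m = 1) (ht : B u t t = 1) (hnt : B u n t = 0)
    (hmt : B u m t = 0) : m = n ∨ m = -n := by
  have h1 : m - B u m n • n = 0 :=
    h.eq_zero_of_orthogonal hu hn ht hnt (by simp [hn]) (by simp [hnt, hmt])
  have h2 : m = B u m n • n := sub_eq_zero.1 h1
  have h3 : B u m n * B u m n = 1 := by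
    have h4 : B u m m = B u (B u m n • n) (B u m n • n) := by rw [← h2]
    rw [hm] at h4
    simp [hn] at h4
    exact h4.symm
  rcases mul_self_eq_one_iff.1 h3 with h5 | h5
  · left; rw [h2, h5, one_smul]
  · right; rw [h2, h5, neg_one_smul]

lemma normalOf_spec (h : IsLeviCivitaOn U B Γ) {u t : Plane} (hu : u ∈ U) (ht : B u t t = 1) :
    B u (normalOf B (u, t)) (normalOf B (u, t)) = 1 ∧ B u (normalOf B (u, t)) t = 0 := by
  have hg := h.gramDet_pos hu
  have hs : √(gramDet (B u)) ^ 2 = gramDet (B u) := Real.sq_sqrt hg.le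
  have hs0 : √(gramDet (B u)) ≠ 0 := (Real.sqrt_pos.2 hg).ne'
  have e0 := h.metric_expand hu t (planeBasis 0)
  have e1 := h.metric_expand hu t (planeBasis 1)
  rw [h.metric_expand hu] at ht
  simp at e0 e1
  have hd : gramDet (B u) = B u (planeBasis 0) (planeBasis 0) * B u (planeBasis 1) (planeBasis 1)
      - B u (planeBasis 0) (planeBasis 1) ^ 2 := by
    rw [gramDet, h.symm u hu (planeBasis 1) (planeBasis 0)]; ring
  constructor
  · rw [h.metric_expand hu]
    simp [normalOf, e0, e1]
    field_simp
    rw [hs, hd]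
    linear_combination (B u (planeBasis 0) (planeBasis 0) * B u (planeBasis 1) (planeBasis 1)
      - B u (planeBasis 0) (planeBasis 1) ^ 2) * ht
  · rw [h.metric_expand hu]
    simp [normalOf, e0, e1]
    ring

lemma contDiffAt_gramDet (h : IsLeviCivitaOn U B Γ) {u : Plane} (hu : u ∈ U) :
    ContDiffAt ℝ ∞ (fun u => gramDet (B u)) u := by
  have hB : ∀ i j, ContDiffAt ℝ ∞ (fun u => B u (planeBasis i) (planeBasis j)) u := fun i j =>
    ((h.contDiffAt_metric hu).clm_apply contDiffAt_const).clm_apply contDiffAt_const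
  exact ((hB 0 0).mul (hB 1 1)).sub ((hB 0 1).mul (hB 1 0))

lemma contDiffAt_normalOf (h : IsLeviCivitaOn U B Γ) {z : Plane × Plane} (hz : z.1 ∈ U) :
    ContDiffAt ℝ ∞ (normalOf B) z := by
  have hg := h.gramDet_pos hz
  have h1 : ContDiffAt ℝ ∞ (fun z : Plane × Plane => B z.1) z :=
    (h.contDiffAt_metric hz).comp z contDiffAt_fst
  have h2 : ContDiffAt ℝ ∞ (fun z : Plane × Plane => gramDet (B z.1)) z :=
    (h.contDiffAt_gramDet hz).comp z contDiffAt_fst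
  have h3 : ∀ i, ContDiffAt ℝ ∞ (fun z : Plane × Plane => B z.1 z.2 (planeBasis i)) z := fun i =>
    (h1.clm_apply contDiffAt_snd).clm_apply contDiffAt_const
  exact ((h2.sqrt hg.ne').inv (Real.sqrt_pos.2 hg).ne').smul
    (((h3 0).smul contDiffAt_const).sub ((h3 1).smul contDiffAt_const))

lemma contDiffAt_gaussOf (h : IsLeviCivitaOn U B Γ) {u : Plane} (hu : u ∈ U) :
    ContDiffAt ℝ ∞ (gaussOf B Γ) u := by
  have hΓ := h.contDiffAt_christoffel hu
  have hD : ContDiffAt ℝ ∞ (fderiv ℝ Γ) u := hΓ.fderiv_right (m := ∞) (by simp)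
  have hD1 : ∀ a b c : Plane, ContDiffAt ℝ ∞ (fun u => fderiv ℝ Γ u a b c) u := fun a b c =>
    ((hD.clm_apply contDiffAt_const).clm_apply contDiffAt_const).clm_apply contDiffAt_const
  have hΓ1 : ∀ a b c : Plane, ContDiffAt ℝ ∞ (fun u => Γ u a (Γ u b c)) u := fun a b c =>
    (hΓ.clm_apply contDiffAt_const).clm_apply
      ((hΓ.clm_apply contDiffAt_const).clm_apply contDiffAt_const)
  have hR : ∀ a b c : Plane, ContDiffAt ℝ ∞ (fun u => curvatureOf Γ u a b c) u := fun a b c =>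
    (((hD1 a b c).sub (hD1 b a c)).add (hΓ1 a b c)).sub (hΓ1 b a c)
  exact (((h.contDiffAt_metric hu).clm_apply (hR _ _ _)).clm_apply contDiffAt_const).div
    (h.contDiffAt_gramDet hu) (h.gramDet_pos hu).ne'

/-- Along a geodesic of unit speed, the rotated velocity is a parallel field. -/
lemma hasDerivAt_normalOf (h : IsLeviCivitaOn U B Γ) {z : ℝ → Plane × Plane} {s : ℝ}
    (hs : (z s).1 ∈ U) (hz : HasDerivAt z (geodesicField Γ (z s)) s)
    (hu : ∀ᶠ t in 𝓝 s, B (z t).1 (z t).2 (z t).2 = 1) :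
    HasDerivAt (fun t => normalOf B (z t)) (-Γ (z s).1 (z s).2 (normalOf B (z s))) s := by
  have hz1 : HasDerivAt (fun t => (z t).1) (z s).2 s := hz.fst
  have hz2 : HasDerivAt (fun t => (z t).2) (-Γ (z s).1 (z s).2 (z s).2) s := hz.snd
  have hU : ∀ᶠ t in 𝓝 s, (z t).1 ∈ U := hz1.continuousAt.eventually (h.isOpen.mem_nhds hs)
  have hn : HasDerivAt (fun t => normalOf B (z t)) _ s :=
    ((h.contDiffAt_normalOf hs).differentiableAt (by simp)).hasFDerivAt.comp_hasDerivAt s hz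
  set m := fderiv ℝ (normalOf B) (z s) (geodesicField Γ (z s))
  obtain ⟨hnn, hnt⟩ := h.normalOf_spec hs hu.self_of_nhds
  refine hn.congr_deriv (eq_neg_of_add_eq_zero_left ?_)
  -- The covariant derivative of the normal is orthogonal to the normal, by differentiating `B(n, n)
  -- = 1`, and to the velocity, by differentiating `B(n, γ') = 0` with `γ'` parallel.
  refine h.eq_zero_of_orthogonal hs hnn hu.self_of_nhds hnt ?_ ?_
  · have h1 := h.hasDerivAt_metric hs hz1 hn hn
    have h2 : (fun t => B (z t).1 (normalOf B (z t)) (normalOf B (z t))) =ᶠ[𝓝 s] fun _ => 1 := by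
      filter_upwards [hU, hu] with t ht ht' using (h.normalOf_spec ht ht').1
    have h3 := h1.unique ((hasDerivAt_const s (1 : ℝ)).congr_of_eventuallyEq h2)
    rw [h.symm _ hs (normalOf B (z s))] at h3
    change B (z s).1 (m + Γ (z s).1 (z s).2 (normalOf B (z s))) (normalOf B (z s)) = 0
    linarith
  · have h1 := h.hasDerivAt_metric hs hz1 hn hz2
    have h2 : (fun t => B (z t).1 (normalOf B (z t)) (z t).2) =ᶠ[𝓝 s] fun _ => 0 := by
      filter_upwards [hU, hu] with t ht ht' using (h.normalOf_spec ht ht').2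
    have h3 := h1.unique ((hasDerivAt_const s (0 : ℝ)).congr_of_eventuallyEq h2)
    rw [neg_add_cancel, map_zero, add_zero] at h3
    exact h3

end IsLeviCivitaOn

/-- The Gauss curvature is invariant under isometries. -/
lemma IsIsometryOn.gaussOf_eq {V U' U : Set Plane} {Φ : Plane → Plane}
    {B' B : Plane → Plane →L[ℝ] Plane →L[ℝ] ℝ} {Γ' Γ : Plane → Plane →L[ℝ] Plane →L[ℝ] Plane}
    (h : IsIsometryOn V U Φ B' B) (hΓ' : IsLeviCivitaOn U' B' Γ')
    (hVU' : V ⊆ U') (hΓ : IsLeviCivitaOn U B Γ) {u : Plane} (hu : u ∈ V) :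
    gaussOf B' Γ' u = gaussOf B Γ (Φ u) := by
  have hU := h.mapsTo hu
  -- One orthonormal pair suffices: its image is orthonormal too, and on both sides the curvature is
  -- the factor in `R(n, t)t = τ n`.
  obtain ⟨t, ht⟩ : ∃ t, B' u t t = 1 := by
    have h0 := hΓ'.pos u (hVU' hu) (planeBasis 0) (by simp)
    refine ⟨(√(B' u (planeBasis 0) (planeBasis 0)))⁻¹ • planeBasis 0, ?_⟩
    simp only [map_smul, smul_apply, smul_eq_mul]
    rw [← mul_assoc, ← mul_inv, Real.mul_self_sqrt h0.le, inv_mul_cancel₀ h0.ne']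
  obtain ⟨hn, hnt⟩ := hΓ'.normalOf_spec (hVU' hu) ht
  set n := normalOf B' (u, t)
  have h1 := hΓ'.curvature_orthonormal (hVU' hu) hn ht hnt
  have h2 := h.curvature hΓ' hVU' hΓ hu n t t
  rw [h.pullback u hu] at hn ht hnt
  rw [h1, hΓ.curvature_orthonormal hU hn ht hnt, map_smul] at h2
  refine smul_left_injective ℝ (fun h0 => ?_) h2
  rw [h0] at hn
  simp at hn

/-! ### Global solutions of local problems on the line. -/

section Gluing

variable {X : Type*} {P : (ℝ → X) → ℝ → Prop}

/-- `P` depends only on germs, and the two curves have the same germ at `s`, so the junction does no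
harm. -/
lemma exists_glue (hloc : ∀ γ γ' t, γ =ᶠ[𝓝 t] γ' → P γ t → P γ' t) {γ₁ γ₂ : ℝ → X}
    {a b s : ℝ} (h₁ : ∀ t ∈ Ioc a s, P γ₁ t) (h₂ : ∀ t ∈ Ico s b, P γ₂ t)
    (hs : γ₁ =ᶠ[𝓝 s] γ₂) :
    ∃ γ : ℝ → X, (∀ t ∈ Ioo a b, P γ t) ∧ (∀ t < s, γ =ᶠ[𝓝 t] γ₁) ∧
      ∀ t, s < t → γ =ᶠ[𝓝 t] γ₂ := by
  classical
  set γ : ℝ → X := fun t => if t < s then γ₁ t else γ₂ t with hγ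
  have hl : ∀ t < s, γ =ᶠ[𝓝 t] γ₁ := fun t ht => by
    filter_upwards [Iio_mem_nhds ht] with r hr
    simp [hγ, mem_Iio.1 hr]
  have hr : ∀ t, s < t → γ =ᶠ[𝓝 t] γ₂ := fun t ht => by
    filter_upwards [Ioi_mem_nhds ht] with r hr
    simp [hγ, (mem_Ioi.1 hr).le]
  refine ⟨γ, fun t ht => ?_, hl, hr⟩
  rcases lt_trichotomy t s with h | rfl | h
  · exact hloc _ _ t (hl t h).symm (h₁ t ⟨ht.1, h.le⟩)
  · refine hloc _ _ t ?_ (h₁ t ⟨ht.1, le_rfl⟩)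
    filter_upwards [hs] with r hr
    by_cases h : r < t
    · simp [hγ, h]
    · simp [hγ, h, hr]
  · exact hloc _ _ t (hr t h).symm (h₂ t ⟨h.le, ht.2⟩)

/-- A local problem on the line with unique continuation, whose solutions near any point extend by
a uniform amount, has global solutions. -/
lemma exists_forall_of_uniform_extension
    (hloc : ∀ γ γ' t, γ =ᶠ[𝓝 t] γ' → P γ t → P γ' t)
    (huniq : ∀ γ γ' a b, ∀ t₀ ∈ Ioo a b, (∀ t ∈ Ioo a b, P γ t) → (∀ t ∈ Ioo a b, P γ' t) →
      γ =ᶠ[𝓝 t₀] γ' → EqOn γ γ' (Ioo a b))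
    {δ : ℝ} (hδ : 0 < δ)
    (hstep : ∀ γ t₀, P γ t₀ → ∃ γ', γ' =ᶠ[𝓝 t₀] γ ∧ ∀ t ∈ Ioo (t₀ - δ) (t₀ + δ), P γ' t)
    {γ₀ : ℝ → X} {t₀ : ℝ} (h₀ : P γ₀ t₀) :
    ∃ γ, γ =ᶠ[𝓝 t₀] γ₀ ∧ ∀ t, P γ t := by
  -- Restarting at distance `δ/2` inside either end and extending by `δ` gains `δ/2` on that side.
  -- The count begins with radius `δ`, that is `2 * (δ/2)`.
  have key : ∀ n : ℕ, ∃ γ, γ =ᶠ[𝓝 t₀] γ₀ ∧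
      ∀ t ∈ Ioo (t₀ - (n + 2) * (δ / 2)) (t₀ + (n + 2) * (δ / 2)), P γ t := by
    intro n
    induction n with
    | zero =>
      obtain ⟨γ, h1, h2⟩ := hstep γ₀ t₀ h₀
      refine ⟨γ, h1, fun t ht => h2 t ?_⟩
      constructor
      · have := ht.1; push_cast at this; linarith
      · have := ht.2; push_cast at this; linarith
    | succ n ih =>
      obtain ⟨γ, h1, h2⟩ := ih
      have hn : (0 : ℝ) ≤ n * (δ / 2) := by positivity
      set r : ℝ := (n + 2) * (δ / 2) with hr
      have hrδ : δ ≤ r := by rw [hr]; linarith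
      have hr' : ((n + 1 : ℕ) + 2 : ℝ) * (δ / 2) = r + δ / 2 := by
        push_cast; rw [hr]; ring
      rw [hr']
      obtain ⟨γp, hp1, hp2⟩ := hstep γ (t₀ + r - δ / 2)
        (h2 _ ⟨by linarith, by linarith⟩)
      obtain ⟨γm, hm1, hm2⟩ := hstep γ (t₀ - r + δ / 2)
        (h2 _ ⟨by linarith, by linarith⟩)
      obtain ⟨γ', h3, h4, -⟩ := exists_glue hloc (a := t₀ - r) (b := t₀ + r + δ / 2)
        (fun t ht => h2 t ⟨ht.1, by linarith [ht.2]⟩)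
        (fun t ht => hp2 t ⟨by linarith [ht.1], by linarith [ht.2]⟩) hp1.symm
      have h5 : γm =ᶠ[𝓝 (t₀ - r + δ / 2)] γ' := hm1.trans (h4 _ (by linarith)).symm
      obtain ⟨γ'', h6, -, h7⟩ := exists_glue hloc (a := t₀ - (r + δ / 2)) (b := t₀ + (r + δ / 2))
        (fun t ht => hm2 t ⟨by linarith [ht.1], by linarith [ht.2]⟩)
        (fun t ht => h3 t ⟨by linarith [ht.1], by linarith [ht.2]⟩) h5
      exact ⟨γ'', ((h7 t₀ (by linarith)).trans (h4 t₀ (by linarith))).trans h1, h6⟩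
  choose G hG1 hG2 using key
  have hmono : ∀ m n : ℕ, m ≤ n →
      EqOn (G m) (G n) (Ioo (t₀ - (m + 2) * (δ / 2)) (t₀ + (m + 2) * (δ / 2))) := by
    intro m n hmn
    have hm : (0 : ℝ) < (m + 2) * (δ / 2) := by positivity
    have hmn' : ((m : ℝ) + 2) * (δ / 2) ≤ (n + 2) * (δ / 2) := by gcongr
    refine huniq _ _ _ _ t₀ ⟨by linarith, by linarith⟩ (hG2 m) (fun t ht => hG2 n t ?_)
      ((hG1 m).trans (hG1 n).symm)
    exact ⟨by linarith [ht.1], by linarith [ht.2]⟩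
  set N : ℝ → ℕ := fun t => ⌈|t - t₀| / (δ / 2)⌉₊ with hN
  have hNt : ∀ t, |t - t₀| ≤ N t * (δ / 2) := fun t =>
    (div_le_iff₀ (by positivity)).1 (Nat.le_ceil _)
  -- The index `N` jumps, but near `t` it is at most `N t + 1`, and `hmono` replaces all these
  -- solutions by the single solution `G (N t + 1)`.
  have hloc' : ∀ t, (fun t => G (N t) t) =ᶠ[𝓝 t] G (N t + 1) := by
    intro t
    have h1 : |t - t₀| < (N t + 1) * (δ / 2) := by have := hNt t; nlinarith
    have h2 : ∀ᶠ s in 𝓝 t, |s - t₀| < (N t + 1) * (δ / 2) :=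
      (by fun_prop : Continuous fun s : ℝ => |s - t₀|).continuousAt.eventually (gt_mem_nhds h1)
    filter_upwards [h2] with s hs
    have h3 : N s ≤ N t + 1 := by
      rw [hN, Nat.ceil_le]
      push_cast
      exact ((div_lt_iff₀ (by positivity)).2 hs).le
    refine hmono _ _ h3 ?_
    have h4 := abs_le.1 (hNt s)
    constructor <;> nlinarith [h4.1, h4.2]
  refine ⟨fun t => G (N t) t, (hloc' t₀).trans (hG1 _), fun t => ?_⟩
  refine hloc _ _ t (hloc' t).symm (hG2 _ t ?_)
  have h4 := abs_le.1 (hNt t)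
  push_cast
  constructor <;> nlinarith [h4.1, h4.2]

end Gluing

/-! ### Linear differential equations. -/

section LinearODE

variable {E : Type*} [NormedAddCommGroup E] [NormedSpace ℝ E]

lemma linear_ode_unique {A : ℝ → E →L[ℝ] E} {C : ℝ} (hC : ∀ t, ‖A t‖ ≤ C) {f g : ℝ → E} {a b s : ℝ}
    (hs : s ∈ Ioo a b) (hf : ∀ t ∈ Ioo a b, HasDerivAt f (A t (f t)) t)
    (hg : ∀ t ∈ Ioo a b, HasDerivAt g (A t (g t)) t) (h : f s = g s) : EqOn f g (Ioo a b) := by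
  have hC0 : 0 ≤ C := (norm_nonneg _).trans (hC 0)
  refine ODE_solution_unique_of_mem_Ioo (v := fun t x => A t x) (s := fun _ => univ)
    (K := ⟨C, hC0⟩) (fun t _ => ?_) hs (fun t ht => ⟨hf t ht, trivial⟩)
    (fun t ht => ⟨hg t ht, trivial⟩) h
  exact ((A t).lipschitz.weaken (hC t)).lipschitzOnWith

/-- Linear differential equations with bounded continuous coefficients have global solutions. -/
lemma exists_linear_ode [CompleteSpace E] {A : ℝ → E →L[ℝ] E} (hA : Continuous A) {C : ℝ}
    (hC : ∀ t, ‖A t‖ ≤ C) (s : ℝ) (x : E) :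
    ∃ f : ℝ → E, f s = x ∧ ∀ t, HasDerivAt f (A t (f t)) t := by
  have hC0 : 0 ≤ C := (norm_nonneg _).trans (hC 0)
  -- Then `C * δ ≤ 1/2`. On the ball of radius `‖x₀‖ + 1` about `x₀` the field is at most `C * (2 *
  -- ‖x₀‖ + 1)`, so a solution stays in it for time `δ`, whatever `x₀` is.
  set δ : ℝ := 1 / (2 * (C + 1)) with hδ
  have hδ0 : 0 < δ := by positivity
  have hloc : ∀ (t₀ : ℝ) (x₀ : E), ∃ f : ℝ → E, f t₀ = x₀ ∧
      ∀ t ∈ Ioo (t₀ - δ) (t₀ + δ), HasDerivAt f (A t (f t)) t := by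
    intro t₀ x₀
    have hpl : IsPicardLindelof (fun t x => A t x) (tmin := t₀ - δ) (tmax := t₀ + δ)
        ⟨t₀, by simp [hδ0.le]⟩ x₀ (‖x₀‖₊ + 1) 0 (⟨C, hC0⟩ * (2 * ‖x₀‖₊ + 1)) ⟨C, hC0⟩ := by
      refine ⟨fun t _ => ((A t).lipschitz.weaken (hC t)).lipschitzOnWith, fun y _ => ?_,
        fun t _ y hy => ?_, ?_⟩
      · exact (hA.clm_apply continuous_const).continuousOn
      · have h1 : ‖y‖ ≤ 2 * ‖x₀‖ + 1 := by
          have h2 := mem_closedBall_iff_norm.1 hy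
          have h3 := norm_le_norm_add_norm_sub' y x₀
          push_cast [coe_nnnorm] at h2
          linarith
        calc ‖A t y‖ ≤ ‖A t‖ * ‖y‖ := (A t).le_opNorm y
          _ ≤ C * (2 * ‖x₀‖ + 1) := by gcongr; exact hC t
      · have h2 : C * δ ≤ 1 / 2 := by
          rw [hδ, mul_one_div, div_le_div_iff₀ (by positivity) (by norm_num)]
          linarith
        have h3 := norm_nonneg x₀
        simp only [add_sub_cancel_left, sub_sub_cancel, max_self, NNReal.coe_zero, sub_zero]
        change C * (2 * ‖x₀‖ + 1) * δ ≤ ‖x₀‖ + 1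
        nlinarith
    obtain ⟨f, h1, h2⟩ := hpl.exists_eq_forall_mem_Icc_hasDerivWithinAt₀
    exact ⟨f, h1, fun t ht => (h2 t (Ioo_subset_Icc_self ht)).hasDerivAt (Icc_mem_nhds ht.1 ht.2)⟩
  have hgerm : ∀ f g : ℝ → E, ∀ t₀, (∀ᶠ t in 𝓝 t₀, HasDerivAt f (A t (f t)) t) →
      (∀ᶠ t in 𝓝 t₀, HasDerivAt g (A t (g t)) t) → f t₀ = g t₀ → f =ᶠ[𝓝 t₀] g := by
    intro f g t₀ hf hg h
    obtain ⟨a, b, h1, h2⟩ := mem_nhds_iff_exists_Ioo_subset.1 (hf.and hg)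
    filter_upwards [Ioo_mem_nhds h1.1 h1.2] with t ht
    exact linear_ode_unique hC h1 (fun t ht => (h2 ht).1) (fun t ht => (h2 ht).2) h ht
  obtain ⟨f₀, h1, h2⟩ := hloc s x
  obtain ⟨f, h3, h4⟩ := exists_forall_of_uniform_extension
    (P := fun f t => ∀ᶠ r in 𝓝 t, HasDerivAt f (A r (f r)) r) (γ₀ := f₀) (t₀ := s)
    (fun f g t hfg hf => by
      filter_upwards [hf, hfg.eventuallyEq_nhds] with r hr hr'
      rw [← hr'.eq_of_nhds]
      exact hr.congr_of_eventuallyEq hr'.symm)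
    (fun f g a b t₀ ht₀ hf hg h => linear_ode_unique hC ht₀ (fun t ht => (hf t ht).self_of_nhds)
      (fun t ht => (hg t ht).self_of_nhds) h.eq_of_nhds)
    hδ0
    (fun f t₀ hf => by
      obtain ⟨g, hg1, hg2⟩ := hloc t₀ (f t₀)
      refine ⟨g, hgerm _ _ _ ?_ hf hg1, fun t ht => ?_⟩
      · filter_upwards [Ioo_mem_nhds (by linarith : t₀ - δ < t₀) (by linarith : t₀ < t₀ + δ)]
          with t ht using hg2 t ht
      · filter_upwards [Ioo_mem_nhds ht.1 ht.2] with r hr using hg2 r hr)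
    (by filter_upwards [Ioo_mem_nhds (by linarith : s - δ < s) (by linarith : s < s + δ)]
          with t ht using h2 t ht)
  exact ⟨f, h3.eq_of_nhds.trans h1, fun t => (h4 t).self_of_nhds⟩

end LinearODE

/-! ### Flows and their first order dependence on initial values. -/

section Flow

variable {F : Type*} [NormedAddCommGroup F] [NormedSpace ℝ F]

/-- Joint continuity of the Picard–Lindelöf flow keeps all trajectories from a small ball inside `W`
for a common time; autonomy allows any initial time `s`. -/
lemma exists_local_flow [CompleteSpace F] {X : F → F} {z₀ : F} (hX : ContDiffAt ℝ 1 X z₀)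
    {W : Set F} (hW : W ∈ 𝓝 z₀) :
    ∃ r > (0 : ℝ), ∃ η > (0 : ℝ), ∀ z ∈ Metric.closedBall z₀ r, ∀ s : ℝ, ∃ α : ℝ → F, α s = z ∧
      ∀ t ∈ Ioo (s - η) (s + η), HasDerivAt α (X (α t)) t ∧ α t ∈ W := by
  obtain ⟨η, hη, a, r, L, K, hr, hpl⟩ := IsPicardLindelof.of_contDiffAt_one hX
  obtain ⟨α, h1, h2⟩ := (hpl 0).exists_forall_mem_closedBall_eq_hasDerivWithinAt_continuousOn
  have h3 : α (z₀, 0) = z₀ := (h1 z₀ (Metric.mem_closedBall_self r.2)).1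
  have h4 : ContinuousAt α (z₀, 0) := h2.continuousAt
    (prod_mem_nhds (Metric.closedBall_mem_nhds _ hr) (Icc_mem_nhds (by simpa) (by simpa)))
  have h5 : α ⁻¹' W ∈ 𝓝 (z₀, (0 : ℝ)) := h4 (by rwa [h3])
  obtain ⟨r', hr', h6⟩ := Metric.mem_nhds_iff.1 h5
  refine ⟨min r (r' / 2), by positivity, min η r', by positivity, fun z hz s => ?_⟩
  have hz1 : z ∈ Metric.closedBall z₀ r := Metric.closedBall_subset_closedBall (min_le_left _ _) hz
  have hz2 : dist z z₀ < r' := by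
    have := (Metric.mem_closedBall.1 hz).trans (min_le_right _ _)
    linarith
  refine ⟨fun t => α (z, t - s), by simpa using (h1 z hz1).1, fun t ht => ⟨?_, ?_⟩⟩
  · have e1 : 0 - η < t - s := by have := ht.1; have := min_le_left η r'; linarith
    have e2 : t - s < 0 + η := by have := ht.2; have := min_le_left η r'; linarith
    have := ((h1 z hz1).2 (t - s) ⟨e1.le, e2.le⟩).hasDerivAt (Icc_mem_nhds e1 e2)
    exact this.comp_sub_const t s
  · refine h6 (a := (z, t - s)) ?_
    rw [← ball_prod_same]
    refine ⟨hz2, ?_⟩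
    rw [Metric.mem_ball, Real.dist_eq, abs_lt]
    have := ht.1; have := ht.2; have := min_le_right η r'
    constructor <;> linarith

variable {X : F → F} {z w : ℝ → F} {zf : ℝ → ℝ → F} {W : Set F} {K : NNReal} {t₀ t₁ : ℝ}

/-- The curve `z + ε w` solves the equation of `X` up to an error `o(ε)`, uniformly on the compact
interval because `X` is strictly differentiable. Grönwall's inequality then compares it with the
true solution `zf ε`. -/
lemma flow_expansion_right (ht : t₀ ≤ t₁) (hK : LipschitzOnWith K X W)
    (hW : ∀ t ∈ Icc t₀ t₁, W ∈ 𝓝 (z t))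
    (hX : ∀ t ∈ Icc t₀ t₁, ContDiffAt ℝ 1 X (z t))
    (hz : ∀ t ∈ Icc t₀ t₁, HasDerivAt z (X (z t)) t)
    (hw : ∀ t ∈ Icc t₀ t₁, HasDerivAt w (fderiv ℝ X (z t) (w t)) t)
    (hzf : ∀ᶠ ε in 𝓝 0, ∀ t ∈ Icc t₀ t₁, HasDerivAt (zf ε) (X (zf ε t)) t ∧ zf ε t ∈ W)
    (h₀ : HasDerivAt (fun ε => zf ε t₀) (w t₀) 0) (h₀₀ : zf 0 t₀ = z t₀) {c : ℝ} (hc : 0 < c) :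
    ∀ᶠ ε in 𝓝 (0 : ℝ), ∀ t ∈ Icc t₀ t₁, ‖zf ε t - z t - ε • w t‖ ≤ c * |ε| := by
  have hzc : ∀ t ∈ Icc t₀ t₁, ContinuousAt z t := fun t ht => (hz t ht).continuousAt
  have hwc : ∀ t ∈ Icc t₀ t₁, ContinuousAt w t := fun t ht => (hw t ht).continuousAt
  obtain ⟨Q, hQ⟩ : ∃ Q, ∀ t ∈ Icc t₀ t₁, ‖w t‖ ≤ Q := by
    obtain ⟨Q, hQ⟩ := isCompact_Icc.exists_bound_of_continuousOn
      (fun t ht => (hwc t ht).continuousWithinAt)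
    exact ⟨Q, hQ⟩
  have hQ0 : 0 ≤ Q := (norm_nonneg _).trans (hQ t₀ ⟨le_rfl, ht⟩)
  -- uniform smallness of the remainder
  have hrem : ∀ c > (0 : ℝ), ∀ᶠ ε in 𝓝 (0 : ℝ), ∀ t ∈ Icc t₀ t₁,
      ‖X (z t) + ε • fderiv ℝ X (z t) (w t) - X (z t + ε • w t)‖ ≤ c * |ε| := by
    intro c hc
    -- The remainder splits into two terms, each at most `c' * |ε| * (Q + 1)`.
    set c' : ℝ := c / (2 * (Q + 1)) with hc'
    have hc0 : 0 < c' := by positivity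
    refine isCompact_Icc.eventually_forall_of_forall_eventually fun t ht => ?_
    have hzt : Tendsto (fun p : ℝ × ℝ => z p.2) (𝓝 (0, t)) (𝓝 (z t)) :=
      (hzc t ht).tendsto.comp (continuous_snd.tendsto (0, t))
    have hwt : Tendsto (fun p : ℝ × ℝ => w p.2) (𝓝 (0, t)) (𝓝 (w t)) :=
      (hwc t ht).tendsto.comp (continuous_snd.tendsto (0, t))
    have hpt : Tendsto (fun p : ℝ × ℝ => z p.2 + p.1 • w p.2) (𝓝 (0, t)) (𝓝 (z t)) := by
      have := hzt.add ((continuous_fst.tendsto ((0 : ℝ), t)).smul hwt)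
      simpa using this
    have hst := ((hX t ht).hasStrictFDerivAt (by simp)).isLittleO.bound hc0
    have hA : ∀ᶠ p in 𝓝 ((0 : ℝ), t), ‖fderiv ℝ X (z p.2) - fderiv ℝ X (z t)‖ < c' := by
      have h1 : ContinuousAt (fderiv ℝ X) (z t) := by
        have : ContDiffAt ℝ 0 (fderiv ℝ X) (z t) := (hX t ht).fderiv_right (m := 0) (by simp)
        exact this.continuousAt
      have h2 := (h1.tendsto.comp hzt).sub_const (fderiv ℝ X (z t))
      rw [sub_self] at h2
      have h3 := h2.norm
      rw [norm_zero] at h3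
      exact h3.eventually (gt_mem_nhds hc0)
    have hw' : ∀ᶠ p in 𝓝 ((0 : ℝ), t), ‖w p.2‖ < Q + 1 :=
      hwt.norm.eventually (gt_mem_nhds (by linarith [hQ t ht]))
    filter_upwards [(hpt.prodMk_nhds hzt).eventually hst, hA, hw'] with p h1 h2 h3
    simp only [add_sub_cancel_left] at h1
    have e1 : X (z p.2) + p.1 • fderiv ℝ X (z p.2) (w p.2) - X (z p.2 + p.1 • w p.2) =
        (fderiv ℝ X (z p.2) - fderiv ℝ X (z t)) (p.1 • w p.2) -
          (X (z p.2 + p.1 • w p.2) - X (z p.2) - fderiv ℝ X (z t) (p.1 • w p.2)) := by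
      simp only [sub_apply, map_smul, smul_sub]
      abel
    have e2 : ‖p.1 • w p.2‖ ≤ |p.1| * (Q + 1) := by
      rw [norm_smul, Real.norm_eq_abs]; gcongr
    rw [e1]
    calc _ ≤ ‖(fderiv ℝ X (z p.2) - fderiv ℝ X (z t)) (p.1 • w p.2)‖ + _ := norm_sub_le _ _
      _ ≤ c' * ‖p.1 • w p.2‖ + c' * ‖p.1 • w p.2‖ := by
          gcongr
          exact (ContinuousLinearMap.le_opNorm _ _).trans (by gcongr)
      _ ≤ c' * (|p.1| * (Q + 1)) + c' * (|p.1| * (Q + 1)) := by gcongr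
      _ = c * |p.1| := by rw [hc']; field_simp; ring
  have hmem : ∀ᶠ ε in 𝓝 (0 : ℝ), ∀ t ∈ Icc t₀ t₁, z t + ε • w t ∈ W := by
    refine isCompact_Icc.eventually_forall_of_forall_eventually fun t ht => ?_
    have hzt : Tendsto (fun p : ℝ × ℝ => z p.2) (𝓝 (0, t)) (𝓝 (z t)) :=
      (hzc t ht).tendsto.comp (continuous_snd.tendsto (0, t))
    have hwt : Tendsto (fun p : ℝ × ℝ => w p.2) (𝓝 (0, t)) (𝓝 (w t)) :=
      (hwc t ht).tendsto.comp (continuous_snd.tendsto (0, t))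
    have hpt : Tendsto (fun p : ℝ × ℝ => z p.2 + p.1 • w p.2) (𝓝 (0, t)) (𝓝 (z t)) := by
      have := hzt.add ((continuous_fst.tendsto ((0 : ℝ), t)).smul hwt)
      simpa using this
    exact hpt (hW t ht)
  -- When the initial error and the defect have the same size, Grönwall's bound is proportional to
  -- it; keeping both below `c / G * |ε|` gives `c * |ε|` at the end.
  set G : ℝ := gronwallBound 1 K 1 (t₁ - t₀) with hG
  have hGmono := gronwallBound_mono (δ := 1) (ε := 1) (K := K) zero_le_one zero_le_one K.2
  have hG1 : 1 ≤ G := by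
    have := hGmono (sub_nonneg.2 ht)
    rwa [gronwallBound_x0] at this
  have hhom : ∀ e x : ℝ, gronwallBound e K e x = e * gronwallBound 1 K 1 x := by
    intro e x
    unfold gronwallBound
    split_ifs <;> ring
  have hc' : 0 < c / G := by positivity
  have hinit : ∀ᶠ ε in 𝓝 (0 : ℝ), ‖zf ε t₀ - z t₀ - ε • w t₀‖ ≤ c / G * |ε| := by
    have := h₀.isLittleO.bound hc'
    simpa [h₀₀] using this
  filter_upwards [hzf, hmem, hrem _ hc', hinit] with ε h1 h2 h3 h4 t htt
  have hIco : Ico t₀ t₁ ⊆ Icc t₀ t₁ := Ico_subset_Icc_self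
  have hd : ∀ t ∈ Icc t₀ t₁, HasDerivAt (fun t => z t + ε • w t)
      (X (z t) + ε • fderiv ℝ X (z t) (w t)) t := fun t ht => (hz t ht).add ((hw t ht).const_smul ε)
  have := dist_le_of_approx_trajectories_ODE_of_mem (v := fun _ => X) (s := fun _ => W)
    (f := zf ε) (g := fun t => z t + ε • w t) (f' := fun t => X (zf ε t)) (εf := 0)
    (εg := c / G * |ε|) (δ := c / G * |ε|) (fun _ _ => hK)
    (fun t ht => (h1 t ht).1.continuousAt.continuousWithinAt)
    (fun t ht => (h1 t (hIco ht)).1.hasDerivWithinAt) (fun t _ => by simp)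
    (fun t ht => (h1 t (hIco ht)).2)
    (fun t ht => (hd t ht).continuousAt.continuousWithinAt)
    (fun t ht => (hd t (hIco ht)).hasDerivWithinAt)
    (fun t ht => by rw [dist_eq_norm]; exact h3 t (hIco ht))
    (fun t ht => h2 t (hIco ht))
    (by rw [dist_eq_norm]; simpa [sub_sub] using h4) t htt
  rw [dist_eq_norm, zero_add, hhom] at this
  rw [sub_sub]
  refine this.trans ?_
  calc c / G * |ε| * gronwallBound 1 K 1 (t - t₀) ≤ c / G * |ε| * G := by
        gcongr
        exact hGmono (by linarith [htt.2])
    _ = c * |ε| := by field_simp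

/-- The first order expansion of a family of solutions of an autonomous differential equation. -/
lemma flow_expansion (hK : LipschitzOnWith K X W)
    (hW : ∀ t ∈ uIcc t₀ t₁, W ∈ 𝓝 (z t))
    (hX : ∀ t ∈ uIcc t₀ t₁, ContDiffAt ℝ 1 X (z t))
    (hz : ∀ t ∈ uIcc t₀ t₁, HasDerivAt z (X (z t)) t)
    (hw : ∀ t ∈ uIcc t₀ t₁, HasDerivAt w (fderiv ℝ X (z t) (w t)) t)
    (hzf : ∀ᶠ ε in 𝓝 0, ∀ t ∈ uIcc t₀ t₁, HasDerivAt (zf ε) (X (zf ε t)) t ∧ zf ε t ∈ W)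
    (h₀ : HasDerivAt (fun ε => zf ε t₀) (w t₀) 0) (h₀₀ : zf 0 t₀ = z t₀) {c : ℝ} (hc : 0 < c) :
    ∀ᶠ ε in 𝓝 (0 : ℝ), ∀ t ∈ uIcc t₀ t₁, ‖zf ε t - z t - ε • w t‖ ≤ c * |ε| := by
  rcases le_total t₀ t₁ with ht | ht
  · rw [uIcc_of_le ht] at *
    exact flow_expansion_right ht hK hW hX hz hw hzf h₀ h₀₀ hc
  · rw [uIcc_of_ge ht] at *
    -- Reversing time turns the backward case into the forward case for `-X`.
    have hneg : ∀ t ∈ Icc (-t₀) (-t₁), -t ∈ Icc t₁ t₀ := fun t ht =>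
      ⟨by linarith [ht.2], by linarith [ht.1]⟩
    have := flow_expansion_right (X := fun x => -X x) (z := fun t => z (-t)) (w := fun t => w (-t))
      (zf := fun ε t => zf ε (-t)) (W := W) (K := K) (t₀ := -t₀) (t₁ := -t₁) (neg_le_neg ht)
      hK.neg
      (fun t ht => hW _ (hneg t ht)) (fun t ht => (hX _ (hneg t ht)).neg)
      (fun t ht => by simpa [Function.comp_def] using (hz _ (hneg t ht)).scomp t (hasDerivAt_neg t))
      (fun t ht => by
        have := (hw _ (hneg t ht)).scomp t (hasDerivAt_neg t)
        simpa [fderiv_fun_neg, Function.comp_def] using this)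
      (by
        filter_upwards [hzf] with ε h t ht
        refine ⟨by simpa [Function.comp_def] using (h _ (hneg t ht)).1.scomp t (hasDerivAt_neg t), (h _ (hneg t ht)).2⟩)
      (by simpa using h₀) (by simpa using h₀₀) hc
    filter_upwards [this] with ε h t ht
    simpa using h (-t) ⟨by linarith [ht.2], by linarith [ht.1]⟩

end Flow

/-! ### Varying the coefficient of `y'' + κ y = 0`. -/

/-- The equation `y'' + k y = 0` as a first order system. -/
def oscillator (k : ℝ) : ℝ × ℝ →L[ℝ] ℝ × ℝ :=
  (ContinuousLinearMap.inl ℝ ℝ ℝ).comp (ContinuousLinearMap.snd ℝ ℝ ℝ) -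
    k • (ContinuousLinearMap.inr ℝ ℝ ℝ).comp (ContinuousLinearMap.fst ℝ ℝ ℝ)

@[simp]
lemma oscillator_apply (k : ℝ) (z : ℝ × ℝ) : oscillator k z = (z.2, -k * z.1) := by
  ext <;> simp [oscillator]

lemma continuous_oscillator : Continuous oscillator :=
  continuous_const.sub (continuous_id.smul continuous_const)

lemma norm_oscillator_le {k C : ℝ} (hk : |k| ≤ C) : ‖oscillator k‖ ≤ C + 1 := by
  have hC : 0 ≤ C := (abs_nonneg k).trans hk
  refine ContinuousLinearMap.opNorm_le_bound _ (by positivity) fun z => ?_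
  rw [oscillator_apply, Prod.norm_mk, Real.norm_eq_abs, Real.norm_eq_abs, abs_mul, abs_neg]
  have h1 : |z.1| ≤ ‖z‖ := norm_fst_le z
  have h2 : |z.2| ≤ ‖z‖ := norm_snd_le z
  have h3 := norm_nonneg z
  refine max_le ?_ ?_
  · nlinarith
  · nlinarith [mul_le_mul hk h1 (abs_nonneg _) hC]

/-- The identity obtained by varying the coefficient of `y'' + κ y = 0` in a family of equations
with all solutions closing up at time `T`. -/
lemma integral_derivative_coefficient_eq_zero {κ : ℝ → ℝ → ℝ} {κd : ℝ → ℝ} {T C K : ℝ} (hT : 0 ≤ T)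
    (hκ : ∀ ε, Continuous (κ ε)) (hC : ∀ ε t, |κ ε t| ≤ C)
    (hK : ∀ᶠ ε in 𝓝 (0 : ℝ), ∀ t ∈ Icc 0 T, |κ ε t - κ 0 t| ≤ K * |ε|)
    (hd : ∀ t ∈ Icc 0 T, HasDerivAt (fun ε => κ ε t) (κd t) 0)
    (hclosed : ∀ ε, ∀ y y' : ℝ → ℝ, (∀ t, HasDerivAt y (y' t) t) →
      (∀ t, HasDerivAt y' (-κ ε t * y t) t) → y T = y 0 ∧ y' T = y' 0)
    {b b' c c' : ℝ → ℝ} (hb : ∀ t, HasDerivAt b (b' t) t)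
    (hb' : ∀ t, HasDerivAt b' (-κ 0 t * b t) t) (hc : ∀ t, HasDerivAt c (c' t) t)
    (hc' : ∀ t, HasDerivAt c' (-κ 0 t * c t) t) :
    ∫ t in (0 : ℝ)..T, κd t * (b t * c t) = 0 := by
  have hcb : Continuous b := continuous_iff_continuousAt.2 fun t => (hb t).continuousAt
  have hcc : Continuous c := continuous_iff_continuousAt.2 fun t => (hc t).continuousAt
  have hC0 : 0 ≤ C := (abs_nonneg _).trans (hC 0 0)
  have hf : ∀ ε, ∃ f : ℝ → ℝ × ℝ, f 0 = (b 0, b' 0) ∧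
      ∀ t, HasDerivAt f (oscillator (κ ε t) (f t)) t := fun ε =>
    exists_linear_ode (continuous_oscillator.comp (hκ ε)) (fun t => norm_oscillator_le (hC ε t)) _ _
  choose f hf0 hf using hf
  have hf1 : ∀ ε t, HasDerivAt (fun t => (f ε t).1) (f ε t).2 t := fun ε t => by
    simpa using (hf ε t).hasFDerivAt.fst.hasDerivAt
  have hf2 : ∀ ε t, HasDerivAt (fun t => (f ε t).2) (-κ ε t * (f ε t).1) t :=
    fun ε t => by
    simpa using (hf ε t).hasFDerivAt.snd.hasDerivAt
  have hfc : ∀ ε, Continuous (f ε) := fun ε =>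
    continuous_iff_continuousAt.2 fun t => (hf ε t).continuousAt
  obtain ⟨B, hB⟩ := isCompact_Icc.exists_bound_of_continuousOn (s := Icc 0 T) hcb.continuousOn
  obtain ⟨N, hN⟩ := isCompact_Icc.exists_bound_of_continuousOn (s := Icc 0 T) hcc.continuousOn
  simp only [Real.norm_eq_abs] at hB hN
  have hB0 : 0 ≤ B := (abs_nonneg _).trans (hB 0 ⟨le_rfl, hT⟩)
  have hN0 : 0 ≤ N := (abs_nonneg _).trans (hN 0 ⟨le_rfl, hT⟩)
  -- the solutions depend continuously on the coefficient
  obtain ⟨D, hD⟩ : ∃ D, ∀ᶠ ε in 𝓝 (0 : ℝ), ∀ t ∈ Icc 0 T, |(f ε t).1 - b t| ≤ D * |ε| := by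
    -- Grönwall's constant: the system has Lipschitz constant `C + 1`, and `b` solves the perturbed
    -- equation up to `(κ ε - κ 0) b`, of size at most `B * |K| * |ε|`.
    set c₀ : ℝ := B * |K| / (C + 1) * (Real.exp ((C + 1) * T) - 1) with hc₀
    refine ⟨c₀, ?_⟩
    filter_upwards [hK] with ε hε t ht
    have h1 := dist_le_of_approx_trajectories_ODE (v := fun t x => oscillator (κ ε t) x)
      (K := ⟨C + 1, by positivity⟩) (f := f ε) (g := fun t => (b t, b' t)) (a := 0) (b := T)
      (f' := fun t => oscillator (κ ε t) (f ε t)) (g' := fun t => (b' t, -κ 0 t * b t))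
      (εf := 0) (εg := B * (|K| * |ε|)) (δ := 0)
      (fun t => ((oscillator (κ ε t)).lipschitz.weaken (norm_oscillator_le (hC ε t))))
      (hfc ε).continuousOn (fun t _ => (hf ε t).hasDerivWithinAt) (fun t _ => by simp)
      (fun t _ => ((hb t).prodMk (hb' t)).continuousAt.continuousWithinAt)
      (fun t _ => ((hb t).prodMk (hb' t)).hasDerivWithinAt)
      (fun t ht => by
        have ht' : t ∈ Icc 0 T := ⟨ht.1, ht.2.le⟩
        rw [oscillator_apply, Prod.dist_eq, dist_self, Real.dist_eq]
        refine max_le (by positivity) ?_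
        rw [← sub_mul, abs_mul, mul_comm, neg_sub_neg]
        exact mul_le_mul (hB t ht') ((hε t ht').trans (by gcongr; exact le_abs_self K))
          (abs_nonneg _) hB0)
      (by rw [hf0]; simp) t ht
    have hC1 : C + 1 ≠ 0 := by positivity
    rw [gronwallBound_of_K_ne_0 (by exact hC1)] at h1
    have h2 : |(f ε t).1 - b t| ≤ dist (f ε t) (b t, b' t) := by
      rw [Prod.dist_eq]
      exact le_max_left _ _
    refine (h2.trans h1).trans ?_
    rw [hc₀]
    change 0 * _ + (0 + B * (|K| * |ε|)) / (C + 1) * (Real.exp ((C + 1) * (t - 0)) - 1) ≤ _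
    have h3 : Real.exp ((C + 1) * (t - 0)) ≤ Real.exp ((C + 1) * T) := by
      rw [sub_zero]
      gcongr
      exact ht.2
    have h4 : 0 ≤ B * (|K| * |ε|) / (C + 1) := by positivity
    calc _ = B * (|K| * |ε|) / (C + 1) * (Real.exp ((C + 1) * (t - 0)) - 1) := by ring
      _ ≤ B * (|K| * |ε|) / (C + 1) * (Real.exp ((C + 1) * T) - 1) := by gcongr
      _ = _ := by ring
  -- the Wronskian of the two solutions
  have hW : ∀ ε, ∫ t in (0 : ℝ)..T, (κ ε t - κ 0 t) * ((f ε t).1 * c t) = 0 := by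
    intro ε
    have h1 : ∀ t, HasDerivAt (fun t => (f ε t).1 * c' t - (f ε t).2 * c t)
        ((κ ε t - κ 0 t) * ((f ε t).1 * c t)) t := fun t =>
      (((hf1 ε t).mul (hc' t)).sub ((hf2 ε t).mul (hc t))).congr_deriv (by ring)
    have h2 := hclosed ε _ _ (hf1 ε) (hf2 ε)
    have h3 := hclosed 0 _ _ hc hc'
    rw [intervalIntegral.integral_eq_sub_of_hasDerivAt (fun t _ => h1 t)
      (Continuous.intervalIntegrable (((hκ ε).sub (hκ 0)).mul ((hfc ε).fst.mul hcc)) _ _)]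
    simp only [h2.1, h2.2, h3.1, h3.2, sub_self]
  -- Dominated convergence: the difference quotients of the coefficient are bounded by `|K|`, and
  -- for `|ε| < 1` the perturbed solutions are bounded by `B + |D|` and tend to `b`.
  have hlim : Tendsto (fun ε => ∫ t in (0 : ℝ)..T, ε⁻¹ * (κ ε t - κ 0 t) * ((f ε t).1 * c t))
      (𝓝[≠] 0) (𝓝 (∫ t in (0 : ℝ)..T, κd t * (b t * c t))) := by
    refine intervalIntegral.tendsto_integral_filter_of_dominated_convergence
      (fun _ => |K| * ((B + |D|) * N)) (Eventually.of_forall fun ε => ?_) ?_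
      intervalIntegrable_const ?_
    · exact (((continuous_const.mul ((hκ ε).sub (hκ 0))).mul
        ((hfc ε).fst.mul hcc))).aestronglyMeasurable
    · have h1 : ∀ᶠ ε in 𝓝 (0 : ℝ), |ε| < 1 :=
        continuous_abs.continuousAt.eventually (gt_mem_nhds (by simp))
      filter_upwards [hK.filter_mono nhdsWithin_le_nhds, hD.filter_mono nhdsWithin_le_nhds,
        h1.filter_mono nhdsWithin_le_nhds, self_mem_nhdsWithin] with ε hε1 hε2 hε3 hε0
      refine Eventually.of_forall fun t ht => ?_
      rw [uIoc_of_le hT] at ht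
      have ht' : t ∈ Icc 0 T := ⟨ht.1.le, ht.2⟩
      have hε0' : 0 < |ε| := abs_pos.2 hε0
      have e1 : |ε⁻¹ * (κ ε t - κ 0 t)| ≤ |K| := by
        rw [abs_mul, abs_inv, inv_mul_le_iff₀ hε0', mul_comm]
        exact (hε1 t ht').trans (mul_le_mul_of_nonneg_right (le_abs_self K) hε0'.le)
      have e2 : |(f ε t).1| ≤ B + |D| := by
        have h2 := hε2 t ht'
        have h3 : D * |ε| ≤ |D| := by
          have := mul_le_mul_of_nonneg_right (le_abs_self D) hε0'.le
          nlinarith [abs_nonneg D]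
        have h4 := abs_sub_abs_le_abs_sub (f ε t).1 (b t)
        linarith [hB t ht']
      rw [Real.norm_eq_abs, abs_mul, abs_mul (f ε t).1]
      gcongr
      exact hN t ht'
    · refine Eventually.of_forall fun t ht => ?_
      rw [uIoc_of_le hT] at ht
      have ht' : t ∈ Icc 0 T := ⟨ht.1.le, ht.2⟩
      have h1 := (hasDerivAt_iff_tendsto_slope_zero.1 (hd t ht'))
      have h2 : Tendsto (fun ε => (f ε t).1) (𝓝[≠] 0) (𝓝 (b t)) := by
        refine Tendsto.mono_left ?_ nhdsWithin_le_nhds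
        rw [tendsto_iff_norm_sub_tendsto_zero]
        refine squeeze_zero' (Eventually.of_forall fun _ => norm_nonneg _)
          (hD.mono fun ε hε => hε t ht') ?_
        have : Tendsto (fun ε : ℝ => D * |ε|) (𝓝 0) (𝓝 (D * |0|)) :=
          (continuous_const.mul continuous_abs).tendsto _
        simpa using this
      simpa using h1.mul (h2.mul_const (c t))
  have hzero : ∀ ε, ∫ t in (0 : ℝ)..T, ε⁻¹ * (κ ε t - κ 0 t) * ((f ε t).1 * c t) = 0 := by
    intro ε
    simp_rw [mul_assoc ε⁻¹]
    rw [intervalIntegral.integral_const_mul, hW, mul_zero]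
  simp only [hzero] at hlim
  exact (tendsto_nhds_unique hlim tendsto_const_nhds)

/-! ### Differentials of charts of the surface. -/

variable {M : Type*} [TopologicalSpace M] [ChartedSpace Plane M] [IsManifold (𝓡 2) ∞ M]

section Charts

lemma contMDiffAt_chart_symm {p : M} {u : Plane} (hu : u ∈ (extChartAt (𝓡 2) p).target) :
    ContMDiffAt 𝓘(ℝ, Plane) (𝓡 2) ∞ (extChartAt (𝓡 2) p).symm u :=
  (contMDiffOn_extChartAt_symm p).contMDiffAt ((isOpen_extChartAt_target p).mem_nhds hu)

lemma mdifferentiableAt_chart_symm {p : M} {u : Plane} (hu : u ∈ (extChartAt (𝓡 2) p).target) :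
    MDifferentiableAt 𝓘(ℝ, Plane) (𝓡 2) (extChartAt (𝓡 2) p).symm u :=
  (contMDiffAt_chart_symm hu).mdifferentiableAt (by simp)

lemma mdifferentiableAt_chart {p x : M} (hx : x ∈ (chartAt Plane p).source) :
    MDifferentiableAt (𝓡 2) 𝓘(ℝ, Plane) (extChartAt (𝓡 2) p) x :=
  mdifferentiableAt_extChartAt hx

lemma mfderiv_chart_comp_symm {p : M} {u : Plane} (hu : u ∈ (extChartAt (𝓡 2) p).target)
    (v : Plane) :
    mfderiv (𝓡 2) 𝓘(ℝ, Plane) (extChartAt (𝓡 2) p) ((extChartAt (𝓡 2) p).symm u)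
      (mfderiv 𝓘(ℝ, Plane) (𝓡 2) (extChartAt (𝓡 2) p).symm u v) = v := by
  have h := mfderiv_extChartAt_comp_mfderivWithin_extChartAt_symm (I := 𝓡 2) (x := p) hu
  rw [ModelWithCorners.range_eq_univ, mfderivWithin_univ] at h
  exact congrArg (fun L => L v) h

lemma mfderiv_symm_comp_chart {p x : M} (hx : x ∈ (chartAt Plane p).source)
    (v : TangentSpace (𝓡 2) x) :
    (mfderiv 𝓘(ℝ, Plane) (𝓡 2) (extChartAt (𝓡 2) p).symm (extChartAt (𝓡 2) p x)
      (mfderiv (𝓡 2) 𝓘(ℝ, Plane) (extChartAt (𝓡 2) p) x v) : Plane) = v := by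
  have h := mfderivWithin_extChartAt_symm_comp_mfderiv_extChartAt' (I := 𝓡 2) (x := p) (y := x)
    (by simpa using hx)
  rw [ModelWithCorners.range_eq_univ, mfderivWithin_univ] at h
  exact congrArg (fun L => L v) h

/-- The field is the tangent map of the inverse chart applied to a constant section. -/
lemma contMDiffAt_coordField {p : M} {u : Plane} (hu : u ∈ (extChartAt (𝓡 2) p).target)
    (v : Plane) :
    ContMDiffAt 𝓘(ℝ, Plane) ((𝓡 2).prod 𝓘(ℝ, Plane)) ∞
      (fun w => Bundle.TotalSpace.mk' Plane (E := fun x : M => TangentSpace (𝓡 2) x)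
        ((extChartAt (𝓡 2) p).symm w)
        (mfderiv 𝓘(ℝ, Plane) (𝓡 2) (extChartAt (𝓡 2) p).symm w v)) u := by
  have hopen := isOpen_extChartAt_target (I := 𝓡 2) p
  have h1 := (contMDiffOn_extChartAt_symm (I := 𝓡 2) (n := ∞) p).contMDiffOn_tangentMapWithin
    (m := ∞) (by simp) hopen.uniqueMDiffOn
  have h2 : ContMDiff 𝓘(ℝ, Plane) (𝓘(ℝ, Plane).prod 𝓘(ℝ, Plane)) ∞
      (fun w : Plane => (⟨w, v⟩ : TangentBundle 𝓘(ℝ, Plane) Plane)) := by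
    intro w
    exact (contMDiffAt_vectorSpace_iff_contDiffAt (V := fun _ => v)).2 contDiffAt_const
  have h3 := h1.comp (s := (extChartAt (𝓡 2) p).target) h2.contMDiffOn (fun w hw => hw)
  refine (h3.contMDiffAt (hopen.mem_nhds hu)).congr_of_eventuallyEq ?_
  filter_upwards [hopen.mem_nhds hu] with w hw
  simp only [Function.comp_def, tangentMapWithin]
  rw [mfderivWithin_of_mem_nhds (hopen.mem_nhds hw)]

end Charts

/-! ### The metric and its Christoffel symbols in a chart. -/

namespace SurfaceMetric

variable (g : SurfaceMetric M)

/-- The metric in the chart at `p`, as a field of bilinear forms on the plane. -/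
def chartMetric (p : M) (u : Plane) : Plane →L[ℝ] Plane →L[ℝ] ℝ :=
  ∑ i, ∑ j, g.metricMatrix p u i j •
    (EuclideanSpace.proj i : Plane →L[ℝ] ℝ).smulRight (EuclideanSpace.proj j : Plane →L[ℝ] ℝ)

/-- The Christoffel symbols in the chart at `p`, as a field of bilinear maps on the plane. -/
def chartChristoffel (p : M) (u : Plane) : Plane →L[ℝ] Plane →L[ℝ] Plane :=
  ∑ k, ∑ i, ∑ j, g.christoffel p k i j u • (EuclideanSpace.proj i : Plane →L[ℝ] ℝ).smulRight
    ((EuclideanSpace.proj j : Plane →L[ℝ] ℝ).smulRight (planeBasis k))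

lemma chartMetric_apply_sum (p : M) (u v w : Plane) :
    g.chartMetric p u v w = ∑ i, ∑ j, v i * w j * g.metricMatrix p u i j := by
  simp [chartMetric, Fin.sum_univ_two, ContinuousLinearMap.smulRight_apply]
  ring

lemma chartMetric_apply (p : M) (u v w : Plane) :
    g.chartMetric p u v w = g.inner ((extChartAt (𝓡 2) p).symm u)
      (mfderiv 𝓘(ℝ, Plane) (𝓡 2) (extChartAt (𝓡 2) p).symm u v)
      (mfderiv 𝓘(ℝ, Plane) (𝓡 2) (extChartAt (𝓡 2) p).symm u w) := by
  rw [chartMetric_apply_sum]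
  set D := mfderiv 𝓘(ℝ, Plane) (𝓡 2) (extChartAt (𝓡 2) p).symm u with hD
  have h : ∀ x : Plane, D x = x 0 • coordVec p 0 u + x 1 • coordVec p 1 u := by
    intro x
    conv_lhs => rw [plane_eq x]
    erw [map_add, map_smul, map_smul]
    rfl
  rw [h v, h w]
  simp only [Fin.sum_univ_two, map_add, map_smul, add_apply, smul_apply, smul_eq_mul,
    metricMatrix, Matrix.of_apply]
  ring

lemma chartChristoffel_apply (p : M) (u v w : Plane) (k : Fin 2) :
    g.chartChristoffel p u v w k = ∑ i, ∑ j, g.christoffel p k i j u * v i * w j := by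
  fin_cases k <;>
  simp [chartChristoffel, Fin.sum_univ_two, ContinuousLinearMap.smulRight_apply] <;> ring

lemma contDiffAt_metricMatrix {p : M} {u : Plane} (hu : u ∈ (extChartAt (𝓡 2) p).target)
    (i j : Fin 2) : ContDiffAt ℝ ∞ (fun u => g.metricMatrix p u i j) u := by
  rw [← contMDiffAt_iff_contDiffAt]
  have h1 : ContMDiffAt 𝓘(ℝ, Plane) ((𝓡 2).prod 𝓘(ℝ, Plane →L[ℝ] Plane →L[ℝ] ℝ)) ∞
      (fun w => Bundle.TotalSpace.mk' (Plane →L[ℝ] Plane →L[ℝ] ℝ)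
        (E := fun x : M => TangentSpace (𝓡 2) x →L[ℝ] TangentSpace (𝓡 2) x →L[ℝ] ℝ)
        ((extChartAt (𝓡 2) p).symm w) (g.inner ((extChartAt (𝓡 2) p).symm w))) u :=
    ContMDiffAt.comp u g.contMDiff.contMDiffAt (contMDiffAt_chart_symm hu)
  have h2 : ContMDiffAt 𝓘(ℝ, Plane) ((𝓡 2).prod 𝓘(ℝ)) ∞
      (fun w => Bundle.TotalSpace.mk' ℝ (E := Bundle.Trivial M ℝ)
        ((extChartAt (𝓡 2) p).symm w) (g.metricMatrix p w i j)) u :=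
    ContMDiffAt.clm_bundle_apply₂ (F₁ := Plane) (F₂ := Plane) h1
      (contMDiffAt_coordField hu (planeBasis i)) (contMDiffAt_coordField hu (planeBasis j))
  simp only [Bundle.contMDiffAt_totalSpace] at h2
  exact h2.2

end SurfaceMetric

namespace SurfaceMetric

variable (g : SurfaceMetric M)

lemma chartMetric_pos {p : M} {u : Plane} (hu : u ∈ (extChartAt (𝓡 2) p).target) {v : Plane}
    (hv : v ≠ 0) : 0 < g.chartMetric p u v v := by
  rw [chartMetric_apply]
  refine g.pos _ _ fun h0 => hv ?_
  rw [← mfderiv_chart_comp_symm hu v, h0]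
  exact map_zero _

lemma metricMatrix_symm (p : M) (u : Plane) (i j : Fin 2) :
    g.metricMatrix p u i j = g.metricMatrix p u j i := by
  simp only [metricMatrix, Matrix.of_apply]
  exact g.symm _ _ _

lemma det_metricMatrix (p : M) (u : Plane) :
    (g.metricMatrix p u).det = gramDet (g.chartMetric p u) := by
  simp [Matrix.det_fin_two, gramDet, chartMetric_apply_sum]

lemma det_metricMatrix_pos {p : M} {u : Plane} (hu : u ∈ (extChartAt (𝓡 2) p).target) :
    0 < (g.metricMatrix p u).det := by
  have h0 := g.chartMetric_pos hu (v := planeBasis 0) (by simp)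
  have h1 := g.chartMetric_pos hu (v := g.metricMatrix p u 0 0 • planeBasis 1
    - g.metricMatrix p u 0 1 • planeBasis 0) (by
      intro h2
      have := congrArg (fun v : Plane => v 1) h2
      simp at this
      simp [chartMetric_apply_sum] at h0
      exact h0.ne' this)
  simp [chartMetric_apply_sum, Fin.sum_univ_two] at h0 h1
  rw [Matrix.det_fin_two]
  have h3 := g.metricMatrix_symm p u 1 0
  rw [h3] at h1 ⊢
  by_contra hcon
  nlinarith

lemma contDiffAt_partialDeriv_metricMatrix {p : M} {u : Plane}
    (hu : u ∈ (extChartAt (𝓡 2) p).target) (k i j : Fin 2) :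
    ContDiffAt ℝ ∞ (fun u => partialDeriv k (fun w => g.metricMatrix p w i j) u) u :=
  ((g.contDiffAt_metricMatrix hu i j).fderiv_right (m := ∞) (by simp)).clm_apply contDiffAt_const

lemma inv_metricMatrix (p : M) (u : Plane) :
    (g.metricMatrix p u)⁻¹ = (g.metricMatrix p u).det⁻¹ •
      !![g.metricMatrix p u 1 1, -g.metricMatrix p u 0 1;
        -g.metricMatrix p u 1 0, g.metricMatrix p u 0 0] := by
  rw [Matrix.inv_def, Matrix.adjugate_fin_two, Ring.inverse_eq_inv']

lemma contDiffAt_inv_metricMatrix {p : M} {u : Plane} (hu : u ∈ (extChartAt (𝓡 2) p).target)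
    (i j : Fin 2) : ContDiffAt ℝ ∞ (fun u => (g.metricMatrix p u)⁻¹ i j) u := by
  have hd : ContDiffAt ℝ ∞ (fun u => (g.metricMatrix p u).det⁻¹) u := by
    refine ContDiffAt.inv ?_ (g.det_metricMatrix_pos hu).ne'
    simp only [Matrix.det_fin_two]
    exact ((g.contDiffAt_metricMatrix hu 0 0).mul (g.contDiffAt_metricMatrix hu 1 1)).sub
      ((g.contDiffAt_metricMatrix hu 0 1).mul (g.contDiffAt_metricMatrix hu 1 0))
  simp only [inv_metricMatrix, Matrix.smul_apply, smul_eq_mul]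
  refine hd.mul ?_
  fin_cases i <;> fin_cases j <;>
    simp [g.contDiffAt_metricMatrix hu, (g.contDiffAt_metricMatrix hu _ _).neg]

lemma contDiffAt_christoffel {p : M} {u : Plane} (hu : u ∈ (extChartAt (𝓡 2) p).target)
    (k i j : Fin 2) : ContDiffAt ℝ ∞ (g.christoffel p k i j) u := by
  refine contDiffAt_const.mul (ContDiffAt.sum fun l _ => ?_)
  exact (g.contDiffAt_inv_metricMatrix hu k l).mul
    (((g.contDiffAt_partialDeriv_metricMatrix hu i j l).add
      (g.contDiffAt_partialDeriv_metricMatrix hu j i l)).sub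
      (g.contDiffAt_partialDeriv_metricMatrix hu l i j))

/-- Lowering the upper index cancels the inverse matrix in the definition of `christoffel`; what
remains is Koszul's formula on coordinate fields. -/
lemma sum_christoffel_mul_metric {p : M} {u : Plane} (hu : u ∈ (extChartAt (𝓡 2) p).target)
    (i j l : Fin 2) :
    2 * ∑ k, g.christoffel p k i j u * g.metricMatrix p u k l =
      partialDeriv i (fun w => g.metricMatrix p w j l) u
      + partialDeriv j (fun w => g.metricMatrix p w i l) u
      - partialDeriv l (fun w => g.metricMatrix p w i j) u := by
  have hd := (g.det_metricMatrix_pos hu).ne'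
  simp only [christoffel, Fin.sum_univ_two]
  set A : Fin 2 → ℝ := fun l => partialDeriv i (fun w => g.metricMatrix p w j l) u
      + partialDeriv j (fun w => g.metricMatrix p w i l) u
      - partialDeriv l (fun w => g.metricMatrix p w i j) u with hA
  change 2 * (1 / 2 * ((g.metricMatrix p u)⁻¹ 0 0 * A 0 + (g.metricMatrix p u)⁻¹ 0 1 * A 1)
      * g.metricMatrix p u 0 l
    + 1 / 2 * ((g.metricMatrix p u)⁻¹ 1 0 * A 0 + (g.metricMatrix p u)⁻¹ 1 1 * A 1)
      * g.metricMatrix p u 1 l) = A l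
  clear_value A
  have hs := g.metricMatrix_symm p u 1 0
  have hdet := Matrix.det_fin_two (g.metricMatrix p u)
  rw [hs] at hdet
  simp only [inv_metricMatrix, Matrix.smul_apply, smul_eq_mul, hs]
  fin_cases l
  · simp [hs]
    field_simp
    rw [hdet]
    ring
  · simp
    field_simp
    rw [hdet]
    ring

lemma fderiv_chartMetric {p : M} {u : Plane} (hu : u ∈ (extChartAt (𝓡 2) p).target)
    (z v w : Plane) :
    fderiv ℝ (g.chartMetric p) u z v w = ∑ l, ∑ i, ∑ j, z l * v i * w j *
      partialDeriv l (fun x => g.metricMatrix p x i j) u := by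
  have hG : ∀ i j, HasFDerivAt (fun u => g.metricMatrix p u i j)
      (fderiv ℝ (fun u => g.metricMatrix p u i j) u) u := fun i j =>
    ((g.contDiffAt_metricMatrix hu i j).differentiableAt (by simp)).hasFDerivAt
  have h1 : HasFDerivAt (g.chartMetric p) _ u :=
    HasFDerivAt.fun_sum fun i (_ : i ∈ Finset.univ) => HasFDerivAt.fun_sum
      fun j (_ : j ∈ Finset.univ) => (hG i j).smul_const
        ((EuclideanSpace.proj i : Plane →L[ℝ] ℝ).smulRight (EuclideanSpace.proj j : Plane →L[ℝ] ℝ))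
  rw [h1.fderiv]
  have h2 : ∀ i j, fderiv ℝ (fun u => g.metricMatrix p u i j) u z =
      ∑ l, z l * partialDeriv l (fun x => g.metricMatrix p x i j) u := by
    intro i j
    conv_lhs => rw [plane_eq z]
    simp [partialDeriv, Fin.sum_univ_two]
  simp [Fin.sum_univ_two, h2, ContinuousLinearMap.smulRight_apply]
  ring

/-- The bridge from index notation to the invariant calculus; Koszul's formula for general vectors
is the combination of its eight coordinate cases. -/
lemma isLeviCivitaOn (p : M) :
    IsLeviCivitaOn (extChartAt (𝓡 2) p).target (g.chartMetric p) (g.chartChristoffel p) where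
  isOpen := isOpen_extChartAt_target p
  contDiffOn_metric u hu := by
    refine ContDiffAt.contDiffWithinAt (ContDiffAt.sum fun i _ => ContDiffAt.sum fun j _ => ?_)
    exact (g.contDiffAt_metricMatrix hu i j).smul contDiffAt_const
  contDiffOn_christoffel u hu := by
    refine ContDiffAt.contDiffWithinAt
      (ContDiffAt.sum fun k _ => ContDiffAt.sum fun i _ => ContDiffAt.sum fun j _ => ?_)
    exact (g.contDiffAt_christoffel hu k i j).smul contDiffAt_const
  symm u _ v w := by
    rw [chartMetric_apply, chartMetric_apply]
    exact g.symm _ _ _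
  pos u hu v hv := g.chartMetric_pos hu hv
  koszul u hu v w z := by
    have h := g.sum_christoffel_mul_metric hu
    simp only [fderiv_chartMetric g hu, chartMetric_apply_sum, chartChristoffel_apply,
      Fin.sum_univ_two] at h ⊢
    linear_combination v 0 * w 0 * z 0 * h 0 0 0 + v 0 * w 0 * z 1 * h 0 0 1
      + v 0 * w 1 * z 0 * h 0 1 0 + v 0 * w 1 * z 1 * h 0 1 1
      + v 1 * w 0 * z 0 * h 1 0 0 + v 1 * w 0 * z 1 * h 1 0 1
      + v 1 * w 1 * z 0 * h 1 1 0 + v 1 * w 1 * z 1 * h 1 1 1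

/-! ### Coordinate changes. -/

/-- The coordinate change from the chart at `q` to the chart at `p`. -/
def coordChange (q p : M) (u : Plane) : Plane := extChartAt (𝓡 2) p ((extChartAt (𝓡 2) q).symm u)

/-- The domain of the coordinate change from the chart at `q` to the chart at `p`. -/
def overlap (q p : M) : Set Plane :=
  (extChartAt (𝓡 2) q).target ∩ (extChartAt (𝓡 2) q).symm ⁻¹' (chartAt Plane p).source

lemma overlap_subset (q p : M) : overlap q p ⊆ (extChartAt (𝓡 2) q).target := inter_subset_left

lemma mem_overlap {q p x : M} (hq : x ∈ (chartAt Plane q).source)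
    (hp : x ∈ (chartAt Plane p).source) : extChartAt (𝓡 2) q x ∈ overlap q p := by
  refine ⟨(extChartAt (𝓡 2) q).map_source (by simpa using hq), ?_⟩
  rw [mem_preimage, (extChartAt (𝓡 2) q).left_inv (by simpa using hq)]
  exact hp

lemma coordChange_apply {q p x : M} (hq : x ∈ (chartAt Plane q).source) :
    coordChange q p (extChartAt (𝓡 2) q x) = extChartAt (𝓡 2) p x := by
  rw [coordChange, (extChartAt (𝓡 2) q).left_inv (by simpa using hq)]

lemma fderiv_coordChange {q p : M} {u : Plane} (hu : u ∈ overlap q p) (v : Plane) :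
    fderiv ℝ (coordChange q p) u v =
      mfderiv (𝓡 2) 𝓘(ℝ, Plane) (extChartAt (𝓡 2) p) ((extChartAt (𝓡 2) q).symm u)
        (mfderiv 𝓘(ℝ, Plane) (𝓡 2) (extChartAt (𝓡 2) q).symm u v) := by
  rw [← mfderiv_eq_fderiv]
  have := mfderiv_comp u (mdifferentiableAt_chart hu.2) (mdifferentiableAt_chart_symm hu.1)
  exact congrArg (fun L => L v) this

/-- Both chart metrics represent the same inner product on the same tangent space. All independence
of the chart below comes from this. -/
lemma isIsometryOn_coordChange (q p : M) :
    IsIsometryOn (overlap q p) (extChartAt (𝓡 2) p).target (coordChange q p)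
      (g.chartMetric q) (g.chartMetric p) where
  isOpen := by
    have h1 : ContinuousOn (extChartAt (𝓡 2) q).symm (extChartAt (𝓡 2) q).target :=
      continuousOn_extChartAt_symm q
    exact h1.isOpen_inter_preimage (isOpen_extChartAt_target q) (chartAt Plane p).open_source
  mapsTo u hu := (extChartAt (𝓡 2) p).map_source (by simpa using hu.2)
  contDiffOn u hu := by
    refine ContDiffAt.contDiffWithinAt ?_
    rw [← contMDiffAt_iff_contDiffAt]
    exact ContMDiffAt.comp u (contMDiffAt_extChartAt' hu.2) (contMDiffAt_chart_symm hu.1)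
  surjective u hu v := by
    set x := (extChartAt (𝓡 2) q).symm u with hx
    have hxq : x ∈ (chartAt Plane q).source := by
      rw [← extChartAt_source (I := 𝓡 2)]
      exact (extChartAt (𝓡 2) q).map_target hu.1
    have hxp : x ∈ (extChartAt (𝓡 2) p).source := by
      rw [extChartAt_source]
      exact hu.2
    have hux : u = extChartAt (𝓡 2) q x := ((extChartAt (𝓡 2) q).right_inv hu.1).symm
    have hv : extChartAt (𝓡 2) p x ∈ (extChartAt (𝓡 2) p).target :=
      (extChartAt (𝓡 2) p).map_source hxp
    set w : TangentSpace (𝓡 2) x := mfderiv 𝓘(ℝ, Plane) (𝓡 2) (extChartAt (𝓡 2) p).symm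
      (extChartAt (𝓡 2) p x) v with hw
    refine ⟨mfderiv (𝓡 2) 𝓘(ℝ, Plane) (extChartAt (𝓡 2) q) x w, (fderiv_coordChange hu _).trans ?_⟩
    have h1 := mfderiv_symm_comp_chart hxq w
    rw [← hux] at h1
    have h2 := mfderiv_chart_comp_symm hv v
    rw [(extChartAt (𝓡 2) p).left_inv hxp] at h2
    erw [h1]
    exact h2
  pullback u hu v w := by
    have hp : (extChartAt (𝓡 2) q).symm u ∈ (chartAt Plane p).source := hu.2
    rw [chartMetric_apply, chartMetric_apply, fderiv_coordChange hu, fderiv_coordChange hu]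
    have h1 := mfderiv_symm_comp_chart hp
    have h2 : (extChartAt (𝓡 2) p).symm (coordChange q p u) = (extChartAt (𝓡 2) q).symm u :=
      (extChartAt (𝓡 2) p).left_inv (by simpa using hp)
    have h3 : coordChange q p u = extChartAt (𝓡 2) p ((extChartAt (𝓡 2) q).symm u) := rfl
    rw [← h3] at h1
    generalize hD : mfderiv 𝓘(ℝ, Plane) (𝓡 2) (extChartAt (𝓡 2) p).symm (coordChange q p u) = D
      at h1 ⊢
    erw [h1, h1]
    rw [h2]

end SurfaceMetric

namespace SurfaceMetric

variable (g : SurfaceMetric M)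

/-! ### The Gauss curvature as a smooth function on the surface. -/

section Curvature

lemma fderiv_chartChristoffel {p : M} {u : Plane} (hu : u ∈ (extChartAt (𝓡 2) p).target)
    (i j k l : Fin 2) :
    fderiv ℝ (g.chartChristoffel p) u (planeBasis i) (planeBasis j) (planeBasis k) l =
      partialDeriv i (g.christoffel p l j k) u := by
  have h1 := (g.isLeviCivitaOn p).hasFDerivAt_christoffel hu
  have h2 : HasFDerivAt (fun x => g.chartChristoffel p x (planeBasis j) (planeBasis k)) _ u :=
    (h1.clm_apply (hasFDerivAt_const (planeBasis j) u)).clm_apply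
      (hasFDerivAt_const (planeBasis k) u)
  have h3 : HasFDerivAt (fun x => g.chartChristoffel p x (planeBasis j) (planeBasis k) l) _ u :=
    (EuclideanSpace.proj l : Plane →L[ℝ] ℝ).hasFDerivAt.comp u h2
  have h4 : (fun x => g.chartChristoffel p x (planeBasis j) (planeBasis k) l) =
      g.christoffel p l j k := by
    funext x
    rw [chartChristoffel_apply]
    fin_cases j <;> fin_cases k <;> simp
  rw [h4] at h3
  rw [partialDeriv, h3.fderiv]
  simp

lemma curvatureOf_chartChristoffel {p : M} {u : Plane} (hu : u ∈ (extChartAt (𝓡 2) p).target)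
    (i j k l : Fin 2) :
    curvatureOf (g.chartChristoffel p) u (planeBasis i) (planeBasis j) (planeBasis k) l =
      g.riemann p l k i j u := by
  have hΓ : ∀ a b c d : Fin 2, ∀ v : Plane, v = g.chartChristoffel p u (planeBasis b)
      (planeBasis c) → g.chartChristoffel p u (planeBasis a) v d =
      ∑ m, g.christoffel p d a m u * g.christoffel p m b c u := by
    rintro a b c d v rfl
    rw [chartChristoffel_apply]
    simp only [chartChristoffel_apply]
    fin_cases a <;> fin_cases b <;> fin_cases c <;> simp [Fin.sum_univ_two]
  simp only [curvatureOf, PiLp.add_apply, PiLp.sub_apply, fderiv_chartChristoffel g hu, riemann,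
    hΓ _ _ _ _ _ rfl, Finset.sum_sub_distrib]
  ring

/-- The definition uses a different chart at each point, which hides the smoothness. With this
formula and invariance under coordinate changes, the curvature can be written near any point in one
fixed chart. -/
lemma gaussCurvature_eq_gaussOf_self (x : M) :
    g.gaussCurvature x =
      gaussOf (g.chartMetric x) (g.chartChristoffel x) (extChartAt (𝓡 2) x x) := by
  have hu : extChartAt (𝓡 2) x x ∈ (extChartAt (𝓡 2) x).target := mem_extChartAt_target x
  rw [gaussCurvature, gaussOf, det_metricMatrix]
  congr 1
  simp only [← curvatureOf_chartChristoffel g hu]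
  rw [(g.isLeviCivitaOn x).symm _ hu, chartMetric_apply_sum]
  simp [Fin.sum_univ_two]
  ring

/-- The Gauss curvature can be computed in any chart. -/
lemma gaussCurvature_eq_gaussOf {p x : M} (hx : x ∈ (chartAt Plane p).source) :
    g.gaussCurvature x =
      gaussOf (g.chartMetric p) (g.chartChristoffel p) (extChartAt (𝓡 2) p x) := by
  have h1 := (g.isIsometryOn_coordChange x p).gaussOf_eq (g.isLeviCivitaOn x)
    (overlap_subset x p) (g.isLeviCivitaOn p) (mem_overlap (mem_chart_source Plane x) hx)
  rw [gaussCurvature_eq_gaussOf_self, h1, coordChange_apply (mem_chart_source Plane x)]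

lemma mem_target {p x : M} (hx : x ∈ (chartAt Plane p).source) :
    extChartAt (𝓡 2) p x ∈ (extChartAt (𝓡 2) p).target :=
  (extChartAt (𝓡 2) p).map_source (by rwa [extChartAt_source])

lemma eventually_gaussCurvature {p x : M} (hx : x ∈ (chartAt Plane p).source) :
    g.gaussCurvature =ᶠ[𝓝 x]
      fun y => gaussOf (g.chartMetric p) (g.chartChristoffel p) (extChartAt (𝓡 2) p y) := by
  filter_upwards [(chartAt Plane p).open_source.mem_nhds hx] with y hy
    using g.gaussCurvature_eq_gaussOf hy

lemma continuous_gaussCurvature : Continuous g.gaussCurvature := by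
  refine continuous_iff_continuousAt.2 fun x => ?_
  have hx := mem_chart_source Plane x
  refine ContinuousAt.congr ?_ (g.eventually_gaussCurvature hx).symm
  exact ContinuousAt.comp
    (((g.isLeviCivitaOn x).contDiffAt_gaussOf (mem_target hx)).continuousAt)
    (continuousAt_extChartAt (I := 𝓡 2) x)

lemma mfderiv_gaussCurvature {p x : M} (hx : x ∈ (chartAt Plane p).source)
    (v : TangentSpace (𝓡 2) x) :
    mfderiv (𝓡 2) 𝓘(ℝ, ℝ) g.gaussCurvature x v =
      fderiv ℝ (gaussOf (g.chartMetric p) (g.chartChristoffel p)) (extChartAt (𝓡 2) p x)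
        (mfderiv (𝓡 2) 𝓘(ℝ, Plane) (extChartAt (𝓡 2) p) x v) := by
  have h1 : MDifferentiableAt 𝓘(ℝ, Plane) 𝓘(ℝ, ℝ)
      (gaussOf (g.chartMetric p) (g.chartChristoffel p)) (extChartAt (𝓡 2) p x) :=
    (((g.isLeviCivitaOn p).contDiffAt_gaussOf (mem_target hx)).differentiableAt
      (by simp)).mdifferentiableAt
  rw [(g.eventually_gaussCurvature hx).mfderiv_eq, ← mfderiv_eq_fderiv]
  have := mfderiv_comp x h1 (mdifferentiableAt_chart hx)
  exact congrArg (fun L => L v) this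

end Curvature

/-! ### Germs of geodesics and unique continuation. -/

section Geodesics

/-- Position and velocity of a curve in the chart at `p`. -/
def phase (p : M) (γ : ℝ → M) (t : ℝ) : Plane × Plane :=
  (extChartAt (𝓡 2) p (γ t), deriv (fun s => extChartAt (𝓡 2) p (γ s)) t)

/-- Near time `t`, the curve `γ` lies in the chart at `p` and is there a geodesic of unit speed. -/
def IsGeodesicIn (p : M) (γ : ℝ → M) (t : ℝ) : Prop :=
  ∀ᶠ s in 𝓝 t, γ s ∈ (chartAt Plane p).source ∧
    HasDerivAt (phase p γ) (geodesicField (g.chartChristoffel p) (phase p γ s)) s ∧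
    g.chartMetric p (phase p γ s).1 (phase p γ s).2 (phase p γ s).2 = 1

lemma phase_congr {p : M} {γ γ' : ℝ → M} {t : ℝ} (h : γ =ᶠ[𝓝 t] γ') :
    phase p γ =ᶠ[𝓝 t] phase p γ' := by
  filter_upwards [h.eventuallyEq_nhds] with s hs
  have h1 : (fun s => extChartAt (𝓡 2) p (γ s)) =ᶠ[𝓝 s] fun s => extChartAt (𝓡 2) p (γ' s) := by
    filter_upwards [hs] with r hr
    rw [hr]
  simp only [phase, h1.deriv_eq, hs.eq_of_nhds]

variable {g}

lemma IsGeodesicIn.congr {p : M} {γ γ' : ℝ → M} {t : ℝ} (h : g.IsGeodesicIn p γ t)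
    (hγ : γ =ᶠ[𝓝 t] γ') : g.IsGeodesicIn p γ' t := by
  filter_upwards [h, hγ.eventuallyEq_nhds] with s hs hs'
  have h1 := phase_congr (p := p) hs'
  rw [← hs'.eq_of_nhds, ← h1.eq_of_nhds]
  exact ⟨hs.1, hs.2.1.congr_of_eventuallyEq h1.symm, hs.2.2⟩

lemma IsGeodesicIn.eventually {p : M} {γ : ℝ → M} {t : ℝ} (h : g.IsGeodesicIn p γ t) :
    ∀ᶠ s in 𝓝 t, g.IsGeodesicIn p γ s := eventually_eventually_nhds.2 h

lemma IsGeodesicIn.mem_source {p : M} {γ : ℝ → M} {t : ℝ} (h : g.IsGeodesicIn p γ t) :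
    γ t ∈ (chartAt Plane p).source := h.self_of_nhds.1

lemma IsGeodesicIn.hasDerivAt {p : M} {γ : ℝ → M} {t : ℝ} (h : g.IsGeodesicIn p γ t) :
    HasDerivAt (phase p γ) (geodesicField (g.chartChristoffel p) (phase p γ t)) t :=
  h.self_of_nhds.2.1

lemma IsGeodesicIn.unit {p : M} {γ : ℝ → M} {t : ℝ} (h : g.IsGeodesicIn p γ t) :
    g.chartMetric p (phase p γ t).1 (phase p γ t).2 (phase p γ t).2 = 1 :=
  h.self_of_nhds.2.2

lemma IsGeodesicIn.phase_mem {p : M} {γ : ℝ → M} {t : ℝ} (h : g.IsGeodesicIn p γ t) :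
    (phase p γ t).1 ∈ (extChartAt (𝓡 2) p).target := mem_target h.mem_source

lemma IsGeodesicIn.hasDerivAt_coord {p : M} {γ : ℝ → M} {t : ℝ} (h : g.IsGeodesicIn p γ t) :
    HasDerivAt (fun s => extChartAt (𝓡 2) p (γ s)) (phase p γ t).2 t :=
  h.hasDerivAt.fst

/-- `IsGeodesicIn` only speaks of coordinates; continuity into the surface is recovered through the
inverse chart. -/
lemma continuousAt_of_chart {p : M} {γ : ℝ → M} {t : ℝ}
    (h : ∀ᶠ s in 𝓝 t, γ s ∈ (chartAt Plane p).source)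
    (hc : ContinuousAt (fun s => extChartAt (𝓡 2) p (γ s)) t) : ContinuousAt γ t := by
  have h1 : ContinuousAt (extChartAt (𝓡 2) p).symm (extChartAt (𝓡 2) p (γ t)) :=
    continuousAt_extChartAt_symm'' (mem_target h.self_of_nhds)
  refine (ContinuousAt.comp (g := (extChartAt (𝓡 2) p).symm)
    (f := fun s => extChartAt (𝓡 2) p (γ s)) h1 hc).congr ?_
  filter_upwards [h] with s hs
  exact (extChartAt (𝓡 2) p).left_inv (by rwa [extChartAt_source])

lemma IsGeodesicIn.continuousAt {p : M} {γ : ℝ → M} {t : ℝ} (h : g.IsGeodesicIn p γ t) :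
    ContinuousAt γ t :=
  continuousAt_of_chart (h.mono fun _ hs => hs.1) h.hasDerivAt_coord.continuousAt

lemma phase_eq_phaseMap {q p : M} {γ : ℝ → M} {t : ℝ}
    (hq : ∀ᶠ s in 𝓝 t, γ s ∈ (chartAt Plane q).source) (hp : γ t ∈ (chartAt Plane p).source)
    (hd : DifferentiableAt ℝ (fun s => extChartAt (𝓡 2) q (γ s)) t) (g : SurfaceMetric M) :
    phase p γ t = phaseMap (coordChange q p) (phase q γ t) := by
  have hu := mem_overlap hq.self_of_nhds hp
  have h1 : (fun s => extChartAt (𝓡 2) p (γ s)) =ᶠ[𝓝 t]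
      fun s => coordChange q p (extChartAt (𝓡 2) q (γ s)) := by
    filter_upwards [hq] with s hs
    exact (coordChange_apply hs).symm
  have h2 := ((g.isIsometryOn_coordChange q p).hasFDerivAt hu).comp_hasDerivAt t hd.hasDerivAt
  refine Prod.ext h1.eq_of_nhds ?_
  exact h1.deriv_eq.trans h2.deriv

lemma IsGeodesicIn.phase_eq {q p : M} {γ : ℝ → M} {t : ℝ} (h : g.IsGeodesicIn q γ t)
    (hp : γ t ∈ (chartAt Plane p).source) :
    phase p γ t = phaseMap (coordChange q p) (phase q γ t) :=
  phase_eq_phaseMap (h.mono fun _ hs => hs.1) hp h.hasDerivAt_coord.differentiableAt g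

/-- The tangent map of the coordinate change intertwines the two geodesic fields
(`phaseMap_geodesicField`) and preserves speed. -/
lemma IsGeodesicIn.change {q p : M} {γ : ℝ → M} {t : ℝ} (h : g.IsGeodesicIn q γ t)
    (hp : γ t ∈ (chartAt Plane p).source) : g.IsGeodesicIn p γ t := by
  have hp' : ∀ᶠ s in 𝓝 t, γ s ∈ (chartAt Plane p).source :=
    h.continuousAt.eventually ((chartAt Plane p).open_source.mem_nhds hp)
  filter_upwards [hp'.eventually_nhds, h.eventually.eventually_nhds] with s hps hs
  have hps0 := hps.self_of_nhds
  have hs0 := hs.self_of_nhds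
  have hiso := g.isIsometryOn_coordChange q p
  have hu : (phase q γ s).1 ∈ overlap q p := mem_overlap hs0.mem_source hps0
  have heq : phase p γ =ᶠ[𝓝 s] fun r => phaseMap (coordChange q p) (phase q γ r) := by
    filter_upwards [hps, hs] with r hr hr' using hr'.phase_eq hr
  refine ⟨hps0, ?_, ?_⟩
  · refine HasDerivAt.congr_of_eventuallyEq ?_ heq
    rw [heq.eq_of_nhds, ← hiso.phaseMap_geodesicField (g.isLeviCivitaOn q) (overlap_subset q p)
      (g.isLeviCivitaOn p) hu]
    exact (hiso.hasFDerivAt_phaseMap hu).differentiableAt.hasFDerivAt.comp_hasDerivAt s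
      hs0.hasDerivAt
  · rw [heq.eq_of_nhds]
    simp only [phaseMap]
    rw [← hiso.pullback _ hu, hs0.unit]

/-- Two geodesics with the same initial data agree. -/
lemma IsGeodesicIn.eventuallyEq {p : M} {γ γ' : ℝ → M} {t : ℝ} (h : g.IsGeodesicIn p γ t)
    (h' : g.IsGeodesicIn p γ' t) (heq : phase p γ t = phase p γ' t) : γ =ᶠ[𝓝 t] γ' := by
  have hX := (g.isLeviCivitaOn p).contDiffAt_geodesicField h.phase_mem
  obtain ⟨K, W, hW, hK⟩ := (hX.of_le (m := 1) (by simp)).exists_lipschitzOnWith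
  have h1 : phase p γ =ᶠ[𝓝 t] phase p γ' := by
    refine ODE_solution_unique_of_eventually (v := fun _ => geodesicField (g.chartChristoffel p))
      (s := fun _ => W) (K := K) (Eventually.of_forall fun _ => hK) ?_ ?_ heq
    · filter_upwards [h, h.hasDerivAt.continuousAt.eventually hW] with s hs hs'
      exact ⟨hs.2.1, hs'⟩
    · filter_upwards [h', h'.hasDerivAt.continuousAt.eventually (heq ▸ hW)] with s hs hs'
      exact ⟨hs.2.1, hs'⟩
  filter_upwards [h1, h, h'] with s hs h2 h3
  refine (extChartAt (𝓡 2) p).injOn ?_ ?_ (congrArg Prod.fst hs)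
  · rw [extChartAt_source]; exact h2.1
  · rw [extChartAt_source]; exact h3.1

/-- `γ` is a geodesic of unit speed near `t`. -/
def IsGeodesicNear (g : SurfaceMetric M) (γ : ℝ → M) (t : ℝ) : Prop := ∃ p, g.IsGeodesicIn p γ t

lemma IsGeodesicNear.isGeodesicIn {p : M} {γ : ℝ → M} {t : ℝ} (h : g.IsGeodesicNear γ t)
    (hp : γ t ∈ (chartAt Plane p).source) : g.IsGeodesicIn p γ t :=
  h.choose_spec.change hp

lemma IsGeodesicNear.continuousAt {γ : ℝ → M} {t : ℝ} (h : g.IsGeodesicNear γ t) :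
    ContinuousAt γ t := h.choose_spec.continuousAt

/-- The set where the germs agree is open. It is closed in the interval: at a limit point the
positions agree because the surface is Hausdorff, the velocities by continuity, and the germs by
uniqueness for the geodesic equation. -/
lemma eqOn_of_isGeodesicNear [T2Space M] {γ γ' : ℝ → M} {a b t₀ : ℝ} (ht₀ : t₀ ∈ Ioo a b)
    (h : ∀ t ∈ Ioo a b, g.IsGeodesicNear γ t) (h' : ∀ t ∈ Ioo a b, g.IsGeodesicNear γ' t)
    (heq : γ =ᶠ[𝓝 t₀] γ') : EqOn γ γ' (Ioo a b) := by
  have hsub : Ioo a b ⊆ {t | γ =ᶠ[𝓝 t] γ'} := by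
    refine isPreconnected_Ioo.subset_of_closure_inter_subset
      (isOpen_iff_mem_nhds.2 fun t ht => ht.eventuallyEq_nhds) ⟨t₀, ht₀, heq⟩ ?_
    rintro t ⟨ht, htI⟩
    have hfr : ∃ᶠ s in 𝓝 t, γ =ᶠ[𝓝 s] γ' := mem_closure_iff_frequently.1 ht
    have e1 : γ t = γ' t := by
      by_contra hne
      obtain ⟨s, hs1, hs2⟩ := (hfr.and_eventually
        (((h t htI).continuousAt.ne_iff_eventually_ne (h' t htI).continuousAt).1 hne)).exists
      exact hs2 hs1.eq_of_nhds
    have hp := (h t htI).isGeodesicIn (mem_chart_source Plane (γ t))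
    have hp' := (h' t htI).isGeodesicIn (p := γ t) (e1 ▸ mem_chart_source Plane (γ t))
    refine hp.eventuallyEq hp' ?_
    by_contra hne
    obtain ⟨s, hs1, hs2⟩ := (hfr.and_eventually
      ((hp.hasDerivAt.continuousAt.ne_iff_eventually_ne hp'.hasDerivAt.continuousAt).1
        hne)).exists
    exact hs2 (phase_congr hs1).eq_of_nhds
  exact fun t ht => (hsub ht).eq_of_nhds

end Geodesics

end SurfaceMetric

/-! ### Equivalence of the chartwise notion with `IsUnitSpeedGeodesic`. -/

namespace SurfaceMetric

variable {g : SurfaceMetric M}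

lemma phase_fst_mfderiv {p : M} {γ : ℝ → M} {t : ℝ} (hp : γ t ∈ (chartAt Plane p).source)
    (hγ : MDifferentiableAt 𝓘(ℝ, ℝ) (𝓡 2) γ t) :
    HasDerivAt (fun s => extChartAt (𝓡 2) p (γ s))
      (mfderiv (𝓡 2) 𝓘(ℝ, Plane) (extChartAt (𝓡 2) p) (γ t) (velocity γ t) : Plane) t := by
  have h1 := ((mdifferentiableAt_chart hp).hasMFDerivAt.comp t hγ.hasMFDerivAt)
  obtain ⟨D, hD⟩ : ∃ D : ℝ →L[ℝ] Plane, D = (mfderiv (𝓡 2) 𝓘(ℝ, Plane) (extChartAt (𝓡 2) p)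
      (γ t)).comp (mfderiv 𝓘(ℝ, ℝ) (𝓡 2) γ t) := ⟨_, rfl⟩
  have h2 : HasFDerivAt (fun s => extChartAt (𝓡 2) p (γ s)) D t := by
    rw [hD]
    exact h1.hasFDerivAt
  have h3 : D 1 = mfderiv (𝓡 2) 𝓘(ℝ, Plane) (extChartAt (𝓡 2) p) (γ t) (velocity γ t) := by
    rw [hD]
    rfl
  exact h2.hasDerivAt.congr_deriv h3

lemma chartMetric_mfderiv {p x : M} (hx : x ∈ (chartAt Plane p).source)
    (v w : TangentSpace (𝓡 2) x) :
    g.chartMetric p (extChartAt (𝓡 2) p x)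
      (mfderiv (𝓡 2) 𝓘(ℝ, Plane) (extChartAt (𝓡 2) p) x v : Plane)
      (mfderiv (𝓡 2) 𝓘(ℝ, Plane) (extChartAt (𝓡 2) p) x w : Plane) = g.inner x v w := by
  refine (chartMetric_apply g p _ _ _).trans ?_
  have h1 := mfderiv_symm_comp_chart hx
  have h2 : (extChartAt (𝓡 2) p).symm (extChartAt (𝓡 2) p x) = x :=
    (extChartAt (𝓡 2) p).left_inv (by rwa [extChartAt_source])
  generalize hD : mfderiv 𝓘(ℝ, Plane) (𝓡 2) (extChartAt (𝓡 2) p).symm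
    (extChartAt (𝓡 2) p x) = D at h1 ⊢
  erw [h1 v, h1 w]
  rw [h2]

/-- The velocity field in a chart. -/
lemma phase_snd {p : M} {γ : ℝ → M} {t : ℝ} (hp : γ t ∈ (chartAt Plane p).source)
    (hγ : MDifferentiableAt 𝓘(ℝ, ℝ) (𝓡 2) γ t) :
    (phase p γ t).2 =
      mfderiv (𝓡 2) 𝓘(ℝ, Plane) (extChartAt (𝓡 2) p) (γ t) (velocity γ t) :=
  (phase_fst_mfderiv hp hγ).deriv

lemma deriv_curveCoord {p : M} {γ : ℝ → M} {t : ℝ}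
    (hd : DifferentiableAt ℝ (fun s => extChartAt (𝓡 2) p (γ s)) t) (k : Fin 2) :
    deriv (curveCoord p γ k) t = (phase p γ t).2 k := by
  have h := (EuclideanSpace.proj k : Plane →L[ℝ] ℝ).hasFDerivAt.comp_hasDerivAt t hd.hasDerivAt
  exact h.deriv

lemma geodesicField_snd_apply (p : M) (z : Plane × Plane) (k : Fin 2) :
    (geodesicField (g.chartChristoffel p) z).2 k =
      -∑ i, ∑ j, g.christoffel p k i j z.1 * z.2 i * z.2 j := by
  simp only [geodesicField, PiLp.neg_apply, chartChristoffel_apply]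

lemma IsUnitSpeedGeodesic.isGeodesicIn {γ : ℝ → M} (h : g.IsUnitSpeedGeodesic γ) {p : M} {t : ℝ}
    (hp : γ t ∈ (chartAt Plane p).source) : g.IsGeodesicIn p γ t := by
  have hp' : ∀ᶠ s in 𝓝 t, γ s ∈ (chartAt Plane p).source :=
    h.contMDiff.continuous.continuousAt.eventually ((chartAt Plane p).open_source.mem_nhds hp)
  have hcd : ∀ s, γ s ∈ (chartAt Plane p).source →
      ContDiffAt ℝ 2 (fun r => extChartAt (𝓡 2) p (γ r)) s := by
    intro s hs
    rw [← contMDiffAt_iff_contDiffAt]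
    have h1 : ContMDiffAt (𝓡 2) 𝓘(ℝ, Plane) 2 (extChartAt (𝓡 2) p) (γ s) :=
      (contMDiffAt_extChartAt' (n := ∞) hs).of_le ENat.LEInfty.out
    exact h1.comp s (h.contMDiff s)
  filter_upwards [hp'.eventually_nhds] with s hs
  have hs0 := hs.self_of_nhds
  have hmd : MDifferentiableAt 𝓘(ℝ, ℝ) (𝓡 2) γ s := (h.contMDiff s).mdifferentiableAt (by simp)
  refine ⟨hs0, ?_, ?_⟩
  · have h1 : DifferentiableAt ℝ (fun r => extChartAt (𝓡 2) p (γ r)) s :=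
      (hcd s hs0).differentiableAt (by simp)
    have h2 : DifferentiableAt ℝ (deriv fun r => extChartAt (𝓡 2) p (γ r)) s :=
      (((hcd s hs0).fderiv_right (m := 1) (by norm_num)).differentiableAt (by simp)).clm_apply
        (differentiableAt_const 1)
    refine (h1.hasDerivAt.prodMk h2.hasDerivAt).congr_deriv ?_
    refine Prod.ext rfl ?_
    ext k
    have h3 := h.geodesic_eq p s hs0 k
    have h4 : deriv (curveCoord p γ k) =ᶠ[𝓝 s] fun r => (phase p γ r).2 k := by
      filter_upwards [hs] with r hr
      exact deriv_curveCoord ((hcd r hr).differentiableAt (by simp)) k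
    have h5 := (EuclideanSpace.proj k : Plane →L[ℝ] ℝ).hasFDerivAt.comp_hasDerivAt s h2.hasDerivAt
    have h6 : deriv (deriv (curveCoord p γ k)) s =
        (deriv (deriv fun r => extChartAt (𝓡 2) p (γ r)) s) k := h4.deriv_eq.trans h5.deriv
    rw [geodesicField_snd_apply]
    simp only [deriv_curveCoord h1] at h3
    rw [h6] at h3
    exact eq_neg_of_add_eq_zero_left h3
  · rw [phase_snd hs0 hmd]
    exact (chartMetric_mfderiv hs0 _ _).trans (h.unit_speed s)

lemma isUnitSpeedGeodesic_of_isGeodesicNear {γ : ℝ → M} (h : ∀ t, g.IsGeodesicNear γ t) :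
    g.IsUnitSpeedGeodesic γ := by
  have hcm : ContMDiff 𝓘(ℝ, ℝ) (𝓡 2) 2 γ := by
    intro t
    have hp := (h t).isGeodesicIn (mem_chart_source Plane (γ t))
    set p := γ t with hpdef
    have hcd : ContDiffAt ℝ 2 (fun s => extChartAt (𝓡 2) p (γ s)) t := by
      obtain ⟨a, b, h1, h2⟩ := mem_nhds_iff_exists_Ioo_subset.1 hp.eventually
      have hd : ∀ s ∈ Ioo a b, HasDerivAt (phase p γ)
          (geodesicField (g.chartChristoffel p) (phase p γ s)) s := fun s hs => (h2 hs).hasDerivAt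
      -- Regularity is gained from the equation: the phase has a continuous derivative, so the
      -- coordinates, whose derivative is part of the phase, are twice continuously differentiable.
      have e1 : ContDiffOn ℝ 1 (phase p γ) (Ioo a b) := by
        rw [contDiffOn_one_iff_derivWithin isOpen_Ioo.uniqueDiffOn]
        refine ⟨fun s hs => (hd s hs).differentiableAt.differentiableWithinAt, fun s hs => ?_⟩
        have e3 : ContinuousAt (fun r => geodesicField (g.chartChristoffel p) (phase p γ r)) s :=
          ContinuousAt.comp ((g.isLeviCivitaOn p).contDiffAt_geodesicField
            (h2 hs).phase_mem).continuousAt (hd s hs).continuousAt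
        refine e3.continuousWithinAt.congr (fun r hr => ?_) ?_
        · rw [derivWithin_of_isOpen isOpen_Ioo hr, (hd r hr).deriv]
        · rw [derivWithin_of_isOpen isOpen_Ioo hs, (hd s hs).deriv]
      have e2 : ContDiffOn ℝ (1 + 1) (fun s => extChartAt (𝓡 2) p (γ s)) (Ioo a b) := by
        rw [contDiffOn_succ_iff_deriv_of_isOpen isOpen_Ioo]
        refine ⟨fun s hs => (h2 hs).hasDerivAt_coord.differentiableAt.differentiableWithinAt,
          by simp, contDiff_snd.comp_contDiffOn e1⟩
      exact (e2.contDiffAt (Ioo_mem_nhds h1.1 h1.2)).of_le (by norm_num)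
    have h1 : ContMDiffAt 𝓘(ℝ, Plane) (𝓡 2) 2 (extChartAt (𝓡 2) p).symm
        (extChartAt (𝓡 2) p (γ t)) :=
      (contMDiffAt_chart_symm (mem_target hp.mem_source)).of_le ENat.LEInfty.out
    refine (ContMDiffAt.comp t h1 hcd.contMDiffAt).congr_of_eventuallyEq ?_
    filter_upwards [hp] with s hs
    exact ((extChartAt (𝓡 2) p).left_inv (by rw [extChartAt_source]; exact hs.1)).symm
  refine ⟨hcm, fun t => ?_, fun p t hp k => ?_⟩
  · have hp := (h t).isGeodesicIn (mem_chart_source Plane (γ t))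
    have h1 := hp.unit
    rw [phase_snd hp.mem_source ((hcm t).mdifferentiableAt (by simp))] at h1
    rw [← h1]
    exact (chartMetric_mfderiv hp.mem_source _ _).symm
  · have hp := (h t).isGeodesicIn hp
    have h1 : deriv (curveCoord p γ k) =ᶠ[𝓝 t] fun s => (phase p γ s).2 k := by
      filter_upwards [hp.eventually] with s hs
      exact deriv_curveCoord hs.hasDerivAt_coord.differentiableAt k
    have h2 : HasDerivAt (fun s => (phase p γ s).2 k) _ t :=
      (EuclideanSpace.proj k : Plane →L[ℝ] ℝ).hasFDerivAt.comp_hasDerivAt t hp.hasDerivAt.snd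
    rw [h1.deriv_eq, h2.deriv]
    simp only [deriv_curveCoord hp.hasDerivAt_coord.differentiableAt]
    have h3 := geodesicField_snd_apply (g := g) p (phase p γ t) k
    change (geodesicField (g.chartChristoffel p) (phase p γ t)).2 k + _ = 0
    rw [h3]
    exact neg_add_cancel _

end SurfaceMetric

/-! ### Geodesic completeness of a compact surface. -/

/-- A uniform bound for unit vectors. -/
lemma IsLeviCivitaOn.exists_norm_le {U : Set Plane} {B : Plane → Plane →L[ℝ] Plane →L[ℝ] ℝ}
    {Γ : Plane → Plane →L[ℝ] Plane →L[ℝ] Plane} (h : IsLeviCivitaOn U B Γ) {u₀ : Plane}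
    (hu₀ : u₀ ∈ U) :
    ∃ C > (0 : ℝ), ∀ᶠ u in 𝓝 u₀, ∀ v, B u v v = 1 → ‖v‖ ≤ C := by
  have hS : IsCompact (Metric.sphere (0 : Plane) 1) := isCompact_sphere 0 1
  have hne : (Metric.sphere (0 : Plane) 1).Nonempty := NormedSpace.sphere_nonempty.2 zero_le_one
  have hcont : ContinuousOn (fun v => B u₀ v v) (Metric.sphere (0 : Plane) 1) := by
    fun_prop
  obtain ⟨v₀, hv₀, hmin⟩ := hS.exists_isMinOn hne hcont
  have hv₀0 : v₀ ≠ 0 := fun h0 => by simp [h0] at hv₀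
  have hm := h.pos u₀ hu₀ v₀ hv₀0
  set m := B u₀ v₀ v₀
  have hev : ∀ᶠ u in 𝓝 u₀, ∀ v ∈ Metric.sphere (0 : Plane) 1, m / 2 < B u v v := by
    refine hS.eventually_forall_of_forall_eventually fun v hv => ?_
    have h1 : ContinuousAt (fun q : Plane × Plane => B q.1 q.2 q.2) (u₀, v) := by
      have h2 : ContinuousAt (fun q : Plane × Plane => B q.1) (u₀, v) :=
        ContinuousAt.comp (f := Prod.fst) (h.contDiffAt_metric hu₀).continuousAt continuousAt_fst
      exact (h2.clm_apply continuousAt_snd).clm_apply continuousAt_snd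
    refine h1.eventually (lt_mem_nhds ?_)
    have := isMinOn_iff.1 hmin v hv
    change m / 2 < B u₀ v v
    linarith
  -- Near `u₀` the form exceeds `m / 2` on the Euclidean unit sphere, so `B u v v = 1` forces `‖v‖²
  -- < 2 / m`.
  refine ⟨√(2 / m), by positivity, ?_⟩
  filter_upwards [hev] with u hu v hv
  by_cases hv0 : v = 0
  · simp [hv0] at hv
  have hn : ‖v‖ ≠ 0 := norm_ne_zero_iff.2 hv0
  have h1 := hu (‖v‖⁻¹ • v) (by simp [norm_smul, hn])
  simp only [map_smul, smul_apply, smul_eq_mul, hv] at h1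
  refine Real.le_sqrt_of_sq_le ?_
  rw [le_div_iff₀ hm]
  have h2 : m / 2 * ‖v‖ ^ 2 < (‖v‖⁻¹ * (‖v‖⁻¹ * 1)) * ‖v‖ ^ 2 := by gcongr
  have h3 : (‖v‖⁻¹ * (‖v‖⁻¹ * 1)) * ‖v‖ ^ 2 = 1 := by field_simp
  linarith

namespace SurfaceMetric

variable {g : SurfaceMetric M}

/-- Solutions of the geodesic equation in a chart give geodesics of the surface. -/
lemma isGeodesicIn_of_chart {p : M} {α : ℝ → Plane × Plane} {a b s : ℝ} (hs : s ∈ Ioo a b)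
    (hα : ∀ t ∈ Ioo a b, HasDerivAt α (geodesicField (g.chartChristoffel p) (α t)) t ∧
      (α t).1 ∈ (extChartAt (𝓡 2) p).target)
    (hunit : g.chartMetric p (α s).1 (α s).2 (α s).2 = 1) :
    ∀ t ∈ Ioo a b, g.IsGeodesicIn p (fun t => (extChartAt (𝓡 2) p).symm (α t).1) t ∧
      phase p (fun t => (extChartAt (𝓡 2) p).symm (α t).1) t = α t := by
  have hfst : ∀ t ∈ Ioo a b, HasDerivAt (fun t => (α t).1) (α t).2 t := fun t ht => (hα t ht).1.fst
  have hsnd : ∀ t ∈ Ioo a b, HasDerivAt (fun t => (α t).2)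
    (-g.chartChristoffel p (α t).1 (α t).2 (α t).2) t := fun t ht => (hα t ht).1.snd
  -- The speed is constant because the velocity is parallel, so unit speed need only be required at
  -- one time.
  have hspeed : ∀ t ∈ Ioo a b, HasDerivAt (fun t => g.chartMetric p (α t).1 (α t).2 (α t).2) 0 t := by
    intro t ht
    have := (g.isLeviCivitaOn p).hasDerivAt_metric (hα t ht).2 (hfst t ht) (hsnd t ht) (hsnd t ht)
    simpa using this
  have hunit' : ∀ t ∈ Ioo a b, g.chartMetric p (α t).1 (α t).2 (α t).2 = 1 := by
    intro t ht
    rw [← hunit]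
    exact isOpen_Ioo.is_const_of_deriv_eq_zero isPreconnected_Ioo
      (fun r hr => (hspeed r hr).differentiableAt.differentiableWithinAt)
      (fun r hr => (hspeed r hr).deriv) ht hs
  set γ : ℝ → M := fun t => (extChartAt (𝓡 2) p).symm (α t).1 with hγ
  have hcoord : ∀ t ∈ Ioo a b, extChartAt (𝓡 2) p (γ t) = (α t).1 := fun t ht =>
    (extChartAt (𝓡 2) p).right_inv (hα t ht).2
  have hphase : ∀ t ∈ Ioo a b, phase p γ t = α t := by
    intro t ht
    have h1 : (fun s => extChartAt (𝓡 2) p (γ s)) =ᶠ[𝓝 t] fun s => (α s).1 := by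
      filter_upwards [Ioo_mem_nhds ht.1 ht.2] with r hr using hcoord r hr
    exact Prod.ext (hcoord t ht) (h1.deriv_eq.trans (hfst t ht).deriv)
  refine fun t ht => ⟨?_, hphase t ht⟩
  filter_upwards [Ioo_mem_nhds ht.1 ht.2] with r hr
  refine ⟨?_, ?_, ?_⟩
  · have := (extChartAt (𝓡 2) p).map_target (hα r hr).2
    rwa [extChartAt_source] at this
  · rw [hphase r hr]
    refine (hα r hr).1.congr_of_eventuallyEq ?_
    filter_upwards [Ioo_mem_nhds hr.1 hr.2] with q hq using hphase q hq
  · rw [hphase r hr]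
    exact hunit' r hr

variable (g) in
-- A flow box about the zero vector at `x` serves all velocities of norm at most `r` for time `η`.
-- Near `x` unit vectors have norm at most `C`; by homogeneity of the geodesic equation, scaling
-- velocities by `l = r / C` yields the common time `l * η` at unit speed.
lemma exists_uniform_time_near (x : M) :
    ∃ U ∈ 𝓝 x, ∃ δ > (0 : ℝ), ∀ (γ : ℝ → M) (t₀ : ℝ), γ t₀ ∈ U → g.IsGeodesicNear γ t₀ →
      ∃ γ' : ℝ → M, γ' =ᶠ[𝓝 t₀] γ ∧ ∀ t ∈ Ioo (t₀ - δ) (t₀ + δ), g.IsGeodesicNear γ' t := by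
  have hx := mem_chart_source Plane x
  have hLC := g.isLeviCivitaOn x
  set u₀ := extChartAt (𝓡 2) x x
  have hu₀ : u₀ ∈ (extChartAt (𝓡 2) x).target := mem_target hx
  obtain ⟨C, hC, hbound⟩ := hLC.exists_norm_le hu₀
  have hX := hLC.contDiffAt_geodesicField (z := (u₀, 0)) hu₀
  have hW : {z : Plane × Plane | z.1 ∈ (extChartAt (𝓡 2) x).target} ∈ 𝓝 (u₀, (0 : Plane)) :=
    continuousAt_fst.preimage_mem_nhds (hLC.isOpen.mem_nhds hu₀)
  obtain ⟨r, hr, η, hη, hflow⟩ := exists_local_flow (hX.of_le (m := 1) (by simp)) hW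
  have hU : ∀ᶠ y in 𝓝 x, y ∈ (chartAt Plane x).source ∧
      extChartAt (𝓡 2) x y ∈ Metric.closedBall u₀ r ∧
      ∀ v, g.chartMetric x (extChartAt (𝓡 2) x y) v v = 1 → ‖v‖ ≤ C := by
    have hc := continuousAt_extChartAt (I := 𝓡 2) x
    filter_upwards [(chartAt Plane x).open_source.mem_nhds hx,
      hc.eventually (Metric.closedBall_mem_nhds u₀ hr), hc.eventually hbound] with y h1 h2 h3
    exact ⟨h1, h2, h3⟩
  set l : ℝ := r / C with hl
  have hl0 : 0 < l := by positivity
  refine ⟨_, hU, l * η, by positivity, fun γ t₀ hγ hnear => ?_⟩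
  obtain ⟨hsrc, hball, hle⟩ := hγ
  have hin := hnear.isGeodesicIn hsrc
  set u := (phase x γ t₀).1 with hu
  set v := (phase x γ t₀).2 with hv
  have hvC : ‖v‖ ≤ C := hle v hin.unit
  obtain ⟨β, hβ0, hβ⟩ := hflow (u, l • v) (by
    rw [← closedBall_prod_same]
    refine ⟨hball, ?_⟩
    rw [mem_closedBall_zero_iff, norm_smul, Real.norm_of_nonneg hl0.le]
    calc l * ‖v‖ ≤ l * C := by gcongr
      _ = r := by rw [hl]; field_simp) 0
  -- undo the rescaling of time
  set α : ℝ → Plane × Plane := fun t => ((β ((t - t₀) / l)).1, l⁻¹ • (β ((t - t₀) / l)).2) with hα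
  have hα0 : α t₀ = phase x γ t₀ := by
    simp only [hα, sub_self, zero_div, hβ0, smul_smul, inv_mul_cancel₀ hl0.ne', one_smul]
    rfl
  have hαd : ∀ t ∈ Ioo (t₀ - l * η) (t₀ + l * η),
      HasDerivAt α (geodesicField (g.chartChristoffel x) (α t)) t ∧
      (α t).1 ∈ (extChartAt (𝓡 2) x).target := by
    intro t ht
    have hmem : (t - t₀) / l ∈ Ioo (0 - η) (0 + η) := by
      constructor
      · rw [lt_div_iff₀ hl0]; linarith [ht.1]
      · rw [div_lt_iff₀ hl0]; linarith [ht.2]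
    obtain ⟨h1, h2⟩ := hβ _ hmem
    refine ⟨?_, h2⟩
    have h3 : HasDerivAt (fun t => (t - t₀) / l) l⁻¹ t := by
      simpa using ((hasDerivAt_id t).sub_const t₀).div_const l
    have hb1 : HasDerivAt (fun s => (β s).1)
        (geodesicField (g.chartChristoffel x) (β ((t - t₀) / l))).1 ((t - t₀) / l) := h1.fst
    have hb2 : HasDerivAt (fun s => (β s).2)
        (geodesicField (g.chartChristoffel x) (β ((t - t₀) / l))).2 ((t - t₀) / l) := h1.snd
    have h4 : HasDerivAt (fun t => (β ((t - t₀) / l)).1) _ t :=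
      HasDerivAt.scomp (g₁ := fun s => (β s).1) (h := fun t => (t - t₀) / l) t hb1 h3
    have h5 : HasDerivAt (fun t => (β ((t - t₀) / l)).2) _ t :=
      HasDerivAt.scomp (g₁ := fun s => (β s).2) (h := fun t => (t - t₀) / l) t hb2 h3
    refine (h4.prodMk (h5.const_smul l⁻¹)).congr_deriv ?_
    simp [geodesicField, hα]
  have hmem : t₀ ∈ Ioo (t₀ - l * η) (t₀ + l * η) :=
    ⟨by linarith [mul_pos hl0 hη], by linarith [mul_pos hl0 hη]⟩
  have hgeo := isGeodesicIn_of_chart hmem hαd (by rw [hα0]; exact hin.unit)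
  refine ⟨_, ?_, fun t ht => ⟨x, (hgeo t ht).1⟩⟩
  exact (hgeo t₀ hmem).1.eventuallyEq hin ((hgeo t₀ hmem).2.trans hα0)

variable (g) in
lemma exists_uniform_time [CompactSpace M] :
    ∃ δ > (0 : ℝ), ∀ (γ : ℝ → M) (t₀ : ℝ), g.IsGeodesicNear γ t₀ →
      ∃ γ' : ℝ → M, γ' =ᶠ[𝓝 t₀] γ ∧ ∀ t ∈ Ioo (t₀ - δ) (t₀ + δ), g.IsGeodesicNear γ' t := by
  have key : ∃ δ > (0 : ℝ), ∀ (γ : ℝ → M) (t₀ : ℝ), γ t₀ ∈ (univ : Set M) →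
      g.IsGeodesicNear γ t₀ →
      ∃ γ' : ℝ → M, γ' =ᶠ[𝓝 t₀] γ ∧ ∀ t ∈ Ioo (t₀ - δ) (t₀ + δ), g.IsGeodesicNear γ' t := by
    refine isCompact_univ.induction_on (p := fun S : Set M => ∃ δ > (0 : ℝ), ∀ (γ : ℝ → M) (t₀ : ℝ),
      γ t₀ ∈ S → g.IsGeodesicNear γ t₀ → ∃ γ' : ℝ → M, γ' =ᶠ[𝓝 t₀] γ ∧
        ∀ t ∈ Ioo (t₀ - δ) (t₀ + δ), g.IsGeodesicNear γ' t) ?_ ?_ ?_ ?_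
    · exact ⟨1, one_pos, fun _ _ h => h.elim⟩
    · rintro s t hst ⟨δ, hδ, h⟩
      exact ⟨δ, hδ, fun γ t₀ ht => h γ t₀ (hst ht)⟩
    · rintro s t ⟨δ, hδ, h⟩ ⟨δ', hδ', h'⟩
      refine ⟨min δ δ', lt_min hδ hδ', fun γ t₀ ht hn => ?_⟩
      rcases ht with ht | ht
      · obtain ⟨γ', h1, h2⟩ := h γ t₀ ht hn
        exact ⟨γ', h1, fun r hr => h2 r ⟨by linarith [hr.1, min_le_left δ δ'],
          by linarith [hr.2, min_le_left δ δ']⟩⟩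
      · obtain ⟨γ', h1, h2⟩ := h' γ t₀ ht hn
        exact ⟨γ', h1, fun r hr => h2 r ⟨by linarith [hr.1, min_le_right δ δ'],
          by linarith [hr.2, min_le_right δ δ']⟩⟩
    · intro x _
      obtain ⟨U, hU, h⟩ := g.exists_uniform_time_near x
      exact ⟨U, mem_nhdsWithin_of_mem_nhds hU, h⟩
  obtain ⟨δ, hδ, h⟩ := key
  exact ⟨δ, hδ, fun γ t₀ => h γ t₀ trivial⟩

/-- A compact surface is geodesically complete. -/
lemma exists_isUnitSpeedGeodesic [CompactSpace M] [T2Space M] {p : M} {z : Plane × Plane}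
    (hz : z.1 ∈ (extChartAt (𝓡 2) p).target) (hunit : g.chartMetric p z.1 z.2 z.2 = 1) (t₀ : ℝ) :
    ∃ γ : ℝ → M, g.IsUnitSpeedGeodesic γ ∧ γ t₀ ∈ (chartAt Plane p).source ∧
      phase p γ t₀ = z := by
  have hX := (g.isLeviCivitaOn p).contDiffAt_geodesicField hz
  have hW : {z : Plane × Plane | z.1 ∈ (extChartAt (𝓡 2) p).target} ∈ 𝓝 z :=
    continuousAt_fst.preimage_mem_nhds ((g.isLeviCivitaOn p).isOpen.mem_nhds hz)
  obtain ⟨r, hr, η, hη, hflow⟩ := exists_local_flow (hX.of_le (m := 1) (by simp)) hW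
  obtain ⟨α, hα0, hα⟩ := hflow z (Metric.mem_closedBall_self hr.le) t₀
  have hmem : t₀ ∈ Ioo (t₀ - η) (t₀ + η) := ⟨by linarith, by linarith⟩
  obtain ⟨h1, h2⟩ := isGeodesicIn_of_chart hmem hα (by rw [hα0]; exact hunit) t₀ hmem
  obtain ⟨δ, hδ, hstep⟩ := g.exists_uniform_time
  obtain ⟨γ, h3, h4⟩ := exists_forall_of_uniform_extension (P := g.IsGeodesicNear)
    (fun γ γ' t hγ ⟨q, hq⟩ => ⟨q, hq.congr hγ⟩)
    (fun γ γ' a b t₀ ht₀ h h' heq => eqOn_of_isGeodesicNear ht₀ h h' heq) hδ hstep ⟨p, h1⟩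
  refine ⟨γ, isUnitSpeedGeodesic_of_isGeodesicNear h4, ?_, ?_⟩
  · rw [h3.eq_of_nhds]
    exact h1.mem_source
  · rw [(phase_congr h3).eq_of_nhds, h2, hα0]

end SurfaceMetric

/-! ### Variations through geodesics. -/

namespace SurfaceMetric

variable {g : SurfaceMetric M}

/-- In the chart at `p`, the family of curves `γf` has at time `t` the variation field `a n`, with
covariant derivative `a' n`. -/
def IsVariationAt (g : SurfaceMetric M) (p : M) (γf : ℝ → ℝ → M) (n : Plane) (a a' t : ℝ) : Prop :=
  (∀ᶠ ε in 𝓝 (0 : ℝ), γf ε t ∈ (chartAt Plane p).source) ∧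
  HasDerivAt (fun ε => phase p (γf ε) t)
    (a • n, a' • n - a • g.chartChristoffel p (phase p (γf 0) t).1 (phase p (γf 0) t).2 n) 0

/-- `n` is a unit vector, in the chart at `p`, normal to `γ` at time `t`. -/
def IsUnitNormalAt (g : SurfaceMetric M) (p : M) (γ : ℝ → M) (n : Plane) (t : ℝ) : Prop :=
  g.chartMetric p (phase p γ t).1 n n = 1 ∧
  g.chartMetric p (phase p γ t).1 n (phase p γ t).2 = 0

lemma IsUnitNormalAt.change {q p : M} {γ : ℝ → M} {n : Plane} {t : ℝ}
    (h : g.IsUnitNormalAt q γ n t) (hγ : g.IsGeodesicIn q γ t)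
    (hp : γ t ∈ (chartAt Plane p).source) :
    g.IsUnitNormalAt p γ (fderiv ℝ (coordChange q p) (phase q γ t).1 n) t := by
  have hu : (phase q γ t).1 ∈ overlap q p := mem_overlap hγ.mem_source hp
  have hiso := g.isIsometryOn_coordChange q p
  unfold IsUnitNormalAt
  rw [hγ.phase_eq hp]
  simp only [phaseMap]
  rw [← hiso.pullback _ hu, ← hiso.pullback _ hu]
  exact h

/-- By `phaseMap_normal` the initial data transform with the same coefficients `a` and `a'`; only
`n` is moved by the differential of the coordinate change. -/
lemma IsVariationAt.change {q p : M} {γf : ℝ → ℝ → M} {n : Plane} {a a' t : ℝ}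
    (h : g.IsVariationAt q γf n a a' t) (hγf : ∀ ε, g.IsUnitSpeedGeodesic (γf ε))
    (hp : γf 0 t ∈ (chartAt Plane p).source) :
    g.IsVariationAt p γf (fderiv ℝ (coordChange q p) (phase q (γf 0) t).1 n) a a' t := by
  have hiso := g.isIsometryOn_coordChange q p
  have hq : γf 0 t ∈ (chartAt Plane q).source := h.1.self_of_nhds
  have hu : (phase q (γf 0) t).1 ∈ overlap q p := mem_overlap hq hp
  have h1 : ∀ᶠ ε in 𝓝 (0 : ℝ), (phase q (γf ε) t).1 ∈ overlap q p :=
    (continuous_fst.continuousAt.comp h.2.continuousAt).eventually (hiso.isOpen.mem_nhds hu)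
  have hp' : ∀ᶠ ε in 𝓝 (0 : ℝ), γf ε t ∈ (chartAt Plane p).source := by
    filter_upwards [h1, h.1] with ε h2 h3
    have h4 := h2.2
    rwa [mem_preimage, phase, (extChartAt (𝓡 2) q).left_inv (by rwa [extChartAt_source])] at h4
  have heq : (fun ε => phase p (γf ε) t) =ᶠ[𝓝 0]
      fun ε => phaseMap (coordChange q p) (phase q (γf ε) t) := by
    filter_upwards [h.1, hp'] with ε h2 h3 using ((hγf ε).isGeodesicIn h2).phase_eq h3
  refine ⟨hp', (HasDerivAt.congr_of_eventuallyEq ?_ heq)⟩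
  have h5 := (hiso.hasFDerivAt_phaseMap (z := phase q (γf 0) t) hu).differentiableAt.hasFDerivAt
  refine (h5.comp_hasDerivAt (0 : ℝ) h.2).congr_deriv ?_
  rw [hiso.phaseMap_normal (g.isLeviCivitaOn q) (overlap_subset q p) (g.isLeviCivitaOn p) hu,
    heq.eq_of_nhds]
  rfl

lemma IsVariationAt.hasDerivAt {p : M} {γf : ℝ → ℝ → M} {n : Plane} {a a' t : ℝ}
    (h : g.IsVariationAt p γf n a a' t) :
    HasDerivAt (fun ε => extChartAt (𝓡 2) p (γf ε t)) (a • n) 0 := h.2.fst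

/-- `n` is a parallel unit normal field along `γ`, in the chart at `p`, during the time `I`. -/
structure IsParallelNormalOn (g : SurfaceMetric M) (p : M) (γ : ℝ → M) (n : ℝ → Plane)
    (I : Set ℝ) : Prop where
  parallel : ∀ t ∈ I, HasDerivAt n
    (-g.chartChristoffel p (phase p γ t).1 (phase p γ t).2 (n t)) t
  unitNormal : ∀ t ∈ I, g.IsUnitNormalAt p γ (n t) t

/-- `(y, y')` is a real solution of Jacobi's equation along `γ`, with its derivative. -/
structure IsJacobiPair (g : SurfaceMetric M) (γ : ℝ → M) (y y' : ℝ → ℝ) : Prop where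
  fst : ∀ t, HasDerivAt y (y' t) t
  snd : ∀ t, HasDerivAt y' (-g.gaussCurvature (γ t) * y t) t

/-- For a short time and inside one chart the nearby geodesics are trajectories of one local flow,
and the Jacobi field solves its linearization, so `flow_expansion` applies. The estimate is kept
uniform in `s` for later use in bounding the curvature along the family. -/
lemma exists_variation_step [T2Space M] {γf : ℝ → ℝ → M}
    (hγf : ∀ ε, g.IsUnitSpeedGeodesic (γf ε)) {p : M} {t₀ : ℝ}
    (hp : γf 0 t₀ ∈ (chartAt Plane p).source) :
    ∃ η > (0 : ℝ), (∀ t ∈ Ioo (t₀ - η) (t₀ + η), g.IsGeodesicIn p (γf 0) t) ∧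
      ∀ (n : ℝ → Plane) (y y' : ℝ → ℝ),
        g.IsParallelNormalOn p (γf 0) n (Ioo (t₀ - η) (t₀ + η)) → g.IsJacobiPair (γf 0) y y' →
        ∀ t ∈ Ioo (t₀ - η) (t₀ + η), ∀ t' ∈ Ioo (t₀ - η) (t₀ + η),
        g.IsVariationAt p γf (n t) (y t) (y' t) t → ∀ c > (0 : ℝ), ∀ᶠ ε in 𝓝 (0 : ℝ),
        ∀ s ∈ uIcc t t', γf ε s ∈ (chartAt Plane p).source ∧
          ‖phase p (γf ε) s - phase p (γf 0) s - ε • (y s • n s, y' s • n s -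
            y s • g.chartChristoffel p (phase p (γf 0) s).1 (phase p (γf 0) s).2 (n s))‖
            ≤ c * |ε| := by
  have hLC := g.isLeviCivitaOn p
  have hγ0 := (hγf 0).isGeodesicIn hp
  set z : ℝ → Plane × Plane := phase p (γf 0) with hz
  have hX := (hLC.contDiffAt_geodesicField hγ0.phase_mem).of_le (m := 1) (by simp)
  obtain ⟨K, W', hW', hK⟩ := hX.exists_lipschitzOnWith
  set W : Set (Plane × Plane) := interior W' ∩ {z | z.1 ∈ (extChartAt (𝓡 2) p).target} with hW
  have hWo : IsOpen W := isOpen_interior.inter (hLC.isOpen.preimage continuous_fst)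
  have hWz : z t₀ ∈ W := ⟨mem_interior_iff_mem_nhds.2 hW', hγ0.phase_mem⟩
  have hKW : LipschitzOnWith K (geodesicField (g.chartChristoffel p)) W :=
    hK.mono (inter_subset_left.trans interior_subset)
  obtain ⟨r, hr, η₀, hη₀, hflow⟩ := exists_local_flow hX (hWo.mem_nhds hWz)
  have hzc : ContinuousAt z t₀ := hγ0.hasDerivAt.continuousAt
  have hev : ∀ᶠ t in 𝓝 t₀, g.IsGeodesicIn p (γf 0) t ∧ z t ∈ W ∧ z t ∈ Metric.ball (z t₀) r := by
    filter_upwards [hγ0.eventually, hzc.eventually (hWo.mem_nhds hWz),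
      hzc.eventually (Metric.ball_mem_nhds _ hr)] with t h1 h2 h3 using ⟨h1, h2, h3⟩
  obtain ⟨η₁, hη₁, hball⟩ := Metric.eventually_nhds_iff_ball.1 hev
  rw [Real.ball_eq_Ioo] at hball
  -- Half of `η₀`, so that the flow started at any time `t` of the interval covers the whole
  -- interval.
  set η := min η₁ (η₀ / 2) with hη
  have hη0 : 0 < η := by positivity
  have hle₁ : η ≤ η₁ := min_le_left _ _
  have hle₀ : η ≤ η₀ / 2 := min_le_right _ _
  have hball' : ∀ t ∈ Ioo (t₀ - η) (t₀ + η),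
      g.IsGeodesicIn p (γf 0) t ∧ z t ∈ W ∧ z t ∈ Metric.ball (z t₀) r := fun t ht =>
    hball t ⟨by linarith [ht.1], by linarith [ht.2]⟩
  refine ⟨η, hη0, fun t ht => (hball' t ht).1, ?_⟩
  intro n y y' hn hy t ht t' ht' hvar c hc
  have hsub : uIcc t t' ⊆ Ioo (t₀ - η) (t₀ + η) := (Set.ordConnected_Ioo).uIcc_subset ht ht'
  have hsub' : uIcc t t' ⊆ Ioo (t - η₀) (t + η₀) := fun s hs => by
    have h1 := hsub hs
    constructor
    · linarith [h1.1, ht.2]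
    · linarith [h1.2, ht.1]
  -- the nearby geodesics are given by the local flow in the chart
  have hnear : ∀ᶠ ε in 𝓝 (0 : ℝ), ∀ s ∈ Ioo (t - η₀) (t + η₀),
      γf ε s ∈ (chartAt Plane p).source ∧
      HasDerivAt (phase p (γf ε)) (geodesicField (g.chartChristoffel p) (phase p (γf ε) s)) s ∧
      phase p (γf ε) s ∈ W := by
    have h1 : ∀ᶠ ε in 𝓝 (0 : ℝ), phase p (γf ε) t ∈ Metric.closedBall (z t₀) r :=
      hvar.2.continuousAt.eventually (mem_of_superset (Metric.isOpen_ball.mem_nhds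
        (hball' t ht).2.2) Metric.ball_subset_closedBall)
    filter_upwards [h1, hvar.1] with ε h2 h3
    obtain ⟨α, hα0, hα⟩ := hflow _ h2 t
    have hin := (hγf ε).isGeodesicIn h3
    have hmem : t ∈ Ioo (t - η₀) (t + η₀) := ⟨by linarith, by linarith⟩
    have hgeo := isGeodesicIn_of_chart (g := g) (p := p) hmem
      (fun s hs => ⟨(hα s hs).1, (hα s hs).2.2⟩) (by rw [hα0]; exact hin.unit)
    have heq := eqOn_of_isGeodesicNear hmem (fun s hs => ⟨p, (hgeo s hs).1⟩)
      (fun s _ => ⟨_, (hγf ε).isGeodesicIn (mem_chart_source Plane (γf ε s))⟩)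
      ((hgeo t hmem).1.eventuallyEq hin ((hgeo t hmem).2.trans hα0))
    intro s hs
    have heqs := heq.eventuallyEq_of_mem (Ioo_mem_nhds hs.1 hs.2)
    have h4 := (hgeo s hs).1.congr heqs
    refine ⟨h4.mem_source, h4.hasDerivAt, ?_⟩
    rw [← (phase_congr heqs).eq_of_nhds, (hgeo s hs).2]
    exact (hα s hs).2
  have hexp := flow_expansion (X := geodesicField (g.chartChristoffel p)) (z := z)
    (w := fun s => (y s • n s, y' s • n s - y s • g.chartChristoffel p (z s).1 (z s).2 (n s)))
    (zf := fun ε => phase p (γf ε)) hKW (t₀ := t) (t₁ := t')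
    (fun s hs => hWo.mem_nhds (hball' s (hsub hs)).2.1)
    (fun s hs => (hLC.contDiffAt_geodesicField (hball' s (hsub hs)).1.phase_mem).of_le (by simp))
    (fun s hs => (hball' s (hsub hs)).1.hasDerivAt)
    (fun s hs => by
      have hs' := (hball' s (hsub hs)).1
      have hu := hn.unitNormal s (hsub hs)
      refine hLC.hasDerivAt_jacobi (τ := g.gaussCurvature (γf 0 s)) hs'.phase_mem hs'.hasDerivAt
        (hn.parallel s (hsub hs)) ?_ (hy.fst s) (hy.snd s)
      rw [g.gaussCurvature_eq_gaussOf hs'.mem_source]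
      exact hLC.curvature_orthonormal hs'.phase_mem hu.1 hs'.unit hu.2)
    (by filter_upwards [hnear] with ε h s hs using (h s (hsub' hs)).2)
    hvar.2 rfl hc
  filter_upwards [hexp, hnear] with ε h1 h2 s hs
  exact ⟨(h2 s (hsub' hs)).1, h1 s hs⟩

lemma exists_variation_propagation [T2Space M] {γf : ℝ → ℝ → M}
    (hγf : ∀ ε, g.IsUnitSpeedGeodesic (γf ε)) {p : M} {t₀ : ℝ}
    (hp : γf 0 t₀ ∈ (chartAt Plane p).source) :
    ∃ η > (0 : ℝ), (∀ t ∈ Ioo (t₀ - η) (t₀ + η), g.IsGeodesicIn p (γf 0) t) ∧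
      ∀ (n : ℝ → Plane) (y y' : ℝ → ℝ),
        g.IsParallelNormalOn p (γf 0) n (Ioo (t₀ - η) (t₀ + η)) → g.IsJacobiPair (γf 0) y y' →
        ∀ t ∈ Ioo (t₀ - η) (t₀ + η), ∀ t' ∈ Ioo (t₀ - η) (t₀ + η),
        g.IsVariationAt p γf (n t) (y t) (y' t) t → g.IsVariationAt p γf (n t') (y t') (y' t') t' := by
  obtain ⟨η, hη, h1, h2⟩ := exists_variation_step hγf hp
  refine ⟨η, hη, h1, fun n y y' hn hy t ht t' ht' hvar => ⟨?_, ?_⟩⟩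
  · filter_upwards [h2 n y y' hn hy t ht t' ht' hvar 1 one_pos] with ε h
    exact (h t' right_mem_uIcc).1
  · rw [hasDerivAt_iff_isLittleO, Asymptotics.isLittleO_iff]
    intro c hc
    filter_upwards [h2 n y y' hn hy t ht t' ht' hvar c hc] with ε h
    simpa using (h t' right_mem_uIcc).2

lemma isParallelNormalOn_normalOf {p : M} {γ : ℝ → M} {I : Set ℝ}
    (h : ∀ t ∈ I, g.IsGeodesicIn p γ t) :
    g.IsParallelNormalOn p γ (fun t => normalOf (g.chartMetric p) (phase p γ t)) I where
  parallel t ht := (g.isLeviCivitaOn p).hasDerivAt_normalOf (h t ht).phase_mem (h t ht).hasDerivAt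
    ((h t ht).mono fun _ hs => hs.2.2)
  unitNormal t ht := (g.isLeviCivitaOn p).normalOf_spec (h t ht).phase_mem (h t ht).unit

lemma IsParallelNormalOn.neg {p : M} {γ : ℝ → M} {n : ℝ → Plane} {I : Set ℝ}
    (h : g.IsParallelNormalOn p γ n I) : g.IsParallelNormalOn p γ (fun t => -n t) I where
  parallel t ht := (h.parallel t ht).fun_neg.congr_deriv (by simp)
  unitNormal t ht := by
    have := h.unitNormal t ht
    simpa [IsUnitNormalAt] using this

/-- Near each point `P` passes between any two times in both directions, so its set of validity is
open and closed in the connected line. -/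
lemma forall_of_locally_constant {P : ℝ → Prop}
    (h : ∀ t₀, ∃ η > (0 : ℝ), ∀ t ∈ Ioo (t₀ - η) (t₀ + η), ∀ t' ∈ Ioo (t₀ - η) (t₀ + η),
      P t → P t') {t₁ : ℝ} (h₁ : P t₁) (t : ℝ) : P t := by
  have hcl : IsClopen {t | P t} := by
    refine ⟨⟨isOpen_iff_mem_nhds.2 fun t ht => ?_⟩, isOpen_iff_mem_nhds.2 fun t ht => ?_⟩
    · obtain ⟨η, hη, hP⟩ := h t
      filter_upwards [Ioo_mem_nhds (by linarith : t - η < t) (by linarith : t < t + η)] with s hs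
      exact fun hs' => ht (hP s hs t ⟨by linarith, by linarith⟩ hs')
    · obtain ⟨η, hη, hP⟩ := h t
      filter_upwards [Ioo_mem_nhds (by linarith : t - η < t) (by linarith : t < t + η)] with s hs
      exact hP t ⟨by linarith, by linarith⟩ s hs ht
  exact (hcl.eq_univ ⟨t₁, h₁⟩).ge (mem_univ t)

/-- A variation through geodesics by a normal Jacobi field stays such a variation. -/
lemma exists_isVariationAt [T2Space M] {γf : ℝ → ℝ → M}
    (hγf : ∀ ε, g.IsUnitSpeedGeodesic (γf ε)) {y y' : ℝ → ℝ} (hy : g.IsJacobiPair (γf 0) y y')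
    {p₁ : M} {n₁ : Plane} {t₁ : ℝ} (hn₁ : g.IsUnitNormalAt p₁ (γf 0) n₁ t₁)
    (h₁ : g.IsVariationAt p₁ γf n₁ (y t₁) (y' t₁) t₁) {p : M} {t : ℝ}
    (hp : γf 0 t ∈ (chartAt Plane p).source) :
    ∃ n, g.IsUnitNormalAt p (γf 0) n t ∧ g.IsVariationAt p γf n (y t) (y' t) t := by
  set P : ℝ → Prop := fun t => ∃ q n, g.IsUnitNormalAt q (γf 0) n t ∧
    g.IsVariationAt q γf n (y t) (y' t) t with hP
  have hchange : ∀ t q, γf 0 t ∈ (chartAt Plane q).source → P t →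
      ∃ n, g.IsUnitNormalAt q (γf 0) n t ∧ g.IsVariationAt q γf n (y t) (y' t) t := by
    rintro t q hq ⟨q', n, h1, h2⟩
    exact ⟨_, h1.change ((hγf 0).isGeodesicIn h2.1.self_of_nhds) hq, h2.change hγf hq⟩
  refine hchange t p hp (forall_of_locally_constant (P := P) (fun t₀ => ?_)
    ⟨p₁, n₁, hn₁, h₁⟩ t)
  obtain ⟨η, hη, hgeo, hstep⟩ := exists_variation_propagation hγf
    (mem_chart_source Plane (γf 0 t₀))
  refine ⟨η, hη, fun t ht t' ht' hPt => ?_⟩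
  obtain ⟨n, hn, hvar⟩ := hchange t _ (hgeo t ht).mem_source hPt
  have hpar := isParallelNormalOn_normalOf hgeo
  have hsp := hpar.unitNormal t ht
  -- The rotated velocity gives a parallel unit normal in this chart, but the transported `n` may be
  -- its negative, so the field is propagated with the matching sign.
  rcases (g.isLeviCivitaOn _).eq_or_eq_neg_of_unit_normal (hgeo t ht).phase_mem hsp.1 hn.1
    (hgeo t ht).unit hsp.2 hn.2 with h | h
  · rw [h] at hvar
    exact ⟨_, _, hpar.unitNormal t' ht', hstep _ y y' hpar hy t ht t' ht' hvar⟩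
  · rw [h] at hvar
    exact ⟨_, _, hpar.neg.unitNormal t' ht', hstep _ y y' hpar.neg hy t ht t' ht' hvar⟩

end SurfaceMetric

/-! ### Variations along a given parallel normal, and their existence. -/

namespace SurfaceMetric

variable {g : SurfaceMetric M}

/-- A vector field along `γ`, in the chart at `p`. -/
def vecInChart (p : M) (γ : ℝ → M) (V : ∀ t, TangentSpace (𝓡 2) (γ t)) (t : ℝ) : Plane :=
  mfderiv (𝓡 2) 𝓘(ℝ, Plane) (extChartAt (𝓡 2) p) (γ t) (V t)

lemma isParallelNormalOn_vecInChart {γ : ℝ → M} (hγ : g.IsUnitSpeedGeodesic γ)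
    {ν : ∀ t, TangentSpace (𝓡 2) (γ t)} (hν : g.IsUnitNormalAlong γ ν) {p : M} {I : Set ℝ}
    (hI : ∀ t ∈ I, γ t ∈ (chartAt Plane p).source) :
    g.IsParallelNormalOn p γ (vecInChart p γ ν) I where
  parallel t ht := by
    have hgeo := hγ.isGeodesicIn (hI t ht)
    have hk : ∀ k, HasDerivAt (fun s => vecInChart p γ ν s k)
        ((-g.chartChristoffel p (phase p γ t).1 (phase p γ t).2 (vecInChart p γ ν t)) k) t := by
      intro k
      have h := hν.parallel p t (hI t ht) k
      simp only [deriv_curveCoord hgeo.hasDerivAt_coord.differentiableAt] at h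
      rw [PiLp.neg_apply, chartChristoffel_apply]
      exact h
    have h1 := ((hk 0).smul_const (planeBasis 0)).add ((hk 1).smul_const (planeBasis 1))
    rw [plane_eq (-g.chartChristoffel p (phase p γ t).1 (phase p γ t).2 (vecInChart p γ ν t))]
    refine h1.congr_of_eventuallyEq (Eventually.of_forall fun s => ?_)
    exact plane_eq (vecInChart p γ ν s)
  unitNormal t ht := by
    have hmd : MDifferentiableAt 𝓘(ℝ, ℝ) (𝓡 2) γ t := (hγ.contMDiff t).mdifferentiableAt (by simp)
    refine ⟨(chartMetric_mfderiv (hI t ht) _ _).trans (hν.unit t), ?_⟩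
    rw [phase_snd (hI t ht) hmd]
    exact (chartMetric_mfderiv (hI t ht) _ _).trans (hν.normal t)

lemma vecInChart_change {q p : M} {γ : ℝ → M} {V : ∀ t, TangentSpace (𝓡 2) (γ t)} {t : ℝ}
    (hq : γ t ∈ (chartAt Plane q).source) (hp : γ t ∈ (chartAt Plane p).source) :
    fderiv ℝ (coordChange q p) (phase q γ t).1 (vecInChart q γ V t) = vecInChart p γ V t := by
  have hu : (phase q γ t).1 ∈ overlap q p := mem_overlap hq hp
  refine (fderiv_coordChange hu _).trans ?_
  have h1 := mfderiv_symm_comp_chart hq (V t)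
  have h2 : (extChartAt (𝓡 2) q).symm (extChartAt (𝓡 2) q (γ t)) = γ t :=
    (extChartAt (𝓡 2) q).left_inv (by rwa [extChartAt_source])
  simp only [phase, vecInChart]
  erw [h1]
  rw [h2]
  rfl

/-- A variation through geodesics by a normal Jacobi field `y ν` stays such a variation. -/
lemma isVariationAt_vecInChart [T2Space M] {γf : ℝ → ℝ → M}
    (hγf : ∀ ε, g.IsUnitSpeedGeodesic (γf ε)) {y y' : ℝ → ℝ} (hy : g.IsJacobiPair (γf 0) y y')
    {ν : ∀ t, TangentSpace (𝓡 2) (γf 0 t)} (hν : g.IsUnitNormalAlong (γf 0) ν)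
    {p₁ : M} {t₁ : ℝ}
    (h₁ : g.IsVariationAt p₁ γf (vecInChart p₁ (γf 0) ν t₁) (y t₁) (y' t₁) t₁) {p : M} {t : ℝ}
    (hp : γf 0 t ∈ (chartAt Plane p).source) :
    g.IsVariationAt p γf (vecInChart p (γf 0) ν t) (y t) (y' t) t := by
  set P : ℝ → Prop := fun t => ∃ q,
    g.IsVariationAt q γf (vecInChart q (γf 0) ν t) (y t) (y' t) t with hP
  have hchange : ∀ t q, γf 0 t ∈ (chartAt Plane q).source → P t →
      g.IsVariationAt q γf (vecInChart q (γf 0) ν t) (y t) (y' t) t := by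
    rintro t q hq ⟨q', h2⟩
    have := h2.change hγf hq
    rwa [vecInChart_change h2.1.self_of_nhds hq] at this
  refine hchange t p hp (forall_of_locally_constant (P := P) (fun t₀ => ?_) ⟨p₁, h₁⟩ t)
  obtain ⟨η, hη, hgeo, hstep⟩ := exists_variation_propagation hγf
    (mem_chart_source Plane (γf 0 t₀))
  refine ⟨η, hη, fun t ht t' ht' hPt => ⟨γf 0 t₀, ?_⟩⟩
  exact hstep _ y y' (isParallelNormalOn_vecInChart (hγf 0) hν fun s hs => (hgeo s hs).mem_source)
    hy t ht t' ht' (hchange t _ (hgeo t ht).mem_source hPt)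

/-- Every normal vector is, with arbitrary covariant derivative, the initial value of the
variation field of a variation through geodesics of unit speed. -/
lemma exists_variation [CompactSpace M] [T2Space M] {γ : ℝ → M} (hγ : g.IsUnitSpeedGeodesic γ)
    {p : M} {n : Plane} {t : ℝ} (hp : γ t ∈ (chartAt Plane p).source)
    (hn : g.IsUnitNormalAt p γ n t) (a a' : ℝ) :
    ∃ γf : ℝ → ℝ → M, γf 0 = γ ∧ (∀ ε, g.IsUnitSpeedGeodesic (γf ε)) ∧
      g.IsVariationAt p γf n a a' t := by
  classical
  have hLC := g.isLeviCivitaOn p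
  have hgeo := hγ.isGeodesicIn hp
  set z := phase p γ t with hz
  set w : Plane := a' • n - a • g.chartChristoffel p z.1 z.2 n with hw
  set u : ℝ → Plane := fun ε => z.1 + ε • a • n with hu
  set v : ℝ → Plane := fun ε => z.2 + ε • w with hv
  have hu0 : u 0 = z.1 := by simp [hu]
  have hv0 : v 0 = z.2 := by simp [hv]
  have hud : HasDerivAt u (a • n) 0 := by
    exact (((hasDerivAt_id (0 : ℝ)).smul_const (a • n)).const_add z.1).congr_deriv (by simp)
  have hvd : HasDerivAt v w 0 := by
    exact (((hasDerivAt_id (0 : ℝ)).smul_const w).const_add z.2).congr_deriv (by simp)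
  set f : ℝ → ℝ := fun ε => g.chartMetric p (u ε) (v ε) (v ε) with hf
  have hzt : z.1 ∈ (extChartAt (𝓡 2) p).target := hgeo.phase_mem
  have hf0 : f 0 = 1 := by simp only [hf, hu0, hv0]; exact hgeo.unit
  -- The derivative of the squared speed is `2 a' g(n, γ') = 0`, so normalizing the velocity does
  -- not alter the first order behaviour of the initial data.
  have hfd : HasDerivAt f 0 0 := by
    refine (hLC.hasDerivAt_metric (by rw [hu0]; exact hzt) hud hvd hvd).congr_deriv ?_
    have h1 : w + g.chartChristoffel p (u 0) (a • n) (v 0) = a' • n := by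
      rw [hu0, hv0, map_smul, smul_apply, hLC.christoffel_symm hzt n, hw]
      abel
    rw [h1, hu0, hv0, hLC.symm _ hzt z.2]
    have h2 : g.chartMetric p z.1 n z.2 = 0 := hn.2
    simp [h2]
  set ζ : ℝ → Plane × Plane := fun ε => (u ε, (√(f ε))⁻¹ • v ε) with hζ
  have hζ0 : ζ 0 = z := by simp [hζ, hu0, hv0, hf0]
  have hζd : HasDerivAt ζ (a • n, w) 0 := by
    have h1 : HasDerivAt (fun ε => (√(f ε))⁻¹) _ 0 :=
      (hfd.sqrt (by rw [hf0]; norm_num)).fun_inv (by simp [hf0])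
    refine (hud.prodMk (h1.smul hvd)).congr_deriv ?_
    simp [hf0]
  have hgood : ∀ᶠ ε in 𝓝 (0 : ℝ), (ζ ε).1 ∈ (extChartAt (𝓡 2) p).target ∧
      g.chartMetric p (ζ ε).1 (ζ ε).2 (ζ ε).2 = 1 := by
    have h1 : ∀ᶠ ε in 𝓝 (0 : ℝ), u ε ∈ (extChartAt (𝓡 2) p).target :=
      hud.continuousAt.eventually (hLC.isOpen.mem_nhds (by rw [hu0]; exact hzt))
    have h2 : ∀ᶠ ε in 𝓝 (0 : ℝ), 0 < f ε :=
      hfd.continuousAt.eventually (lt_mem_nhds (by rw [hf0]; norm_num))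
    filter_upwards [h1, h2] with ε h3 h4
    refine ⟨h3, ?_⟩
    simp only [hζ, map_smul, smul_apply, smul_eq_mul]
    change (√(f ε))⁻¹ * ((√(f ε))⁻¹ * f ε) = 1
    rw [← mul_assoc, ← mul_inv, Real.mul_self_sqrt h4.le, inv_mul_cancel₀ h4.ne']
  -- At `ε = 0` the geodesic has to be `γ` itself. Where the initial data are unusable, which does
  -- not happen near `0`, any geodesic will do, and `γ` is taken.
  have hex : ∀ ε, ∃ η : ℝ → M, g.IsUnitSpeedGeodesic η ∧ ((ε = 0 → η = γ) ∧
      ((ζ ε).1 ∈ (extChartAt (𝓡 2) p).target ∧ g.chartMetric p (ζ ε).1 (ζ ε).2 (ζ ε).2 = 1 →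
        η t ∈ (chartAt Plane p).source ∧ phase p η t = ζ ε)) := by
    intro ε
    by_cases h0 : ε = 0
    · subst h0
      exact ⟨γ, hγ, fun _ => rfl, fun _ => ⟨hp, hζ0.symm⟩⟩
    by_cases h : (ζ ε).1 ∈ (extChartAt (𝓡 2) p).target ∧
        g.chartMetric p (ζ ε).1 (ζ ε).2 (ζ ε).2 = 1
    · obtain ⟨η, h1, h2, h3⟩ := exists_isUnitSpeedGeodesic h.1 h.2 t
      exact ⟨η, h1, fun h => (h0 h).elim, fun _ => ⟨h2, h3⟩⟩
    · exact ⟨γ, hγ, fun h => (h0 h).elim, fun h' => (h h').elim⟩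
  choose γf h1 h2 h3 using hex
  refine ⟨γf, h2 0 rfl, h1, ?_, ?_⟩
  · filter_upwards [hgood] with ε hε using (h3 ε hε).1
  · rw [h2 0 rfl]
    refine hζd.congr_of_eventuallyEq ?_
    filter_upwards [hgood] with ε hε using (h3 ε hε).2

end SurfaceMetric

/-! ### The Gauss curvature along a variation. -/

namespace SurfaceMetric

variable {g : SurfaceMetric M}

lemma IsVariationAt.hasDerivAt_gaussCurvature {γf : ℝ → ℝ → M}
    {ν : ∀ t, TangentSpace (𝓡 2) (γf 0 t)} {p : M} {a a' t : ℝ}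
    (h : g.IsVariationAt p γf (vecInChart p (γf 0) ν t) a a' t) :
    HasDerivAt (fun ε => g.gaussCurvature (γf ε t))
      (g.normalDerivCurvature (γf 0) ν t * a) 0 := by
  have hp : γf 0 t ∈ (chartAt Plane p).source := h.1.self_of_nhds
  have h1 : HasFDerivAt (gaussOf (g.chartMetric p) (g.chartChristoffel p)) _
      (extChartAt (𝓡 2) p (γf 0 t)) :=
    (((g.isLeviCivitaOn p).contDiffAt_gaussOf (mem_target hp)).differentiableAt
      (by simp)).hasFDerivAt
  have h2 := h1.comp_hasDerivAt (0 : ℝ) h.hasDerivAt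
  refine (h2.congr_of_eventuallyEq ?_).congr_deriv ?_
  · filter_upwards [h.1] with ε hε using g.gaussCurvature_eq_gaussOf hε
  · rw [map_smul, smul_eq_mul, mul_comm]
    congr 1
    exact (g.mfderiv_gaussCurvature hp (ν t)).symm

section Bounds

variable {γf : ℝ → ℝ → M} {y y' : ℝ → ℝ} {ν : ∀ t, TangentSpace (𝓡 2) (γf 0 t)}

/-- Supplies the uniform bound needed for dominated convergence. In a chart the curvature is locally
Lipschitz, and by `exists_variation_step` the position moves by at most `(1 + B) * |ε|`, where `B`
bounds `y n`. -/
lemma exists_gaussCurvature_sub_le_near [T2Space M] (hγf : ∀ ε, g.IsUnitSpeedGeodesic (γf ε))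
    (hy : g.IsJacobiPair (γf 0) y y') (hν : g.IsUnitNormalAlong (γf 0) ν)
    (hvar : ∀ p t, γf 0 t ∈ (chartAt Plane p).source →
      g.IsVariationAt p γf (vecInChart p (γf 0) ν t) (y t) (y' t) t) (s₀ : ℝ) :
    ∃ S ∈ 𝓝 s₀, ∃ K : ℝ, ∀ᶠ ε in 𝓝 (0 : ℝ), ∀ s ∈ S,
      |g.gaussCurvature (γf ε s) - g.gaussCurvature (γf 0 s)| ≤ K * |ε| := by
  obtain ⟨p, hp⟩ : ∃ p, p = γf 0 s₀ := ⟨_, rfl⟩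
  obtain ⟨η, hη, hgeo, hstep⟩ := exists_variation_step hγf (p := p) (t₀ := s₀)
    (by rw [hp]; exact mem_chart_source Plane (γf 0 s₀))
  set n := vecInChart p (γf 0) ν with hn
  have hpar := isParallelNormalOn_vecInChart (hγf 0) hν (p := p) (I := Ioo (s₀ - η) (s₀ + η))
    fun s hs => (hgeo s hs).mem_source
  have hm : s₀ - η / 2 ∈ Ioo (s₀ - η) (s₀ + η) := ⟨by linarith, by linarith⟩
  have hM : s₀ + η / 2 ∈ Ioo (s₀ - η) (s₀ + η) := ⟨by linarith, by linarith⟩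
  have hs₀ : s₀ ∈ Ioo (s₀ - η) (s₀ + η) := ⟨by linarith, by linarith⟩
  have hev := hstep n y y' hpar hy _ hm _ hM (hvar p _ (hgeo _ hm).mem_source) 1 one_pos
  rw [uIcc_of_le (by linarith)] at hev
  have hsub : Icc (s₀ - η / 2) (s₀ + η / 2) ⊆ Ioo (s₀ - η) (s₀ + η) := fun s hs =>
    ⟨by linarith [hs.1], by linarith [hs.2]⟩
  have hcont : ContinuousOn (fun s => y s • n s) (Icc (s₀ - η / 2) (s₀ + η / 2)) := fun s hs =>
    ((hy.fst s).continuousAt.smul (hpar.parallel s (hsub hs)).continuousAt).continuousWithinAt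
  obtain ⟨B, hB⟩ := isCompact_Icc.exists_bound_of_continuousOn hcont
  have hB0 : 0 ≤ B := (norm_nonneg _).trans (hB s₀ ⟨by linarith, by linarith⟩)
  obtain ⟨K, W, hW, hK⟩ := (((g.isLeviCivitaOn p).contDiffAt_gaussOf
    (hgeo s₀ hs₀).phase_mem).of_le (m := 1) (by simp)).exists_lipschitzOnWith
  obtain ⟨r, hr, hrW⟩ := Metric.mem_nhds_iff.1 hW
  have hc : ContinuousAt (fun s => (phase p (γf 0) s).1) s₀ :=
    (hgeo s₀ hs₀).hasDerivAt_coord.continuousAt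
  have hsmall : ∀ᶠ ε in 𝓝 (0 : ℝ), (1 + B) * |ε| < r / 2 := by
    have : ContinuousAt (fun ε : ℝ => (1 + B) * |ε|) 0 := by fun_prop
    exact this.eventually (gt_mem_nhds (by simpa))
  refine ⟨Icc (s₀ - η / 2) (s₀ + η / 2) ∩
    (fun s => (phase p (γf 0) s).1) ⁻¹' Metric.ball (phase p (γf 0) s₀).1 (r / 2),
    inter_mem (Icc_mem_nhds (by linarith) (by linarith))
      (hc (Metric.ball_mem_nhds _ (by positivity))), K * (1 + B), ?_⟩
  filter_upwards [hev, hsmall] with ε h1 h2 s hs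
  obtain ⟨h3, h4⟩ := h1 s hs.1
  have h5 : ‖(phase p (γf ε) s).1 - (phase p (γf 0) s).1 - ε • (y s • n s)‖ ≤ 1 * |ε| :=
    (norm_fst_le _).trans h4
  have h6 : dist (phase p (γf ε) s).1 (phase p (γf 0) s).1 ≤ (1 + B) * |ε| := by
    rw [dist_eq_norm]
    have h7 := norm_add_le ((phase p (γf ε) s).1 - (phase p (γf 0) s).1 - ε • (y s • n s))
      (ε • (y s • n s))
    rw [sub_add_cancel, norm_smul ε, Real.norm_eq_abs] at h7
    have h8 := mul_le_mul_of_nonneg_left (hB s hs.1) (abs_nonneg ε)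
    linarith
  have h9 : dist (phase p (γf 0) s).1 (phase p (γf 0) s₀).1 < r / 2 := hs.2
  rw [g.gaussCurvature_eq_gaussOf h3, g.gaussCurvature_eq_gaussOf (hgeo s (hsub hs.1)).mem_source,
    ← Real.dist_eq, mul_assoc]
  refine (hK.dist_le_mul _ (hrW ?_) _ (hrW ?_)).trans (mul_le_mul_of_nonneg_left h6 K.2)
  · exact (dist_triangle _ (phase p (γf 0) s).1 _).trans_lt
      ((add_lt_add_of_le_of_lt h6 h9).trans (by linarith))
  · exact h9.trans (by linarith)

lemma exists_gaussCurvature_sub_le [T2Space M] (hγf : ∀ ε, g.IsUnitSpeedGeodesic (γf ε))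
    (hy : g.IsJacobiPair (γf 0) y y') (hν : g.IsUnitNormalAlong (γf 0) ν)
    (hvar : ∀ p t, γf 0 t ∈ (chartAt Plane p).source →
      g.IsVariationAt p γf (vecInChart p (γf 0) ν t) (y t) (y' t) t) {I : Set ℝ}
    (hI : IsCompact I) :
    ∃ K : ℝ, ∀ᶠ ε in 𝓝 (0 : ℝ), ∀ s ∈ I,
      |g.gaussCurvature (γf ε s) - g.gaussCurvature (γf 0 s)| ≤ K * |ε| := by
  refine hI.induction_on (p := fun S => ∃ K : ℝ, ∀ᶠ ε in 𝓝 (0 : ℝ), ∀ s ∈ S,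
      |g.gaussCurvature (γf ε s) - g.gaussCurvature (γf 0 s)| ≤ K * |ε|) ⟨0, by simp⟩
    ?_ ?_ ?_
  · rintro s t hst ⟨K, h⟩
    exact ⟨K, h.mono fun ε hε s hs => hε s (hst hs)⟩
  · rintro s t ⟨K, h⟩ ⟨K', h'⟩
    refine ⟨max K K', ?_⟩
    filter_upwards [h, h'] with ε h1 h2 x hx
    rcases hx with hx | hx
    · exact (h1 x hx).trans (by gcongr; exact le_max_left _ _)
    · exact (h2 x hx).trans (by gcongr; exact le_max_right _ _)
  · intro x _
    obtain ⟨S, hS, K, h⟩ := exists_gaussCurvature_sub_le_near hγf hy hν hvar x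
    exact ⟨S, mem_nhdsWithin_of_mem_nhds hS, K, h⟩

end Bounds

/-! ### Periodicity of normal Jacobi fields. -/

section Periodicity

/-- On a Zoll surface, every period of a geodesic is a period of all geodesics. -/
lemma IsZoll.periodic (hg : g.IsZoll) {γ : ℝ → M} (hγ : g.IsUnitSpeedGeodesic γ) {L : ℝ}
    (hL : 0 < L) (hper : Function.Periodic γ L) {η : ℝ → M} (hη : g.IsUnitSpeedGeodesic η) :
    Function.Periodic η L := by
  obtain ⟨L₀, h⟩ := hg
  obtain ⟨⟨hL₀, hγL₀⟩, hmin⟩ := h γ hγ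
  obtain ⟨⟨-, hηL₀⟩, -⟩ := h η hη
  -- The remainder `L - k * L₀` is less than `L₀`; if positive it would be a period of `γ`,
  -- contradicting the minimality of `L₀`.
  set k := ⌊L / L₀⌋₊ with hk
  have h1 : (k : ℝ) * L₀ ≤ L := (le_div_iff₀ hL₀).1 (Nat.floor_le (by positivity))
  have h2 : L < (k + 1 : ℝ) * L₀ := (div_lt_iff₀ hL₀).1 (Nat.lt_floor_add_one _)
  have h3 : L = k * L₀ := by
    by_contra hne
    have h4 : 0 < L - k * L₀ := sub_pos.2 (lt_of_le_of_ne h1 (Ne.symm hne))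
    have h5 := hmin (a := L - k * L₀) ⟨h4, fun t => by
      rw [← add_sub_assoc, (hγL₀.nat_mul k).sub_eq, hper]⟩
    linarith
  rw [h3]
  exact hηL₀.nat_mul k

lemma phase_periodic {γ : ℝ → M} {L : ℝ} (h : Function.Periodic γ L) (p : M) :
    Function.Periodic (phase p γ) L := fun t => by
  have h1 : (fun s => extChartAt (𝓡 2) p (γ s)) = fun s => extChartAt (𝓡 2) p (γ (s + L)) := by
    funext s
    rw [h]
  unfold phase
  rw [h t]
  conv_rhs => rw [h1]
  rw [deriv_comp_add_const (fun s => extChartAt (𝓡 2) p (γ s)) L t]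

lemma exists_gaussCurvature_le [CompactSpace M] (g : SurfaceMetric M) :
    ∃ C, ∀ x, |g.gaussCurvature x| ≤ C := by
  obtain ⟨C, hC⟩ := isCompact_univ.exists_bound_of_continuousOn
    g.continuous_gaussCurvature.continuousOn
  exact ⟨C, fun x => hC x (mem_univ x)⟩

lemma IsJacobiPair.hasDerivAt {γ : ℝ → M} {y y' : ℝ → ℝ} (h : g.IsJacobiPair γ y y') (t : ℝ) :
    HasDerivAt (fun t => (y t, y' t)) (oscillator (g.gaussCurvature (γ t)) (y t, y' t)) t :=
  ((h.fst t).prodMk (h.snd t)).congr_deriv (by simp)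

lemma IsJacobiPair.eq_of_eq [CompactSpace M] {γ : ℝ → M} {y y' z z' : ℝ → ℝ}
    (hy : g.IsJacobiPair γ y y') (hz : g.IsJacobiPair γ z z') {t₀ : ℝ} (h : y t₀ = z t₀)
    (h' : y' t₀ = z' t₀) (t : ℝ) : y t = z t ∧ y' t = z' t := by
  obtain ⟨C, hC⟩ := g.exists_gaussCurvature_le
  obtain ⟨a, ha⟩ := exists_lt (min t t₀)
  obtain ⟨b, hb⟩ := exists_gt (max t t₀)
  have hat := lt_min_iff.1 ha
  have hbt := max_lt_iff.1 hb
  have := linear_ode_unique (fun t => norm_oscillator_le (hC (γ t))) (s := t₀) ⟨hat.2, hbt.2⟩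
    (fun t _ => hy.hasDerivAt t) (fun t _ => hz.hasDerivAt t) (by simp [h, h'])
    (show t ∈ Ioo a b from ⟨hat.1, hbt.1⟩)
  simpa using this

lemma IsJacobiPair.const_mul {γ : ℝ → M} {y y' : ℝ → ℝ} (h : g.IsJacobiPair γ y y') (k : ℝ) :
    g.IsJacobiPair γ (fun t => k * y t) (fun t => k * y' t) where
  fst t := (h.fst t).const_mul k
  snd t := ((h.snd t).const_mul k).congr_deriv (by ring)

lemma IsJacobiPair.comp_add_const {γ : ℝ → M} {y y' : ℝ → ℝ} (h : g.IsJacobiPair γ y y') {L : ℝ}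
    (hγ : Function.Periodic γ L) :
    g.IsJacobiPair γ (fun t => y (t + L)) (fun t => y' (t + L)) where
  fst t := (h.fst (t + L)).comp_add_const t L
  snd t := by simpa only [hγ t] using (h.snd (t + L)).comp_add_const t L

variable [CompactSpace M] [T2Space M]

/-- If all geodesics have period `L`, then normal Jacobi fields have period `L` up to sign. -/
lemma IsJacobiPair.eq_or_eq_neg {L : ℝ}
    (hper : ∀ γ : ℝ → M, g.IsUnitSpeedGeodesic γ → Function.Periodic γ L) {γ : ℝ → M}
    (hγ : g.IsUnitSpeedGeodesic γ) {y y' : ℝ → ℝ} (hy : g.IsJacobiPair γ y y') (t : ℝ) :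
    ∃ σ : ℝ, σ * σ = 1 ∧ y (t + L) = σ * y t ∧ y' (t + L) = σ * y' t := by
  set p := γ t
  have hp : γ t ∈ (chartAt Plane p).source := mem_chart_source Plane (γ t)
  have hLC := g.isLeviCivitaOn p
  have hgeo := hγ.isGeodesicIn hp
  set n := normalOf (g.chartMetric p) (phase p γ t) with hn
  have hu : g.IsUnitNormalAt p γ n t := hLC.normalOf_spec hgeo.phase_mem hgeo.unit
  obtain ⟨γf, h0, hγf, hvar⟩ := exists_variation hγ hp hu (y t) (y' t)
  subst h0
  have hpL : γf 0 (t + L) ∈ (chartAt Plane p).source := by rwa [hper _ hγ]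
  obtain ⟨m, hm, hvarL⟩ := exists_isVariationAt hγf hy hu hvar hpL
  have hph : ∀ ε, phase p (γf ε) (t + L) = phase p (γf ε) t := fun ε =>
    phase_periodic (hper _ (hγf ε)) p t
  have hd := hvarL.2
  -- All curves of the family have period `L`, so their phases at `t + L` and `t` coincide for every
  -- `ε`; the `ε`-derivatives then coincide as well.
  simp only [hph] at hd
  have heq := hvar.2.unique hd
  rw [Prod.mk.injEq] at heq
  obtain ⟨e1, e2⟩ := heq
  unfold IsUnitNormalAt at hm
  rw [hph] at hm
  have hn0 : n ≠ 0 := by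
    rintro h
    have := hu.1
    simp [h] at this
  have e1' : g.chartChristoffel p (phase p (γf 0) t).1 (phase p (γf 0) t).2 (y t • n) =
      g.chartChristoffel p (phase p (γf 0) t).1 (phase p (γf 0) t).2 (y (t + L) • m) := by rw [e1]
  rw [map_smul, map_smul] at e1'
  rw [e1', sub_left_inj] at e2
  -- The normal may come back reversed when the surface is not orientable along `γ`; this is the
  -- sign `σ`.
  rcases hLC.eq_or_eq_neg_of_unit_normal hgeo.phase_mem hu.1 hm.1 hgeo.unit hu.2 hm.2 with h | h
  · rw [h] at e1 e2
    refine ⟨1, by norm_num, ?_, ?_⟩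
    · rw [one_mul]; exact (smul_left_injective ℝ hn0 e1).symm
    · rw [one_mul]; exact (smul_left_injective ℝ hn0 e2).symm
  · rw [h, smul_neg, ← neg_smul] at e1 e2
    refine ⟨-1, by norm_num, ?_, ?_⟩
    · linarith [smul_left_injective ℝ hn0 e1]
    · linarith [smul_left_injective ℝ hn0 e2]

/-- Uniqueness extends `y(· + L) = σ y` from the time `t` to all times with the same `σ`; applied
twice it gives the factor `σ² = 1`. Thus `2L` closes the scalar solutions whatever the orientation.
-/
lemma IsJacobiPair.add_two_mul {L : ℝ}
    (hper : ∀ γ : ℝ → M, g.IsUnitSpeedGeodesic γ → Function.Periodic γ L) {γ : ℝ → M}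
    (hγ : g.IsUnitSpeedGeodesic γ) {y y' : ℝ → ℝ} (hy : g.IsJacobiPair γ y y') (t : ℝ) :
    y (t + 2 * L) = y t ∧ y' (t + 2 * L) = y' t := by
  obtain ⟨σ, hσ, h1, h2⟩ := hy.eq_or_eq_neg hper hγ t
  obtain ⟨h3, h4⟩ := (hy.comp_add_const (hper γ hγ)).eq_of_eq (hy.const_mul σ) h1 h2 (t + L)
  rw [two_mul, ← add_assoc, h3, h4, h1, h2, ← mul_assoc, ← mul_assoc, hσ, one_mul, one_mul]
  exact ⟨rfl, rfl⟩

/-- If all geodesics have period `L`, then normal Jacobi fields have period `L`. -/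
lemma IsJacobiPair.smul_vecInChart_periodic {L : ℝ}
    (hper : ∀ γ : ℝ → M, g.IsUnitSpeedGeodesic γ → Function.Periodic γ L) {γ : ℝ → M}
    (hγ : g.IsUnitSpeedGeodesic γ) {ν : ∀ t, TangentSpace (𝓡 2) (γ t)}
    (hν : g.IsUnitNormalAlong γ ν) {y y' : ℝ → ℝ} (hy : g.IsJacobiPair γ y y') {p : M} {t : ℝ}
    (hp : γ t ∈ (chartAt Plane p).source) :
    y (t + L) • vecInChart p γ ν (t + L) = y t • vecInChart p γ ν t := by
  have hu := (isParallelNormalOn_vecInChart hγ hν (I := {t}) (p := p)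
    (by rintro _ rfl; exact hp)).unitNormal t rfl
  obtain ⟨γf, h0, hγf, hvar⟩ := exists_variation hγ hp hu (y t) (y' t)
  subst h0
  have hpL : γf 0 (t + L) ∈ (chartAt Plane p).source := by rwa [hper _ hγ]
  have hd := (isVariationAt_vecInChart hγf hy hν hvar hpL).2
  have hph : ∀ ε, phase p (γf ε) (t + L) = phase p (γf ε) t := fun ε =>
    phase_periodic (hper _ (hγf ε)) p t
  simp only [hph] at hd
  have heq := hvar.2.unique hd
  rw [Prod.mk.injEq] at heq
  exact heq.1.symm

end Periodicity

end SurfaceMetric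

/-! ### The integral of three real Jacobi fields. -/

namespace SurfaceMetric

variable {g : SurfaceMetric M}

lemma normalDerivCurvature_eq {γ : ℝ → M} {ν : ∀ t, TangentSpace (𝓡 2) (γ t)} {p : M} {t : ℝ}
    (hp : γ t ∈ (chartAt Plane p).source) :
    g.normalDerivCurvature γ ν t =
      fderiv ℝ (gaussOf (g.chartMetric p) (g.chartChristoffel p)) (phase p γ t).1
        (vecInChart p γ ν t) :=
  g.mfderiv_gaussCurvature hp (ν t)

lemma continuous_normalDerivCurvature {γ : ℝ → M} (hγ : g.IsUnitSpeedGeodesic γ)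
    {ν : ∀ t, TangentSpace (𝓡 2) (γ t)} (hν : g.IsUnitNormalAlong γ ν) :
    Continuous (g.normalDerivCurvature γ ν) := by
  refine continuous_iff_continuousAt.2 fun t => ?_
  obtain ⟨p, hp⟩ : ∃ p, γ t ∈ (chartAt Plane p).source := ⟨_, mem_chart_source Plane (γ t)⟩
  have hgeo := hγ.isGeodesicIn hp
  have hpar := (isParallelNormalOn_vecInChart hγ hν (p := p) (I := {t})
    (by rintro _ rfl; exact hp)).parallel t rfl
  have h1 : ContinuousAt (fderiv ℝ (gaussOf (g.chartMetric p) (g.chartChristoffel p)))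
      (phase p γ t).1 :=
    (((g.isLeviCivitaOn p).contDiffAt_gaussOf hgeo.phase_mem).fderiv_right (m := ∞)
      (by simp)).continuousAt
  have h2 : ContinuousAt (fun s => (phase p γ s).1) t := hgeo.hasDerivAt_coord.continuousAt
  refine ((ContinuousAt.comp (f := fun s => (phase p γ s).1) h1 h2).clm_apply
    hpar.continuousAt).congr ?_
  filter_upwards [hgeo.eventually] with s hs
  exact (normalDerivCurvature_eq hs.mem_source).symm

variable [CompactSpace M] [T2Space M]

/-- The normal and the scalar functions may each change sign after `L`, but the integrand is `dτ(a
ν) g(b ν, c ν)`, and the fields `a ν`, `b ν`, `c ν` are `L`-periodic. -/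
lemma integrand_periodic {L : ℝ}
    (hper : ∀ γ : ℝ → M, g.IsUnitSpeedGeodesic γ → Function.Periodic γ L) {γ : ℝ → M}
    (hγ : g.IsUnitSpeedGeodesic γ) {ν : ∀ t, TangentSpace (𝓡 2) (γ t)}
    (hν : g.IsUnitNormalAlong γ ν) {a a' b b' c c' : ℝ → ℝ} (ha : g.IsJacobiPair γ a a')
    (hb : g.IsJacobiPair γ b b') (hc : g.IsJacobiPair γ c c') :
    Function.Periodic (fun t => g.normalDerivCurvature γ ν t * a t * (b t * c t)) L := by
  intro t
  obtain ⟨p, hp⟩ : ∃ p, γ t ∈ (chartAt Plane p).source := ⟨_, mem_chart_source Plane (γ t)⟩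
  have key : ∀ s, γ s ∈ (chartAt Plane p).source →
      g.normalDerivCurvature γ ν s * a s * (b s * c s) =
        fderiv ℝ (gaussOf (g.chartMetric p) (g.chartChristoffel p)) (phase p γ s).1
          (a s • vecInChart p γ ν s) *
        g.chartMetric p (phase p γ s).1 (b s • vecInChart p γ ν s)
          (c s • vecInChart p γ ν s) := by
    intro s hs
    have hu := ((isParallelNormalOn_vecInChart hγ hν (p := p) (I := {s})
      (by rintro _ rfl; exact hs)).unitNormal s rfl).1
    rw [normalDerivCurvature_eq hs]
    simp only [map_smul, smul_apply, smul_eq_mul, hu]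
    ring
  have hpL : γ (t + L) ∈ (chartAt Plane p).source := by rwa [hper _ hγ]
  simp only [key _ hp, key _ hpL]
  rw [ha.smul_vecInChart_periodic hper hγ hν hp, hb.smul_vecInChart_periodic hper hγ hν hp,
    hc.smul_vecInChart_periodic hper hγ hν hp, phase_periodic (hper _ hγ)]

lemma integral_normalDerivCurvature_mul_eq_zero {L : ℝ} (hL : 0 < L)
    (hper : ∀ γ : ℝ → M, g.IsUnitSpeedGeodesic γ → Function.Periodic γ L) {γ : ℝ → M}
    (hγ : g.IsUnitSpeedGeodesic γ) {ν : ∀ t, TangentSpace (𝓡 2) (γ t)}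
    (hν : g.IsUnitNormalAlong γ ν) {a a' b b' c c' : ℝ → ℝ} (ha : g.IsJacobiPair γ a a')
    (hb : g.IsJacobiPair γ b b') (hc : g.IsJacobiPair γ c c') :
    ∫ t in (0 : ℝ)..L, g.normalDerivCurvature γ ν t * a t * (b t * c t) = 0 := by
  have hcont : Continuous fun t => g.normalDerivCurvature γ ν t * a t * (b t * c t) := by
    have h : ∀ {f f' : ℝ → ℝ}, g.IsJacobiPair γ f f' → Continuous f := fun hf =>
      continuous_iff_continuousAt.2 fun t => (hf.fst t).continuousAt
    exact ((continuous_normalDerivCurvature hγ hν).mul (h ha)).mul ((h hb).mul (h hc))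
  have hF := integrand_periodic hper hγ hν ha hb hc
  -- The Wronskian argument runs over `2L`, where all scalar solutions close up. Here `a` drives the
  -- variation of `γ`, while `b` and `c` are the two solutions compared.
  have h2 : ∫ t in (0 : ℝ)..2 * L, g.normalDerivCurvature γ ν t * a t * (b t * c t) = 0 := by
    have hp : γ 0 ∈ (chartAt Plane (γ 0)).source := mem_chart_source Plane (γ 0)
    have hu := (isParallelNormalOn_vecInChart hγ hν (I := {0}) (p := γ 0)
      (by rintro _ rfl; exact hp)).unitNormal 0 rfl
    obtain ⟨γf, h0, hγf, hvar0⟩ := exists_variation hγ hp hu (a 0) (a' 0)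
    subst h0
    have hvar : ∀ p t, γf 0 t ∈ (chartAt Plane p).source →
        g.IsVariationAt p γf (vecInChart p (γf 0) ν t) (a t) (a' t) t := fun p t hp =>
      isVariationAt_vecInChart hγf ha hν hvar0 hp
    obtain ⟨C, hC⟩ := g.exists_gaussCurvature_le
    obtain ⟨K, hK⟩ := exists_gaussCurvature_sub_le hγf ha hν hvar (I := Icc 0 (2 * L)) isCompact_Icc
    refine integral_derivative_coefficient_eq_zero (κ := fun ε t => g.gaussCurvature (γf ε t))
      (by positivity) (fun ε => g.continuous_gaussCurvature.comp (hγf ε).contMDiff.continuous)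
      (fun ε t => hC _) hK
      (fun t _ => (hvar _ t (mem_chart_source Plane (γf 0 t))).hasDerivAt_gaussCurvature)
      (fun ε y y' h h' => ?_) hb.fst hb.snd hc.fst hc.snd
    have := IsJacobiPair.add_two_mul hper (hγf ε) (y := y) (y' := y') ⟨h, h'⟩ 0
    rwa [zero_add] at this
  have h3 := hF.intervalIntegral_add_eq 0 L
  rw [← intervalIntegral.integral_add_adjacent_intervals (hcont.intervalIntegrable 0 L)
    (hcont.intervalIntegrable L (2 * L)), two_mul, ← h3, zero_add] at h2
  linarith

/-- The curvature is real, so real linear functionals, in particular the real and imaginary parts,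
preserve Jacobi's equation. -/
lemma IsNormalJacobi.isJacobiPair_comp {γ : ℝ → M} {𝕜 : Type*} [RCLike 𝕜] {y : ℝ → 𝕜}
    (hy : g.IsNormalJacobi γ y) (φ : 𝕜 →L[ℝ] ℝ) :
    g.IsJacobiPair γ (fun t => φ (y t)) (fun t => φ (deriv y t)) where
  fst t := φ.hasFDerivAt.comp_hasDerivAt t (hy.1 t).hasDerivAt
  snd t := by
    refine (φ.hasFDerivAt.comp_hasDerivAt t (hy.2 t)).congr_deriv ?_
    rw [← RCLike.ofReal_neg, ← RCLike.real_smul_eq_coe_mul, map_smul, smul_eq_mul]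

end SurfaceMetric

end

/-! ### The theorem, by reduction to real and imaginary parts. -/

theorem lemma2p1 {M : Type*} [TopologicalSpace M] [T2Space M] [CompactSpace M]
    [ChartedSpace Plane M] [IsManifold (𝓡 2) ∞ M]
    (g : SurfaceMetric M) (hg : g.IsZoll)
    (γ : ℝ → M) (hγ : g.IsUnitSpeedGeodesic γ)
    (L : ℝ) (hL : 0 < L) (hper : Function.Periodic γ L)
    (ν : ∀ s, TangentSpace (𝓡 2) (γ s)) (hν : g.IsUnitNormalAlong γ ν)
    {𝕜 : Type*} [RCLike 𝕜] (y y₂ : ℝ → 𝕜)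
    (hy : g.IsNormalJacobi γ y) (hy₂ : g.IsNormalJacobi γ y₂) :
    ∫ s in (0 : ℝ)..L, ((g.normalDerivCurvature γ ν s : ℝ) : 𝕜) * y s ^ 2 * y₂ s = 0 := by
  have hτ := SurfaceMetric.continuous_normalDerivCurvature hγ hν
  have hyc : Continuous y := hy.1.continuous
  have hyc₂ : Continuous y₂ := hy₂.1.continuous
  have hre : Continuous fun s => RCLike.re (y s) := RCLike.continuous_re.comp hyc
  have him : Continuous fun s => RCLike.im (y s) := RCLike.continuous_im.comp hyc
  -- The two integrals contain the real and the imaginary part of `y²`, each multiplied by a real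
  -- component `φ (y₂)`.
  have key : ∀ φ : 𝕜 →L[ℝ] ℝ, (∫ s in (0 : ℝ)..L, g.normalDerivCurvature γ ν s *
        (RCLike.re (y s) * (RCLike.re (y s) * φ (y₂ s)) -
          RCLike.im (y s) * (RCLike.im (y s) * φ (y₂ s))) = 0) ∧
      ∫ s in (0 : ℝ)..L, g.normalDerivCurvature γ ν s *
        (2 * (RCLike.re (y s) * (RCLike.im (y s) * φ (y₂ s)))) = 0 := by
    intro φ
    have hφ : Continuous fun s => φ (y₂ s) := φ.continuous.comp hyc₂
    have hzero := fun ψ χ : 𝕜 →L[ℝ] ℝ => SurfaceMetric.integral_normalDerivCurvature_mul_eq_zero hL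
      (fun η hη => hg.periodic hγ hL hper hη) hγ hν (hy.isJacobiPair_comp ψ)
      (hy.isJacobiPair_comp χ) (hy₂.isJacobiPair_comp φ)
    have h1 := hzero RCLike.reCLM RCLike.reCLM
    have h2 := hzero RCLike.imCLM RCLike.imCLM
    have h3 := hzero RCLike.reCLM RCLike.imCLM
    simp only [RCLike.reCLM_apply, RCLike.imCLM_apply, mul_assoc] at h1 h2 h3
    constructor
    · simp_rw [mul_sub]
      rw [intervalIntegral.integral_sub (Continuous.intervalIntegrable (by fun_prop) _ _)
        (Continuous.intervalIntegrable (by fun_prop) _ _), h1, h2, sub_zero]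
    · simp_rw [mul_left_comm _ (2 : ℝ)]
      rw [intervalIntegral.integral_const_mul, h3, mul_zero]
  have hint : IntervalIntegrable
      (fun s => ((g.normalDerivCurvature γ ν s : ℝ) : 𝕜) * y s ^ 2 * y₂ s)
      MeasureTheory.volume 0 L :=
    ((((RCLike.continuous_ofReal.comp hτ).mul (hyc.pow 2)).mul hyc₂)).intervalIntegrable _ _
  -- Covers both parts of `y² y₂`: the real part has `φ = re`, `ψ = im`, `k = -1`, the imaginary
  -- part `φ = im`, `ψ = re`, `k = 1`.
  have hsplit : ∀ φ ψ : 𝕜 →L[ℝ] ℝ, ∀ k : ℝ, ∫ s in (0 : ℝ)..L, (g.normalDerivCurvature γ ν s *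
        (RCLike.re (y s) * (RCLike.re (y s) * φ (y₂ s)) -
          RCLike.im (y s) * (RCLike.im (y s) * φ (y₂ s))) + k * (g.normalDerivCurvature γ ν s *
        (2 * (RCLike.re (y s) * (RCLike.im (y s) * ψ (y₂ s)))))) = 0 := by
    intro φ ψ k
    have hφ : Continuous fun s => φ (y₂ s) := φ.continuous.comp hyc₂
    have hψ : Continuous fun s => ψ (y₂ s) := ψ.continuous.comp hyc₂
    rw [intervalIntegral.integral_add (Continuous.intervalIntegrable (by fun_prop) _ _)
      (Continuous.intervalIntegrable (by fun_prop) _ _), intervalIntegral.integral_const_mul,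
      (key φ).1, (key ψ).2, mul_zero, add_zero]
  refine RCLike.ext ?_ ?_
  · rw [map_zero, ← RCLike.reCLM_apply, ← RCLike.reCLM.intervalIntegral_comp_comm hint]
    refine Eq.trans ?_ (hsplit RCLike.reCLM RCLike.imCLM (-1))
    refine intervalIntegral.integral_congr fun s _ => ?_
    simp only [RCLike.reCLM_apply, RCLike.imCLM_apply, RCLike.mul_re, RCLike.mul_im, pow_two,
      RCLike.ofReal_re, RCLike.ofReal_im]
    ring
  · rw [map_zero, ← RCLike.imCLM_apply, ← RCLike.imCLM.intervalIntegral_comp_comm hint]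
    refine Eq.trans ?_ (hsplit RCLike.imCLM RCLike.reCLM 1)
    refine intervalIntegral.integral_congr fun s _ => ?_
    simp only [RCLike.reCLM_apply, RCLike.imCLM_apply, RCLike.mul_re, RCLike.mul_im, pow_two,
      RCLike.ofReal_re, RCLike.ofReal_im]
    ring
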